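/- **Setting.** Let $X\subset\mathbb R^m$, $Y\subset\mathbb R^n$ be convex and compact, $F(x,y)=\mathbb E_{\zeta\sim\mathcal D_\zeta}[f(x,y;\zeta)]$, $G(x,y)=\mathbb E_{\xi\sim\mathcal D_\xi}[g(x,y;\xi)]$, $H=(H_1,\dots,H_p)$, and assume: * $F,G,H_i$ are $C^1$ near $X\times Y$, and on $X\times Y$ the gradients $\nabla F,\nabla G,\nabla H_i$ are $L_F,L_G,L_H$-Lipschitz; * for each $x\in X$, $G(x,\cdot)$ is $\mu_G$-strongly convex on $Y$ ($\mu_G>0$) and every $H_i(x,\cdot)$ is convex on $Y$; * on $X\times Y$, $\|\nabla G\|\le M_{G,1}$, $|H_i|\le M_{H,0}$, $\|\nabla H_i\|\le M_{H,1}$; * $\nabla f(x,y;\zeta)$, $\nabla g(x,y;\xi)$ are unbiased estimators of $\nabla F$, $\nabla G$ on $X\times Y$, with variance (expected squared deviation) at most $\sigma_f^2$, $\sigma_g^2$. Fix $\gamma_1,\gamma_2>0$, $B\ge0$, $\eta\ge1/\mu_G$, $\rho\ge1/\gamma_2$, and let $$\mathcal L(x,y,z)=G(x,y)+\tfrac1{2\gamma_1}\sum_{i=1}^p\big([\gamma_1z_i+H_i(x,y)]_+^2-\gamma_1^2z_i^2\big),\qquad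 \ell(x,z,w,\lambda)=\mathcal L(x,w,\lambda)-\tfrac{\gamma_2}2\|\lambda-z\|^2,$$ $$E(x,z)=\max_{\lambda\in\mathbb R^p_+}\min_{w\in Y}\ell(x,z,w,\lambda),\qquad \mathcal U=X\times Y\times[0,p^{-1/2}B]^p,$$ $$\Psi(x,y,z)=F(x,y)+c_1\big(G(x,y)-E(x,z)\big)+\tfrac{c_2}2\sum_{i=1}^p[H_i(x,y)]_+^2,\qquad c_1,c_2>0,$$ and write $\ell(x,z,w,\lambda;\xi)$ for $\ell$ with $g(\cdot;\xi)$ in place of $G$. Let $\mathcal N_{\mathcal U}(\mathbf u)$ be the normal cone of $\mathcal U$ at $\mathbf u$ and $S(\mathbf u)=\mathrm{dist}(0,\nabla\Psi(\mathbf u)+\mathcal N_{\mathcal U}(\mathbf u))$. **Algorithm (SALVF).** Start at $\mathbf u^0\in\mathcal U$. In iteration $k=0,1,\dots,K-1$, at $\mathbf u^k=(x^k,y^k,z^k)$, draw fresh independent samples $\xi^k_0,\dots,\xi^k_{s-1}\sim\mathcal D_\xi$, $\zeta^k_1,\dots,\zeta^k_r\sim\mathcal D_\zeta$, $\tilde\xi^k_1,\dots,\tilde\xi^k_q\sim\mathcal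 D_\xi$. From any $w^{k,0}\in Y$ and $\lambda^{k,0}=0$ compute, for $j=0,\dots,s-1$, $$w^{k,j+1}=\mathrm{Proj}_Y\big(w^{k,j}-\tfrac{\eta}{j+1}\nabla_w\ell(x^k,z^k,w^{k,j},\lambda^{k,j};\xi^k_j)\big),\quad \lambda^{k,j+1}=\mathrm{Proj}_{\mathbb R^p_+}\big(\lambda^{k,j}+\tfrac{\rho}{j+1}\nabla_\lambda\ell(x^k,z^k,w^{k,j},\lambda^{k,j})\big),$$ put $(w^k,\lambda^k)=(w^{k,s},\lambda^{k,s})$, and set $\mathbf u^{k+1}=\mathrm{Proj}_{\mathcal U}(\mathbf u^k-\alpha d^k)$ with $$d^k=\frac1r\sum_{j=1}^r\nabla f(x^k,y^k;\zeta^k_j)+\frac{c_1}q\sum_{j=1}^q\big(\nabla g(x^k,y^k;\tilde\xi^k_j)-\nabla_{(x,y,z)}\ell(x^k,z^k,w^k,\lambda^k;\tilde\xi^k_j)\big)+c_2\sum_{i=1}^p[H_i(x^k,y^k)]_+\nabla H_i(x^k,y^k).$$ The output index $R$ is independent of all samples and uniform on $\{1,\dots,K\}$, or, in a variant, uniform on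 $\{0,\dots,K-1\}$ (i.e. $\mathrm{Prob}(R=k)\propto\alpha_k$ for the constant step size $\alpha$). **Claim.** There are constants $C_L,C>0$ depending only on $p,\gamma_1,\gamma_2,\eta,\rho,B$ and on $L_F,L_G,L_H,\mu_G,M_{G,1},M_{H,0},M_{H,1},\sigma_f,\sigma_g$ such that the following hold. 1. $\Psi$ is differentiable at every point of $\mathcal U$, and $\nabla\Psi$ is Lipschitz on $\mathcal U$ with modulus $C_L(1+c_1+c_2)$. 2. Let $L_\Psi$ be any Lipschitz modulus of $\nabla\Psi$ on $\mathcal U$, $0<\alpha<\frac1{2L_\Psi}$ (any $\alpha>0$ if $L_\Psi=0$), $K,r,q,s\ge1$, and let $\Delta$ satisfy $\Psi(\mathbf u^0)-\min_{\mathcal U}\Psi\le\Delta$. If $R$ is uniform on $\{1,\dots,K\}$, then $$\mathbb E\big[\mathrm{dist}(0,\nabla\Psi(\mathbf u^R)+\mathcal N_{\mathcal U}(\mathbf u^R))^2\big]\le C\Big(\frac{\Delta}{\alpha K}+\frac1r+\frac{c_1^2}q+\frac{c_1^2}s\Big);$$ if $R$ is uniform on $\{0,\dots,K-1\}$, the same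 holds with $S(\mathbf u^0)^2/K$ added on the right. 3. For all $\underline c>0$ and $\Delta\ge0$ there are $a,A,C'>0$, depending only on $\underline c,\Delta$ and the quantities above, such that for all $c_1\ge\underline c$, $c_2>0$, $0<\epsilon\le1$, with $c=\max(c_1,c_2)$, the choice $$\alpha=\frac ac,\quad r=\Big\lceil\frac A\epsilon\Big\rceil,\quad q=s=\Big\lceil\frac{A c_1^2}\epsilon\Big\rceil,\quad K=\Big\lceil\frac{Ac}\epsilon\Big\rceil$$ satisfies $\alpha<\frac1{2C_L(1+c_1+c_2)}$, uses $rK\le C'c\,\epsilon^{-2}$ samples of $\zeta$ and $(s+q)K\le C'c\,c_1^2\,\epsilon^{-2}$ samples of $\xi$, and, whenever $\Psi(\mathbf u^0)-\min_{\mathcal U}\Psi\le\Delta$, gives $\mathbb E[S(\mathbf u^R)^2]\le\epsilon$ for $R$ uniform on $\{1,\dots,K\}$, and, if moreover $S(\mathbf u^0)^2\le c\Delta$, also for $R$ uniform on $\{0,\dots,K-1\}$. In particular the sample complexity on $(\zeta,\xi)$ is $\big(\widetilde O(c\epsilon^{-2}),\widetilde O(c\,c_1^2\epsilon^{-2})\big)$.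 -/

import Mathlib

open MeasureTheory ProbabilityTheory
open scoped Gradient NNReal

universe u₁ u₂ u₃

noncomputable section

namespace SALVF

/-- The Euclidean space `ℝᵈ`. -/
abbrev Vec (d : ℕ) : Type := EuclideanSpace ℝ (Fin d)

/-- The space `ℝᵐ × ℝⁿ` of pairs `(x, y)`, with the Euclidean norm. -/
abbrev XY (m n : ℕ) : Type := WithLp 2 (Vec m × Vec n)

/-- The space `ℝᵐ × ℝⁿ × ℝᵖ` of triples `u = ((x, y), z)`, with the Euclidean norm. -/
abbrev XYZ (m n p : ℕ) : Type := WithLp 2 (XY m n × Vec p)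

/-- The pair `(x, y)` as a point of `ℝᵐ × ℝⁿ`. -/
def pair {m n : ℕ} (x : Vec m) (y : Vec n) : XY m n := WithLp.toLp 2 (x, y)

open Classical in
/-- A point of `S` nearest to `v`: the metric projection, when `S` is closed, convex, nonempty
(then the nearest point exists and is unique). -/
def proj {E : Type*} [NormedAddCommGroup E] (S : Set E) (v : E) : E :=
  if h : ∃ w ∈ S, ∀ w' ∈ S, ‖v - w‖ ≤ ‖v - w'‖ then h.choose else v

/-- The normal cone of the set `S` at `y`. -/
def normalCone {E : Type*} [NormedAddCommGroup E] [InnerProductSpace ℝ E] (S : Set E) (y : E) :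
    Set E :=
  {v | ∀ w ∈ S, inner ℝ v (w - y) ≤ 0}

/-- The nonnegative orthant of `ℝᵖ`. -/
def orthant (p : ℕ) : Set (Vec p) := {l | ∀ i, 0 ≤ l i}

/-- The data of a stochastic bilevel problem with lower-level constraints:
`min_{x ∈ X} F(x, y*(x))`, where `y*(x)` minimizes `G(x, ·)` over `{y ∈ Y | H(x, y) ≤ 0}`, and
`F = 𝔼 f(·; ζ)`, `G = 𝔼 g(·; ξ)`. -/
structure Problem (m n p : ℕ) (Ωξ : Type u₁) (Ωζ : Type u₂)
    [MeasurableSpace Ωξ] [MeasurableSpace Ωζ] where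
  X : Set (Vec m)
  Y : Set (Vec n)
  f : XY m n → Ωζ → ℝ
  g : XY m n → Ωξ → ℝ
  H : Fin p → XY m n → ℝ
  Dξ : Measure Ωξ
  Dζ : Measure Ωζ

/-- Smoothness, convexity, boundedness and variance constants of a problem. -/
structure Constants where
  LF : ℝ
  LG : ℝ
  LH : ℝ
  μG : ℝ
  MG : ℝ
  MH0 : ℝ
  MH1 : ℝ
  σf : ℝ
  σg : ℝ

/-- Fixed parameters: the penalty parameter `γ₁` and the regularization parameter `γ₂` of the
augmented Lagrangian envelope, the primal and dual inner step size constants `η`, `ρ`, and the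
bound `B` that defines the box of the variable `z`. -/
structure Params where
  γ₁ : ℝ
  γ₂ : ℝ
  η : ℝ
  ρ : ℝ
  B : ℝ

namespace Problem

variable {m n p : ℕ} {Ωξ : Type u₁} {Ωζ : Type u₂} [MeasurableSpace Ωξ] [MeasurableSpace Ωζ]
variable (P : Problem m n p Ωξ Ωζ)

/-- The set `X × Y`. -/
def dom : Set (XY m n) := {v | v.fst ∈ P.X ∧ v.snd ∈ P.Y}

/-- The upper-level objective `F = 𝔼 f(·; ζ)`. -/
def F (v : XY m n) : ℝ := ∫ ζ, P.f v ζ ∂P.Dζ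

/-- The lower-level objective `G = 𝔼 g(·; ξ)`. -/
def G (v : XY m n) : ℝ := ∫ ξ, P.g v ξ ∂P.Dξ

/-- The stochastic gradient `∇f(x, y; ζ)` with respect to `(x, y)`. -/
def gradf (v : XY m n) (ζ : Ωζ) : XY m n := ∇ (fun v' => P.f v' ζ) v

/-- The stochastic gradient `∇g(x, y; ξ)` with respect to `(x, y)`. -/
def gradg (v : XY m n) (ξ : Ωξ) : XY m n := ∇ (fun v' => P.g v' ξ) v

/-- The standing assumptions. Only values on `X × Y`, and continuous differentiability near its
points, matter. -/
structure Assumptions (κ : Constants) : Prop where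
  X_compact : IsCompact P.X
  X_convex : Convex ℝ P.X
  Y_compact : IsCompact P.Y
  Y_convex : Convex ℝ P.Y
  prob_ξ : IsProbabilityMeasure P.Dξ
  prob_ζ : IsProbabilityMeasure P.Dζ
  -- Smoothness: `F`, `G`, `H` are continuously differentiable with Lipschitz gradients.
  F_smooth : ∀ v ∈ P.dom, ContDiffAt ℝ 1 P.F v
  G_smooth : ∀ v ∈ P.dom, ContDiffAt ℝ 1 P.G v
  H_smooth : ∀ i, ∀ v ∈ P.dom, ContDiffAt ℝ 1 (P.H i) v
  F_lip : ∀ v ∈ P.dom, ∀ v' ∈ P.dom, ‖∇ P.F v - ∇ P.F v'‖ ≤ κ.LF * ‖v - v'‖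
  G_lip : ∀ v ∈ P.dom, ∀ v' ∈ P.dom, ‖∇ P.G v - ∇ P.G v'‖ ≤ κ.LG * ‖v - v'‖
  H_lip : ∀ i, ∀ v ∈ P.dom, ∀ v' ∈ P.dom, ‖∇ (P.H i) v - ∇ (P.H i) v'‖ ≤ κ.LH * ‖v - v'‖
  -- Convexity of the lower-level problem.
  G_convex : ∀ x ∈ P.X, StrongConvexOn P.Y κ.μG (fun y => P.G (pair x y))
  H_convex : ∀ i, ∀ x ∈ P.X, ConvexOn ℝ P.Y (fun y => P.H i (pair x y))
  -- Boundedness.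
  G_grad_bdd : ∀ v ∈ P.dom, ‖∇ P.G v‖ ≤ κ.MG
  H_bdd : ∀ i, ∀ v ∈ P.dom, |P.H i v| ≤ κ.MH0
  H_grad_bdd : ∀ i, ∀ v ∈ P.dom, ‖∇ (P.H i) v‖ ≤ κ.MH1
  -- Stochastic oracles: measurable, unbiased, of bounded variance.
  f_int : ∀ v ∈ P.dom, Integrable (P.f v) P.Dζ
  g_int : ∀ v ∈ P.dom, Integrable (P.g v) P.Dξ
  f_diff : ∀ v ∈ P.dom, ∀ᵐ ζ ∂P.Dζ, DifferentiableAt ℝ (fun v' => P.f v' ζ) v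
  g_diff : ∀ v ∈ P.dom, ∀ᵐ ξ ∂P.Dξ, DifferentiableAt ℝ (fun v' => P.g v' ξ) v
  f_meas : Measurable (fun a : P.dom × Ωζ => P.gradf a.1 a.2)
  g_meas : Measurable (fun a : P.dom × Ωξ => P.gradg a.1 a.2)
  f_memLp : ∀ v ∈ P.dom, MemLp (P.gradf v) 2 P.Dζ
  g_memLp : ∀ v ∈ P.dom, MemLp (P.gradg v) 2 P.Dξ
  f_unbiased : ∀ v ∈ P.dom, ∫ ζ, P.gradf v ζ ∂P.Dζ = ∇ P.F v
  g_unbiased : ∀ v ∈ P.dom, ∫ ξ, P.gradg v ξ ∂P.Dξ = ∇ P.G v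
  f_var : ∀ v ∈ P.dom, ∫ ζ, ‖P.gradf v ζ - ∇ P.F v‖ ^ 2 ∂P.Dζ ≤ κ.σf ^ 2
  g_var : ∀ v ∈ P.dom, ∫ ξ, ‖P.gradg v ξ - ∇ P.G v‖ ^ 2 ∂P.Dξ ≤ κ.σg ^ 2

/-- The augmented Lagrangian
`L_{γ₁}(x, y, z) = G(x, y) + (1 / 2γ₁) ∑ᵢ ([γ₁ zᵢ + Hᵢ(x, y)]₊² - γ₁² zᵢ²)`. -/
def augLagrangian (γ₁ : ℝ) (x : Vec m) (y : Vec n) (z : Vec p) : ℝ :=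
  P.G (pair x y) +
    1 / (2 * γ₁) * ∑ i, ((max 0 (γ₁ * z i + P.H i (pair x y))) ^ 2 - γ₁ ^ 2 * z i ^ 2)

/-- The augmented dual function `D(x, z) = min_{y ∈ Y} L_{γ₁}(x, y, z)`. -/
def dualFn (γ₁ : ℝ) (x : Vec m) (z : Vec p) : ℝ := ⨅ y : P.Y, P.augLagrangian γ₁ x y z

/-- Its envelope `E(x, z) = max_{l ≥ 0} (D(x, l) - (γ₂ / 2) ‖l - z‖²)`. -/
def envelope (γ₁ γ₂ : ℝ) (x : Vec m) (z : Vec p) : ℝ :=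
  ⨆ l : orthant p, (P.dualFn γ₁ x l - γ₂ / 2 * ‖(l : Vec p) - z‖ ^ 2)

/-- The penalized objective
`Ψ(x, y, z) = F(x, y) + c₁ (G(x, y) - E(x, z)) + (c₂ / 2) ∑ᵢ [Hᵢ(x, y)]₊²`. -/
def Ψ (par : Params) (c₁ c₂ : ℝ) (u : XYZ m n p) : ℝ :=
  P.F u.fst + c₁ * (P.G u.fst - P.envelope par.γ₁ par.γ₂ u.fst.fst u.snd) +
    c₂ / 2 * ∑ i, (max 0 (P.H i u.fst)) ^ 2

/-- The feasible region `U = X × Y × [0, B / √p]ᵖ`. -/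
def U (par : Params) : Set (XYZ m n p) :=
  {u | u.fst ∈ P.dom ∧ ∀ i, 0 ≤ u.snd i ∧ u.snd i ≤ par.B / √p}

/-- The stationarity measure `dist(0, ∇Ψ(u) + N_U(u))`. -/
def stat (par : Params) (c₁ c₂ : ℝ) (u : XYZ m n p) : ℝ :=
  Metric.infDist 0 ((fun v => ∇ (P.Ψ par c₁ c₂) u + v) '' normalCone (P.U par) u)

/-- The stochastic gradient in `(x, w)` of the augmented Lagrangian at `(x, w)` with multiplier
`l`: `∇g(x, w; ξ) + (1 / γ₁) ∑ᵢ [γ₁ lᵢ + Hᵢ(x, w)]₊ ∇Hᵢ(x, w)`. Its two components are the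
stochastic gradients in `x` and in `w` of
`ℓ(x, z, w, l; ξ) = L_{γ₁}(x, w, l; ξ) - (γ₂ / 2) ‖l - z‖²`. -/
def gradL (γ₁ : ℝ) (x : Vec m) (w : Vec n) (l : Vec p) (ξ : Ωξ) : XY m n :=
  P.gradg (pair x w) ξ +
    (1 / γ₁) • ∑ i, (max 0 (γ₁ * l i + P.H i (pair x w))) • ∇ (P.H i) (pair x w)

/-- The gradient in `l` of `ℓ(x, z, w, l)`: `[γ₁ l + H(x, w)]₊ - γ₁ l - γ₂ (l - z)`. -/
def gradDual (γ₁ γ₂ : ℝ) (x : Vec m) (z : Vec p) (w : Vec n) (l : Vec p) : Vec p :=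
  WithLp.toLp 2 fun i =>
    max 0 (γ₁ * l i + P.H i (pair x w)) - γ₁ * l i - γ₂ * (l i - z i)

/-- The inner iterates `(w^j, l^j)`: projected stochastic gradient descent in `w`, ascent in `l`,
with step sizes `η / (j + 1)` and `ρ / (j + 1)`, started at `(w₀, 0)`; step `j < s` uses the
sample `ξ j`. -/
def salmIter (par : Params) (x : Vec m) (z : Vec p) (w₀ : Vec n) {s : ℕ} (ξ : Fin s → Ωξ) :
    ℕ → Vec n × Vec p
  | 0 => (w₀, 0)
  | j + 1 =>
    let a := salmIter par x z w₀ ξ j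
    if h : j < s then
      (proj P.Y (a.1 - (par.η / (j + 1)) • (P.gradL par.γ₁ x a.1 a.2 (ξ ⟨j, h⟩)).snd),
        proj (orthant p) (a.2 + (par.ρ / (j + 1)) • P.gradDual par.γ₁ par.γ₂ x z a.1 a.2))
    else a

/-- The output `(w^s, l^s)` of the inner loop. -/
def salm (par : Params) (x : Vec m) (z : Vec p) (w₀ : Vec n) {s : ℕ} (ξ : Fin s → Ωξ) :
    Vec n × Vec p :=
  P.salmIter par x z w₀ ξ s

/-- The mini-batch direction at `u = (x, y, z)`, given the inner output `(w, l)`: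
`∇f(x, y; ζ) + c₁ (∇g(x, y; ξ') - ∇ℓ(x, z, w, l; ξ')) + c₂ ∑ᵢ [Hᵢ(x, y)]₊ ∇Hᵢ(x, y)`,
with `∇` the gradient in `(x, y, z)` for fixed `(w, l)` and with averages over the samples. -/
def direction (par : Params) (c₁ c₂ : ℝ) (u : XYZ m n p) (w : Vec n) (l : Vec p)
    {r q : ℕ} (ζ : Fin r → Ωζ) (ξ' : Fin q → Ωξ) : XYZ m n p :=
  WithLp.toLp 2
    ((1 / (r : ℝ)) • ∑ j, P.gradf u.fst (ζ j) +
        c₁ • ((1 / (q : ℝ)) • ∑ j, P.gradg u.fst (ξ' j) -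
          pair ((1 / (q : ℝ)) • ∑ j, (P.gradL par.γ₁ u.fst.fst w l (ξ' j)).fst) 0) +
        c₂ • ∑ i, (max 0 (P.H i u.fst)) • ∇ (P.H i) u.fst,
      c₁ • (-(par.γ₂ • (l - u.snd))))

end Problem

/-- The samples drawn in one outer iteration: `s` samples of `ξ` for the inner loop, `r` samples of
`ζ` and `q` further samples of `ξ` for the outer gradient. -/
abbrev Batch (Ωξ : Type u₁) (Ωζ : Type u₂) (s r q : ℕ) : Type (max u₁ u₂) :=
  (Fin s → Ωξ) × (Fin r → Ωζ) × (Fin q → Ωξ)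

namespace Problem

variable {m n p : ℕ} {Ωξ : Type u₁} {Ωζ : Type u₂} [MeasurableSpace Ωξ] [MeasurableSpace Ωζ]
variable (P : Problem m n p Ωξ Ωζ)

/-- The joint law of the samples of one outer iteration: all independent. -/
def batchLaw (s r q : ℕ) : Measure (Batch Ωξ Ωζ s r q) :=
  (Measure.pi fun _ : Fin s => P.Dξ).prod
    ((Measure.pi fun _ : Fin r => P.Dζ).prod (Measure.pi fun _ : Fin q => P.Dξ))

/-- The outer iterates `u^k`, as a function of the samples `b 0, b 1, …` of the successive
iterations: `u^{k+1} = Proj_U (u^k - α d^k)`. The inner loop of iteration `k` starts at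
`(w₀ k, 0)`. -/
def iterate (par : Params) (c₁ c₂ α : ℝ) {s r q : ℕ} (w₀ : ℕ → Vec n) (u₀ : XYZ m n p)
    (b : ℕ → Batch Ωξ Ωζ s r q) : ℕ → XYZ m n p
  | 0 => u₀
  | k + 1 =>
    let u := iterate par c₁ c₂ α w₀ u₀ b k
    let a := P.salm par u.fst.fst u.snd (w₀ k) (b k).1
    proj (P.U par) (u - α • P.direction par c₁ c₂ u a.1 a.2 (b k).2.1 (b k).2.2)

/-- On the probability space `(Ω, Pr)`, the batches `b k` are independent with law `batchLaw`, and
the output index `R` is uniform on the finite set `S` and independent of all the batches. -/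
structure IsSampling {Ω : Type u₃} [MeasurableSpace Ω] (Pr : Measure Ω) {s r q : ℕ}
    (b : ℕ → Ω → Batch Ωξ Ωζ s r q) (S : Finset ℕ) (R : Ω → ℕ) : Prop where
  prob : IsProbabilityMeasure Pr
  b_meas : ∀ k, Measurable (b k)
  b_law : ∀ k, Pr.map (b k) = P.batchLaw s r q
  b_indep : iIndepFun b Pr
  R_meas : Measurable R
  R_law : ∀ k ∈ S, Pr.real {ω | R ω = k} = 1 / (S.card : ℝ)
  R_indep : IndepFun R (fun ω k => b k ω) Pr

/-- `𝔼[dist(0, ∇Ψ(u^R) + N_U(u^R))²] ≤ τ`, the expectation being that of an integrable variable. -/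
def ExpStatLE (par : Params) (c₁ c₂ α : ℝ) {s r q : ℕ} (w₀ : ℕ → Vec n) (u₀ : XYZ m n p)
    {Ω : Type u₃} [MeasurableSpace Ω] (Pr : Measure Ω) (b : ℕ → Ω → Batch Ωξ Ωζ s r q) (R : Ω → ℕ)
    (τ : ℝ) : Prop :=
  Integrable
      (fun ω => P.stat par c₁ c₂ (P.iterate par c₁ c₂ α w₀ u₀ (fun k => b k ω) (R ω)) ^ 2) Pr ∧
    ∫ ω, P.stat par c₁ c₂ (P.iterate par c₁ c₂ α w₀ u₀ (fun k => b k ω) (R ω)) ^ 2 ∂Pr ≤ τ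

end Problem

end SALVF

end

/-!
Everything rests on the saddle point `(w, l)` of `ℓ(x, z, ·, ·)` on `Y × ℝᵖ₊`. The maximization over
`l` splits into scalar problems with an explicit solution `dualArg`, at which the slope in `l`
vanishes; minimizing the resulting function of `w` over the compact set `Y` gives a saddle point
(`exists_isSaddle`). Since `ℓ` is `μ`-strongly convex in `w` and `γ₂`-strongly concave in `l`, the
saddle operator is strongly monotone (`IsSaddle.strong_monotone`).

*Smoothness of `Ψ`.* The envelope `E` is squeezed between two models at `u`: from above by the
maximum over `l` of `ℓ(x', z', w, l)` for the fixed `w`, which has a quadratic upper model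
(`dualTerm_le_model`), and from below by the minimum over `w'` of `ℓ(x', z', w', l)` for the fixed
`l`, which has a linear lower model because `w` is its unique minimizer at `u`. Both have the
gradient of `ℓ` in `(x, z)` at the saddle point, hence so has `E`
(`IsSaddle.hasGradientAt_envelope`). Strong monotonicity makes the saddle point Lipschitz in
`(x, z)` (`IsSaddle.norm_sub_le`), and then `∇Ψ` is Lipschitz (`norm_gradient_Ψ_sub_le`).

*Inner loop.* Nonexpansiveness of the projections and strong monotonicity give, for the squared
distance to the saddle point with the weights `1 / η` and `1 / ρ`, the recursion
`a_{j+1} ≤ (1 - 2 / (j + 1)) a_j + V / (j + 1)²` in expectation, whence `𝔼 a_s ≤ V / s`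
(`IsSaddle.lintegral_potential_salmIter_le`). The multipliers stay in a fixed box although `ℝᵖ₊` is
unbounded (`proj_dual_step_mem`), which bounds the gradients. The direction `d^k` is then within
`O(1 / r + c₁² / q + c₁² / s)` of `∇Ψ(u^k)` in mean square (`lintegral_sq_norm_direction_sub_le`).

*Outer loop.* One projected step decreases `Ψ` by a multiple of the squared stationarity measure at
the new point, up to the error of the direction (`sq_infDist_normalCone_proj_le`). Summing over the
iterations and averaging over the independent output index gives the rate. The stationarity measure
is measurable because it is lower semicontinuous (`lowerSemicontinuous_infDist_normalCone`).

Expectations are estimated as integrals with values in `[0, ∞]`, so that integrability comes out at the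
end instead of being needed along the way.
-/

noncomputable section

namespace SALVF

open Filter Topology

/-! ### Projections and first-order inequalities -/

theorem proj_eq_self {E : Type*} [NormedAddCommGroup E] {S : Set E} {w : E} (hw : w ∈ S) :
    proj S w = w := by
  have hex : ∃ a ∈ S, ∀ w' ∈ S, ‖w - a‖ ≤ ‖w - w'‖ := ⟨w, hw, fun w' _ => by simp⟩
  have hproj : proj S w = hex.choose := by rw [proj, dif_pos hex]
  have := hex.choose_spec.2 w hw
  rw [← hproj, sub_self, norm_zero, norm_le_zero_iff, sub_eq_zero] at this
  exact this.symm

section Hilbert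

variable {E : Type*} [NormedAddCommGroup E] [InnerProductSpace ℝ E] [CompleteSpace E] {S : Set E}

theorem proj_mem_and_inner_le (hne : S.Nonempty) (hcl : IsClosed S) (hS : Convex ℝ S) (v : E) :
    proj S v ∈ S ∧ ∀ w ∈ S, inner ℝ (v - proj S v) (w - proj S v) ≤ 0 := by
  obtain ⟨a, ha, hmin⟩ := exists_norm_eq_iInf_of_complete_convex hne hcl.isComplete hS v
  have hbdd : BddBelow (Set.range fun w : S => ‖v - w‖) :=
    ⟨0, by rintro _ ⟨w, rfl⟩; exact norm_nonneg _⟩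
  have hex : ∃ w ∈ S, ∀ w' ∈ S, ‖v - w‖ ≤ ‖v - w'‖ :=
    ⟨a, ha, fun w' hw' => hmin ▸ ciInf_le hbdd ⟨w', hw'⟩⟩
  have hproj : proj S v = hex.choose := by rw [proj, dif_pos hex]
  obtain ⟨h1, h2⟩ := hex.choose_spec
  rw [← hproj] at h1 h2
  have : Nonempty S := hne.to_subtype
  refine ⟨h1, (norm_eq_iInf_iff_real_inner_le_zero hS h1).1 ?_⟩
  exact le_antisymm (le_ciInf fun w => h2 w w.2) (ciInf_le hbdd ⟨_, h1⟩)

theorem proj_mem (hne : S.Nonempty) (hcl : IsClosed S) (hS : Convex ℝ S) (v : E) :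
    proj S v ∈ S :=
  (proj_mem_and_inner_le hne hcl hS v).1

theorem inner_sub_proj_le (hne : S.Nonempty) (hcl : IsClosed S) (hS : Convex ℝ S) (v : E)
    {w : E} (hw : w ∈ S) : inner ℝ (v - proj S v) (w - proj S v) ≤ 0 :=
  (proj_mem_and_inner_le hne hcl hS v).2 w hw

theorem norm_proj_sub_proj_le (hne : S.Nonempty) (hcl : IsClosed S) (hS : Convex ℝ S) (v v' : E) :
    ‖proj S v - proj S v'‖ ≤ ‖v - v'‖ := by
  have h1 := inner_sub_proj_le hne hcl hS v (proj_mem hne hcl hS v')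
  have h2 := inner_sub_proj_le hne hcl hS v' (proj_mem hne hcl hS v)
  have h3 : ‖proj S v - proj S v'‖ ^ 2 ≤ inner ℝ (v - v') (proj S v - proj S v') := by
    rw [← real_inner_self_eq_norm_sq]
    have e : inner ℝ (v - v') (proj S v - proj S v')
        - inner ℝ (proj S v - proj S v') (proj S v - proj S v')
        = - inner ℝ (v - proj S v) (proj S v' - proj S v)
          - inner ℝ (v' - proj S v') (proj S v - proj S v') := by
      rw [← neg_sub (proj S v) (proj S v'), inner_neg_right]
      simp only [inner_sub_left, inner_sub_right]
      ring
    linarith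
  have h4 := h3.trans (real_inner_le_norm _ _)
  by_contra! h
  have : 0 < ‖proj S v - proj S v'‖ := (norm_nonneg _).trans_lt h
  nlinarith

theorem continuous_proj (hne : S.Nonempty) (hcl : IsClosed S) (hS : Convex ℝ S) :
    Continuous (proj S) :=
  (LipschitzWith.of_dist_le_mul (K := 1) fun v v' => by
    simpa [dist_eq_norm] using norm_proj_sub_proj_le hne hcl hS v v').continuous

theorem norm_proj_sub_le (hne : S.Nonempty) (hcl : IsClosed S) (hS : Convex ℝ S) (v : E)
    {w : E} (hw : w ∈ S) : ‖proj S v - w‖ ≤ ‖v - w‖ := by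
  simpa [proj_eq_self hw] using norm_proj_sub_proj_le hne hcl hS v w

theorem hasDerivAt_line {f : E → ℝ} {g a : E} (hg : HasGradientAt f g a) (d : E) :
    HasDerivAt (fun t : ℝ => f (a + t • d)) (inner ℝ g d) 0 := by
  have hl : HasDerivAt (fun t : ℝ => a + t • d) d 0 := by
    simpa using ((hasDerivAt_id (0 : ℝ)).smul_const d).const_add a
  have hg' : HasFDerivAt f (InnerProductSpace.toDual ℝ E g) (a + (0 : ℝ) • d) := by
    simpa using hg.hasFDerivAt
  have := hg'.comp_hasDerivAt (0 : ℝ) hl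
  rw [InnerProductSpace.toDual_apply_apply] at this
  exact this

/-- If the difference quotients of `f` at `a` in the direction `d` are at most `φ t` for small
`t > 0`, the directional derivative is at most `lim φ`. -/
theorem inner_gradient_le_of_slope_le {f : E → ℝ} {g a d : E} (hg : HasGradientAt f g a)
    {φ : ℝ → ℝ} (hφ : ContinuousAt φ 0)
    (h : ∀ t : ℝ, 0 < t → t ≤ 1 → f (a + t • d) - f a ≤ t * φ t) :
    inner ℝ g d ≤ φ 0 := by
  have h1 := (hasDerivAt_line hg d).tendsto_slope_zero_right
  refine le_of_tendsto_of_tendsto h1 (hφ.tendsto.mono_left nhdsWithin_le_nhds) ?_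
  have : Set.Ioc (0 : ℝ) 1 ∈ 𝓝[>] (0 : ℝ) := Ioc_mem_nhdsGT one_pos
  filter_upwards [this] with t ht
  simp only [zero_add, zero_smul, add_zero, smul_eq_mul]
  rw [inv_mul_le_iff₀ ht.1]
  exact h t ht.1 ht.2

theorem StrongConvexOn.add_inner_gradient_le {f : E → ℝ} {g a b : E} {μ : ℝ}
    (hf : StrongConvexOn S μ f) (ha : a ∈ S) (hb : b ∈ S) (hg : HasGradientAt f g a) :
    f a + inner ℝ g (b - a) + μ / 2 * ‖b - a‖ ^ 2 ≤ f b := by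
  have := inner_gradient_le_of_slope_le (d := b - a) hg
    (φ := fun t => f b - f a - (1 - t) * (μ / 2 * ‖b - a‖ ^ 2)) (by fun_prop) ?_
  · simp only [sub_zero, one_mul] at this
    linarith
  · intro t ht0 ht1
    have := hf.2 ha hb (sub_nonneg.2 ht1) ht0.le (by ring)
    have e : (1 - t) • a + t • b = a + t • (b - a) := by module
    rw [e, norm_sub_rev] at this
    simp only [smul_eq_mul] at this
    nlinarith

theorem ConvexOn.add_inner_gradient_le {f : E → ℝ} {g a b : E}
    (hf : ConvexOn ℝ S f) (ha : a ∈ S) (hb : b ∈ S) (hg : HasGradientAt f g a) :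
    f a + inner ℝ g (b - a) ≤ f b := by
  simpa using StrongConvexOn.add_inner_gradient_le (strongConvexOn_zero.2 hf) ha hb hg

/-- A point that minimizes `f` over a convex set up to a quadratic error satisfies the first-order
optimality condition. -/
theorem inner_gradient_nonneg_of_isMin_up_to_sq {f : E → ℝ} {g a w : E} {C : ℝ}
    (hS : Convex ℝ S) (ha : a ∈ S) (hg : HasGradientAt f g a)
    (hmin : ∀ w ∈ S, f a ≤ f w + C * ‖w - a‖ ^ 2) (hw : w ∈ S) :
    0 ≤ inner ℝ g (w - a) := by
  have hg' : HasGradientAt (fun x => - f x) (-g) a := by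
    have := hg.hasFDerivAt.neg
    rw [hasGradientAt_iff_hasFDerivAt, map_neg]
    exact this
  have := inner_gradient_le_of_slope_le (d := w - a) hg'
    (φ := fun t => t * (C * ‖w - a‖ ^ 2)) (by fun_prop) ?_
  · simp only [inner_neg_left, zero_mul] at this
    linarith
  · intro t ht0 ht1
    have := hmin _ (hS.add_smul_sub_mem ha hw ⟨ht0.le, ht1⟩)
    rw [add_sub_cancel_left, norm_smul, Real.norm_eq_abs, mul_pow, sq_abs] at this
    linarith

/-- The descent lemma on a convex set. -/
theorem le_add_inner_gradient_add_sq {f : E → ℝ} {L : ℝ} (hS : Convex ℝ S)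
    (hf : ∀ u ∈ S, DifferentiableAt ℝ f u)
    (hL : ∀ u ∈ S, ∀ u' ∈ S, ‖∇ f u - ∇ f u'‖ ≤ L * ‖u - u'‖)
    {u v : E} (hu : u ∈ S) (hv : v ∈ S) :
    f v ≤ f u + inner ℝ (∇ f u) (v - u) + L / 2 * ‖v - u‖ ^ 2 := by
  set d := v - u with hd
  have hmem : ∀ t ∈ Set.Icc (0 : ℝ) 1, u + t • d ∈ S := fun t ht =>
    hS.add_smul_sub_mem hu hv ht
  let φ : ℝ → ℝ := fun t => f (u + t • d) - t * inner ℝ (∇ f u) d - L / 2 * ‖d‖ ^ 2 * t ^ 2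
  have hφ : ∀ t ∈ Set.Icc (0 : ℝ) 1, HasDerivAt φ
      (inner ℝ (∇ f (u + t • d)) d - inner ℝ (∇ f u) d - L / 2 * ‖d‖ ^ 2 * (2 * t)) t := by
    intro t ht
    have h1 : HasDerivAt (fun t : ℝ => f (u + t • d)) (inner ℝ (∇ f (u + t • d)) d) t := by
      have := (hasDerivAt_line (hf _ (hmem t ht)).hasGradientAt d)
      have h2 : HasDerivAt (fun τ : ℝ => τ - t) 1 t := (hasDerivAt_id t).sub_const t
      rw [← sub_self t] at this
      have h3 := HasDerivAt.comp (h := fun τ : ℝ => τ - t) t this h2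
      simp only [mul_one] at h3
      refine h3.congr_of_eventuallyEq (Eventually.of_forall fun τ => ?_)
      simp only [Function.comp]
      congr 1
      module
    have h2 : HasDerivAt (fun t : ℝ => t * inner ℝ (∇ f u) d) (inner ℝ (∇ f u) d) t := by
      simpa using (hasDerivAt_id t).mul_const (inner ℝ (∇ f u) d)
    have h3 : HasDerivAt (fun t : ℝ => L / 2 * ‖d‖ ^ 2 * t ^ 2) (L / 2 * ‖d‖ ^ 2 * (2 * t)) t := by
      simpa using (hasDerivAt_pow 2 t).const_mul (L / 2 * ‖d‖ ^ 2)
    exact (h1.sub h2).sub h3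
  have hanti : AntitoneOn φ (Set.Icc 0 1) := by
    refine antitoneOn_of_deriv_nonpos (convex_Icc 0 1)
      (fun t ht => (hφ t ht).continuousAt.continuousWithinAt)
      (fun t ht => (hφ t (interior_subset ht)).differentiableAt.differentiableWithinAt) ?_
    intro t ht
    have ht' := interior_subset ht
    rw [(hφ t ht').deriv, ← inner_sub_left]
    have h1 := real_inner_le_norm (∇ f (u + t • d) - ∇ f u) d
    have h2 := hL _ (hmem t ht') u hu
    rw [add_sub_cancel_left, norm_smul, Real.norm_eq_abs, abs_of_nonneg ht'.1] at h2
    nlinarith [norm_nonneg d]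
  have := hanti (Set.left_mem_Icc.2 zero_le_one) (Set.right_mem_Icc.2 zero_le_one) zero_le_one
  simp only [φ, one_smul, zero_smul, add_zero, zero_mul, one_mul, one_pow, mul_one, sub_zero,
    ne_eq, OfNat.ofNat_ne_zero, not_false_eq_true, zero_pow, mul_zero] at this
  rw [show u + d = v by rw [hd]; abel] at this
  linarith

end Hilbert

/-! ### Positive parts -/

theorem abs_max_zero_sub_le (a b : ℝ) : |max 0 a - max 0 b| ≤ |a - b| :=
  (abs_max_sub_max_le_abs a b 0 |>.trans_eq' (by rw [max_comm a, max_comm b]))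

theorem sq_max_zero_add_le (a d : ℝ) :
    (max 0 (a + d)) ^ 2 ≤ (max 0 a) ^ 2 + 2 * max 0 a * d + d ^ 2 := by
  rcases max_cases 0 a with ⟨h, h'⟩ | ⟨h, h'⟩ <;>
    rcases max_cases 0 (a + d) with ⟨k, k'⟩ | ⟨k, k'⟩ <;>
    rw [h, k] <;> nlinarith

theorem le_sq_max_zero_add (a d : ℝ) :
    (max 0 a) ^ 2 + 2 * max 0 a * d ≤ (max 0 (a + d)) ^ 2 := by
  rcases max_cases 0 a with ⟨h, h'⟩ | ⟨h, h'⟩ <;>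
    rcases max_cases 0 (a + d) with ⟨k, k'⟩ | ⟨k, k'⟩ <;>
    rw [h, k] <;> nlinarith [sq_nonneg d]

theorem hasDerivAt_sq_max_zero (a : ℝ) :
    HasDerivAt (fun t : ℝ => (max 0 t) ^ 2) (2 * max 0 a) a := by
  rw [hasDerivAt_iff_isLittleO_nhds_zero]
  refine (Asymptotics.IsBigO.of_bound 1 (Eventually.of_forall fun h => ?_)).trans_isLittleO
    (Asymptotics.isLittleO_pow_id (n := 2) one_lt_two)
  have h1 := sq_max_zero_add_le a h
  have h2 := le_sq_max_zero_add a h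
  rw [Real.norm_eq_abs, Real.norm_eq_abs, abs_of_nonneg (sq_nonneg h), one_mul, abs_le, smul_eq_mul]
  constructor <;> nlinarith [sq_nonneg h]

/-! ### The dual variable: scalar inequalities -/

/-- The contribution of one constraint to `ℓ`, as a function of the constraint value `h`, the
parameter `z` and the multiplier `l`. -/
def dualTerm (γ₁ γ₂ h z l : ℝ) : ℝ :=
  1 / (2 * γ₁) * ((max 0 (γ₁ * l + h)) ^ 2 - γ₁ ^ 2 * l ^ 2) - γ₂ / 2 * (l - z) ^ 2

/-- The derivative of `dualTerm` in `l`. -/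
def dualSlope (γ₁ γ₂ h z l : ℝ) : ℝ := max 0 (γ₁ * l + h) - γ₁ * l - γ₂ * (l - z)

/-- The maximizer of `dualTerm` in `l`, for `z ≥ 0`. -/
def dualArg (γ₁ γ₂ h z : ℝ) : ℝ := max (z + h / γ₂) (γ₂ * z / (γ₁ + γ₂))

section Scalar

variable {γ₁ γ₂ : ℝ} (hγ₁ : 0 < γ₁) (hγ₂ : 0 < γ₂)
include hγ₁ hγ₂

theorem dualArg_nonneg {h z : ℝ} (hz : 0 ≤ z) : 0 ≤ dualArg γ₁ γ₂ h z :=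
  le_max_of_le_right (div_nonneg (mul_nonneg hγ₂.le hz) (add_pos hγ₁ hγ₂).le)

theorem dualArg_le {h z M : ℝ} (hz : 0 ≤ z) (hh : |h| ≤ M) :
    dualArg γ₁ γ₂ h z ≤ z + M / γ₂ := by
  have hM : 0 ≤ M := (abs_nonneg h).trans hh
  refine max_le ?_ ?_
  · gcongr
    exact (le_abs_self h).trans hh
  · have : γ₂ * z / (γ₁ + γ₂) ≤ z := by
      rw [div_le_iff₀ (by positivity)]
      nlinarith [mul_nonneg hγ₁.le hz]
    have : 0 ≤ M / γ₂ := by positivity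
    linarith

/-- At `dualArg` the slope vanishes, so that the constraint `l ≥ 0` is not active in the dual
optimality condition. -/
theorem dualSlope_dualArg {h z : ℝ} (hz : 0 ≤ z) :
    dualSlope γ₁ γ₂ h z (dualArg γ₁ γ₂ h z) = 0 := by
  have hs : 0 < γ₁ + γ₂ := by positivity
  have hz' : 0 ≤ γ₁ * z := mul_nonneg hγ₁.le hz
  unfold dualSlope dualArg
  rcases le_total (γ₂ * z / (γ₁ + γ₂)) (z + h / γ₂) with hle | hle
  · rw [max_eq_left hle]
    have h1 : 0 ≤ γ₁ * (z + h / γ₂) + h := by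
      rw [div_le_iff₀ hs] at hle
      have e : (z + h / γ₂) * (γ₁ + γ₂) = γ₁ * (z + h / γ₂) + h + γ₂ * z := by
        field_simp
        ring
      linarith
    rw [max_eq_right h1]
    field_simp
    ring
  · rw [max_eq_right hle]
    have h1 : γ₁ * (γ₂ * z / (γ₁ + γ₂)) + h ≤ 0 := by
      rw [le_div_iff₀ hs] at hle
      have e : (z + h / γ₂) * (γ₁ + γ₂) - γ₂ * z =
          (γ₁ * (γ₂ * z / (γ₁ + γ₂)) + h) * ((γ₁ + γ₂) / γ₂) := by
        field_simp
        ring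
      by_contra! hc
      have : 0 < (γ₁ * (γ₂ * z / (γ₁ + γ₂)) + h) * ((γ₁ + γ₂) / γ₂) := by positivity
      linarith
    rw [max_eq_left h1]
    field_simp
    ring

omit hγ₂ in
/-- `dualTerm` is `γ₂`-strongly concave in `l`. -/
theorem dualTerm_le (h z l l' : ℝ) :
    dualTerm γ₁ γ₂ h z l' ≤
      dualTerm γ₁ γ₂ h z l + dualSlope γ₁ γ₂ h z l * (l' - l) - γ₂ / 2 * (l' - l) ^ 2 := by
  have h1 := sq_max_zero_add_le (γ₁ * l + h) (γ₁ * (l' - l))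
  rw [show γ₁ * l + h + γ₁ * (l' - l) = γ₁ * l' + h by ring] at h1
  have h2 := mul_le_mul_of_nonneg_left h1 (by positivity : 0 ≤ 1 / (2 * γ₁))
  unfold dualTerm dualSlope
  have e : 1 / (2 * γ₁) * (max 0 (γ₁ * l + h) ^ 2 + 2 * max 0 (γ₁ * l + h) * (γ₁ * (l' - l)) +
      (γ₁ * (l' - l)) ^ 2) = 1 / (2 * γ₁) * max 0 (γ₁ * l + h) ^ 2 +
      max 0 (γ₁ * l + h) * (l' - l) + γ₁ / 2 * (l' - l) ^ 2 := by
    field_simp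
  have e1 : 1 / (2 * γ₁) * (γ₁ ^ 2 * l ^ 2) = γ₁ / 2 * l ^ 2 := by field_simp
  have e2 : 1 / (2 * γ₁) * (γ₁ ^ 2 * l' ^ 2) = γ₁ / 2 * l' ^ 2 := by field_simp
  rw [e] at h2
  rw [mul_sub, mul_sub, e1, e2]
  nlinarith

/-- The maximizer for the constraint value `h₀` is optimal for the value `h` up to a quadratic
error. -/
theorem dualTerm_le_dualArg_add_sq {h h₀ z l : ℝ} (hz : 0 ≤ z) :
    dualTerm γ₁ γ₂ h z l ≤
      dualTerm γ₁ γ₂ h z (dualArg γ₁ γ₂ h₀ z) + 1 / (2 * γ₂) * (h - h₀) ^ 2 := by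
  set a := dualArg γ₁ γ₂ h₀ z with ha
  have h1 := dualTerm_le (γ₂ := γ₂) hγ₁ h z a l
  have h0 : dualSlope γ₁ γ₂ h₀ z a = 0 := dualSlope_dualArg hγ₁ hγ₂ hz
  have h2 : |dualSlope γ₁ γ₂ h z a| ≤ |h - h₀| := by
    rw [← sub_zero (dualSlope γ₁ γ₂ h z a), ← h0]
    unfold dualSlope
    refine le_trans (le_of_eq ?_) ((abs_max_zero_sub_le (γ₁ * a + h) (γ₁ * a + h₀)).trans_eq ?_)
    · congr 1; ring
    · congr 1; ring
  have h3 : dualSlope γ₁ γ₂ h z a * (l - a) ≤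
      1 / (2 * γ₂) * (dualSlope γ₁ γ₂ h z a) ^ 2 + γ₂ / 2 * (l - a) ^ 2 := by
    have : 0 ≤ 1 / (2 * γ₂) * (dualSlope γ₁ γ₂ h z a - γ₂ * (l - a)) ^ 2 := by positivity
    have e : 1 / (2 * γ₂) * (dualSlope γ₁ γ₂ h z a - γ₂ * (l - a)) ^ 2 =
      1 / (2 * γ₂) * (dualSlope γ₁ γ₂ h z a) ^ 2 + γ₂ / 2 * (l - a) ^ 2 -
        dualSlope γ₁ γ₂ h z a * (l - a) := by
      field_simp
      ring
    linarith
  have h4 : 1 / (2 * γ₂) * (dualSlope γ₁ γ₂ h z a) ^ 2 ≤ 1 / (2 * γ₂) * (h - h₀) ^ 2 := by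
    gcongr 1 / (2 * γ₂) * ?_
    exact sq_le_sq.2 h2
  linarith

/-- A quadratic upper model of `dualTerm`, uniform in `l`, around the maximizer: the maximum over
`l` is differentiable in `(h, z)`. -/
theorem dualTerm_le_model {h h' z z' l : ℝ} (hz : 0 ≤ z) :
    dualTerm γ₁ γ₂ h' z' l ≤ dualTerm γ₁ γ₂ h z (dualArg γ₁ γ₂ h z)
      + 1 / γ₁ * max 0 (γ₁ * dualArg γ₁ γ₂ h z + h) * (h' - h)
      + γ₂ * (dualArg γ₁ γ₂ h z - z) * (z' - z)
      + ((1 / γ₂ + 1 / (2 * γ₁)) * (h' - h) ^ 2 + γ₂ * (z' - z) ^ 2) := by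
  set a := dualArg γ₁ γ₂ h z with ha
  have h1 := dualTerm_le (γ₂ := γ₂) hγ₁ h z a l
  rw [show dualSlope γ₁ γ₂ h z a = 0 from dualSlope_dualArg hγ₁ hγ₂ hz, zero_mul, add_zero] at h1
  have h2 := sq_max_zero_add_le (γ₁ * l + h) (h' - h)
  rw [show γ₁ * l + h + (h' - h) = γ₁ * l + h' by ring] at h2
  have h3 := mul_le_mul_of_nonneg_left h2 (by positivity : 0 ≤ 1 / (2 * γ₁))
  have h4 : (max 0 (γ₁ * l + h) - max 0 (γ₁ * a + h)) * (h' - h) ≤ γ₁ * (|l - a| * |h' - h|) := by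
    refine (le_abs_self _).trans ?_
    rw [abs_mul, ← mul_assoc]
    gcongr
    refine (abs_max_zero_sub_le _ _).trans_eq ?_
    rw [show γ₁ * l + h - (γ₁ * a + h) = γ₁ * (l - a) by ring, abs_mul, abs_of_pos hγ₁]
  have h4' : 1 / γ₁ * ((max 0 (γ₁ * l + h) - max 0 (γ₁ * a + h)) * (h' - h)) ≤
      |l - a| * |h' - h| := by
    refine (mul_le_mul_of_nonneg_left h4 (by positivity)).trans_eq ?_
    field_simp
  have h5 : |l - a| * |h' - h| ≤ γ₂ / 4 * (l - a) ^ 2 + 1 / γ₂ * (h' - h) ^ 2 := by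
    rw [← sq_abs (l - a), ← sq_abs (h' - h)]
    have : 0 ≤ 1 / γ₂ * (γ₂ / 2 * |l - a| - |h' - h|) ^ 2 := by positivity
    have e : 1 / γ₂ * (γ₂ / 2 * |l - a| - |h' - h|) ^ 2 =
        γ₂ / 4 * |l - a| ^ 2 + 1 / γ₂ * |h' - h| ^ 2 - |l - a| * |h' - h| := by
      field_simp
      ring
    linarith
  have h6 : γ₂ * ((l - a) * (z' - z)) ≤ γ₂ / 4 * (l - a) ^ 2 + γ₂ * (z' - z) ^ 2 := by
    nlinarith [mul_nonneg hγ₂.le (sq_nonneg ((l - a) / 2 - (z' - z)))]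
  have e1 : dualTerm γ₁ γ₂ h' z' l = dualTerm γ₁ γ₂ h z l
      + (1 / (2 * γ₁) * max 0 (γ₁ * l + h') ^ 2 - 1 / (2 * γ₁) * max 0 (γ₁ * l + h) ^ 2)
      + γ₂ * (l - z) * (z' - z) - γ₂ / 2 * (z' - z) ^ 2 := by
    unfold dualTerm
    ring
  have e2 : 1 / (2 * γ₁) * (max 0 (γ₁ * l + h) ^ 2 + 2 * max 0 (γ₁ * l + h) * (h' - h) +
      (h' - h) ^ 2) = 1 / (2 * γ₁) * max 0 (γ₁ * l + h) ^ 2 +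
      (1 / γ₁ * max 0 (γ₁ * a + h) * (h' - h) +
        1 / γ₁ * ((max 0 (γ₁ * l + h) - max 0 (γ₁ * a + h)) * (h' - h))) +
      1 / (2 * γ₁) * (h' - h) ^ 2 := by
    field_simp
    ring
  rw [e2] at h3
  rw [e1]
  nlinarith [mul_nonneg hγ₂.le (sq_nonneg (z' - z))]

end Scalar

/-! ### Gradients on products -/

section Products

variable {m n p : ℕ}

@[simp] theorem pair_fst (x : Vec m) (y : Vec n) : (pair x y).fst = x := rfl
@[simp] theorem pair_snd (x : Vec m) (y : Vec n) : (pair x y).snd = y := rfl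
theorem pair_fst_snd (v : XY m n) : pair v.fst v.snd = v := rfl

theorem norm_le_fst_add_snd {E F : Type*} [NormedAddCommGroup E] [NormedAddCommGroup F]
    (v : WithLp 2 (E × F)) : ‖v‖ ≤ ‖v.fst‖ + ‖v.snd‖ := by
  have := WithLp.prod_norm_sq_eq_of_L2 v
  nlinarith [norm_nonneg v, norm_nonneg v.fst, norm_nonneg v.snd]

theorem norm_pair_sub_pair_left (x x' : Vec m) (y : Vec n) :
    ‖pair x y - pair x' y‖ = ‖x - x'‖ := by
  rw [← sq_eq_sq₀ (norm_nonneg _) (norm_nonneg _), WithLp.prod_norm_sq_eq_of_L2]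
  simp

theorem norm_pair_sub_pair_right (x : Vec m) (y y' : Vec n) :
    ‖pair x y - pair x y'‖ = ‖y - y'‖ := by
  rw [← sq_eq_sq₀ (norm_nonneg _) (norm_nonneg _), WithLp.prod_norm_sq_eq_of_L2]
  simp

theorem continuous_pair : Continuous fun a : Vec m × Vec n => pair a.1 a.2 :=
  WithLp.prod_continuous_toLp 2 _ _

theorem norm_le_sum_abs (v : Vec p) : ‖v‖ ≤ ∑ i, |v i| := by
  rw [EuclideanSpace.norm_eq]
  refine Real.sqrt_le_iff.2 ⟨by positivity, ?_⟩
  simp only [Real.norm_eq_abs]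
  exact Finset.sum_sq_le_sq_sum_of_nonneg fun i _ => abs_nonneg _

theorem abs_apply_le_norm (v : Vec p) (i : Fin p) : |v i| ≤ ‖v‖ := PiLp.norm_apply_le v i

theorem hasGradientAt_pair_right {f : XY m n → ℝ} {g v : XY m n} (h : HasGradientAt f g v) :
    HasGradientAt (fun y => f (pair v.fst y)) g.snd v.snd := by
  rw [hasGradientAt_iff_isLittleO] at h ⊢
  have ht : Tendsto (fun y => pair v.fst y) (𝓝 v.snd) (𝓝 v) :=
    (continuous_pair.comp (Continuous.prodMk_right v.fst)).tendsto' _ _ rfl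
  have h2 := h.comp_tendsto ht
  refine (h2.congr_left fun y => ?_).trans_isBigO ?_
  · simp only [Function.comp]
    congr 1
    simp
  · refine Asymptotics.IsBigO.of_bound 1 (Eventually.of_forall fun y => ?_)
    simp only [Function.comp, one_mul]
    exact (norm_pair_sub_pair_right v.fst y v.snd).le

end Products

/-! ### Normalized constants -/

/-- All smoothness, boundedness and variance constants replaced by one number `M`. -/
def Constants.uniform (M μ : ℝ) : Constants := ⟨M, M, M, μ, M, M, M, M, M⟩

/-- A number above `1` and above the absolute value of each constant. -/
def Constants.bound (κ : Constants) : ℝ :=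
  1 + |κ.LF| + |κ.LG| + |κ.LH| + |κ.MG| + |κ.MH0| + |κ.MH1| + |κ.σf| + |κ.σg|

/-- The upper end `B / √p` of the intervals in which the coordinates of `z` lie. -/
def Params.box (par : Params) (p : ℕ) : ℝ := par.B / √p

/-- An upper bound of all multipliers: of the inner iterates, and of the saddle points. -/
def Params.dualBound (par : Params) (p : ℕ) (M : ℝ) : ℝ := par.ρ * (M + par.γ₂ * par.box p)

/-- The values of the parameters that the result covers. -/
structure Params.Valid (par : Params) (M μ : ℝ) : Prop where
  hM : 1 ≤ M
  hμ : 0 < μ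
  hγ₁ : 0 < par.γ₁
  hγ₂ : 0 < par.γ₂
  hη : 1 / μ ≤ par.η
  hρ : 1 / par.γ₂ ≤ par.ρ
  hB : 0 ≤ par.B

namespace Params.Valid

variable {par : Params} {M μ : ℝ} (hv : par.Valid M μ)
include hv

theorem M_pos : 0 < M := one_pos.trans_le hv.hM
theorem η_pos : 0 < par.η := (one_div_pos.2 hv.hμ).trans_le hv.hη
theorem ρ_pos : 0 < par.ρ := (one_div_pos.2 hv.hγ₂).trans_le hv.hρ
theorem box_nonneg (p : ℕ) : 0 ≤ par.box p := div_nonneg hv.hB (Real.sqrt_nonneg _)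
theorem dualBound_nonneg (p : ℕ) : 0 ≤ par.dualBound p M :=
  mul_nonneg hv.ρ_pos.le (add_nonneg hv.M_pos.le (mul_nonneg hv.hγ₂.le (hv.box_nonneg p)))

theorem box_add_le_dualBound (p : ℕ) : par.box p + M / par.γ₂ ≤ par.dualBound p M := by
  have h1 := hv.M_pos
  have h2 := hv.box_nonneg p
  have h3 := hv.hγ₂
  calc par.box p + M / par.γ₂ = 1 / par.γ₂ * (M + par.γ₂ * par.box p) := by
        field_simp
        ring
    _ ≤ _ := mul_le_mul_of_nonneg_right hv.hρ (by positivity)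

end Params.Valid

theorem Problem.Assumptions.uniform {m n p : ℕ} {Ωξ : Type u₁} {Ωζ : Type u₂}
    [MeasurableSpace Ωξ] [MeasurableSpace Ωζ] {P : Problem m n p Ωξ Ωζ} {κ : Constants}
    (h : P.Assumptions κ) : P.Assumptions (Constants.uniform κ.bound κ.μG) := by
  have h1 := le_abs_self κ.LF
  have h2 := le_abs_self κ.LG
  have h3 := le_abs_self κ.LH
  have h4 := le_abs_self κ.MG
  have h5 := le_abs_self κ.MH0
  have h6 := le_abs_self κ.MH1
  have k1 := abs_nonneg κ.LF
  have k2 := abs_nonneg κ.LG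
  have k3 := abs_nonneg κ.LH
  have k4 := abs_nonneg κ.MG
  have k5 := abs_nonneg κ.MH0
  have k6 := abs_nonneg κ.MH1
  have k7 := abs_nonneg κ.σf
  have k8 := abs_nonneg κ.σg
  have b1 : κ.LF ≤ κ.bound := by unfold Constants.bound; linarith
  have b2 : κ.LG ≤ κ.bound := by unfold Constants.bound; linarith
  have b3 : κ.LH ≤ κ.bound := by unfold Constants.bound; linarith
  have b4 : κ.MG ≤ κ.bound := by unfold Constants.bound; linarith
  have b5 : κ.MH0 ≤ κ.bound := by unfold Constants.bound; linarith
  have b6 : κ.MH1 ≤ κ.bound := by unfold Constants.bound; linarith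
  have b7 : |κ.σf| ≤ |κ.bound| := by rw [le_abs]; left; unfold Constants.bound; linarith
  have b8 : |κ.σg| ≤ |κ.bound| := by rw [le_abs]; left; unfold Constants.bound; linarith
  exact { h with
    F_lip := fun v hv v' hv' => (h.F_lip v hv v' hv').trans (by unfold Constants.uniform; gcongr)
    G_lip := fun v hv v' hv' => (h.G_lip v hv v' hv').trans (by unfold Constants.uniform; gcongr)
    H_lip := fun i v hv v' hv' =>
      (h.H_lip i v hv v' hv').trans (by unfold Constants.uniform; gcongr)
    G_convex := h.G_convex
    G_grad_bdd := fun v hv => (h.G_grad_bdd v hv).trans b4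
    H_bdd := fun i v hv => (h.H_bdd i v hv).trans b5
    H_grad_bdd := fun i v hv => (h.H_grad_bdd i v hv).trans b6
    f_var := fun v hv => (h.f_var v hv).trans (sq_le_sq.2 b7)
    g_var := fun v hv => (h.g_var v hv).trans (sq_le_sq.2 b8) }

namespace Problem

variable {m n p : ℕ} {Ωξ : Type u₁} {Ωζ : Type u₂} [MeasurableSpace Ωξ] [MeasurableSpace Ωζ]
variable (P : Problem m n p Ωξ Ωζ)

/-! ### The augmented Lagrangian -/

/-- The gradient in `(x, w)` of the augmented Lagrangian: the mean of `gradL`. -/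
def meanGradL (γ₁ : ℝ) (v : XY m n) (l : Vec p) : XY m n :=
  ∇ P.G v + (1 / γ₁) • ∑ i, (max 0 (γ₁ * l i + P.H i v)) • ∇ (P.H i) v

/-- `ℓ(x, z, w, l)`, with `v = (x, w)`. -/
def lagr (par : Params) (v : XY m n) (z l : Vec p) : ℝ :=
  P.G v + ∑ i, dualTerm par.γ₁ par.γ₂ (P.H i v) (z i) (l i)

/-- The multiplier that maximizes `ℓ(x, z, w, ·)`, with `v = (x, w)`. -/
def dualOpt (par : Params) (v : XY m n) (z : Vec p) : Vec p :=
  WithLp.toLp 2 fun i => dualArg par.γ₁ par.γ₂ (P.H i v) (z i)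

/-- `(w, l)` is a saddle point of `ℓ(x, z, ·, ·)` on `Y × ℝᵖ₊`, by first-order conditions: `l` is
the maximizer for `w`, and `w` is stationary for `l`. The maximizer over `ℝᵖ` is nonnegative when
`z ≥ 0`, so that no constraint on `l` appears. -/
structure IsSaddle (par : Params) (x : Vec m) (z : Vec p) (w : Vec n) (l : Vec p) : Prop where
  mem : w ∈ P.Y
  dual : l = P.dualOpt par (pair x w) z
  primal : ∀ w' ∈ P.Y, 0 ≤ inner ℝ (P.meanGradL par.γ₁ (pair x w) l).snd (w' - w)

variable {P} {par : Params} {M μ : ℝ}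

theorem augLagrangian_sub_eq_lagr (v : XY m n) (z l : Vec p) :
    P.augLagrangian par.γ₁ v.fst v.snd l - par.γ₂ / 2 * ‖l - z‖ ^ 2 = P.lagr par v z l := by
  have e : ∑ i, dualTerm par.γ₁ par.γ₂ (P.H i v) (z i) (l i) = 1 / (2 * par.γ₁) *
      ∑ i, ((max 0 (par.γ₁ * l i + P.H i v)) ^ 2 - par.γ₁ ^ 2 * l i ^ 2) -
      par.γ₂ / 2 * ∑ i, (l i - z i) ^ 2 := by
    rw [Finset.mul_sum, Finset.mul_sum, ← Finset.sum_sub_distrib]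
    rfl
  unfold augLagrangian lagr
  rw [e, EuclideanSpace.norm_sq_eq, add_sub]
  simp only [PiLp.sub_apply, Real.norm_eq_abs, sq_abs, pair_fst_snd]

theorem gradL_eq (γ₁ : ℝ) (x : Vec m) (w : Vec n) (l : Vec p) (ξ : Ωξ) :
    P.gradL γ₁ x w l ξ =
      P.meanGradL γ₁ (pair x w) l + (P.gradg (pair x w) ξ - ∇ P.G (pair x w)) := by
  unfold gradL meanGradL
  abel

section

variable (hP : P.Assumptions (Constants.uniform M μ)) (hv : par.Valid M μ)
include hP

theorem Assumptions.dom_convex : Convex ℝ P.dom := by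
  intro v hv v' hv' a b ha hb hab
  exact ⟨hP.X_convex hv.1 hv'.1 ha hb hab, hP.Y_convex hv.2 hv'.2 ha hb hab⟩

theorem Assumptions.dom_compact : IsCompact P.dom := by
  have := (hP.X_compact.prod hP.Y_compact).image (WithLp.prod_continuous_toLp 2 (Vec m) (Vec n))
  convert this using 1
  ext v
  constructor
  · exact fun h => ⟨(v.fst, v.snd), h, rfl⟩
  · rintro ⟨a, ha, rfl⟩
    exact ha

theorem Assumptions.hasGradientAt_F {v : XY m n} (h : v ∈ P.dom) :
    HasGradientAt P.F (∇ P.F v) v :=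
  ((hP.F_smooth v h).differentiableAt one_ne_zero).hasGradientAt

theorem Assumptions.hasGradientAt_G {v : XY m n} (h : v ∈ P.dom) :
    HasGradientAt P.G (∇ P.G v) v :=
  ((hP.G_smooth v h).differentiableAt one_ne_zero).hasGradientAt

theorem Assumptions.hasGradientAt_H (i : Fin p) {v : XY m n} (h : v ∈ P.dom) :
    HasGradientAt (P.H i) (∇ (P.H i) v) v :=
  ((hP.H_smooth i v h).differentiableAt one_ne_zero).hasGradientAt

theorem Assumptions.H_lipschitz (i : Fin p) {v v' : XY m n} (h : v ∈ P.dom) (h' : v' ∈ P.dom) :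
    |P.H i v - P.H i v'| ≤ M * ‖v - v'‖ := by
  refine hP.dom_convex.norm_image_sub_le_of_norm_hasFDerivWithin_le
    (fun u hu => (hP.hasGradientAt_H i hu).hasFDerivAt.hasFDerivWithinAt) (fun u hu => ?_) h' h
  rw [LinearIsometryEquiv.norm_map]
  exact hP.H_grad_bdd i u hu

theorem Assumptions.continuousOn_gradH (i : Fin p) : ContinuousOn (∇ (P.H i)) P.dom :=
  (LipschitzOnWith.of_dist_le_mul (K := M.toNNReal) fun v h v' h' => by
    rw [dist_eq_norm, dist_eq_norm]
    exact (hP.H_lip i v h v' h').trans (by gcongr; exact Real.le_coe_toNNReal M)).continuousOn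

theorem Assumptions.continuousOn_gradG : ContinuousOn (∇ P.G) P.dom :=
  (LipschitzOnWith.of_dist_le_mul (K := M.toNNReal) fun v h v' h' => by
    rw [dist_eq_norm, dist_eq_norm]
    exact (hP.G_lip v h v' h').trans (by gcongr; exact Real.le_coe_toNNReal M)).continuousOn

theorem Assumptions.continuousOn_H (i : Fin p) : ContinuousOn (P.H i) P.dom := fun v h =>
  (hP.H_smooth i v h).continuousAt.continuousWithinAt

theorem Assumptions.continuousOn_G : ContinuousOn P.G P.dom := fun v h =>
  (hP.G_smooth v h).continuousAt.continuousWithinAt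

include hv

theorem hasStrictFDerivAt_augLagrangian (l : Vec p) {v : XY m n} (h : v ∈ P.dom) :
    HasStrictFDerivAt (fun v : XY m n => P.augLagrangian par.γ₁ v.fst v.snd l)
      (InnerProductSpace.toDual ℝ _ (P.meanGradL par.γ₁ v l)) v := by
  have hG := (hP.G_smooth v h).hasStrictFDerivAt one_ne_zero
  have hH : ∀ i, HasStrictFDerivAt (fun v => (max 0 (par.γ₁ * l i + P.H i v)) ^ 2
      - par.γ₁ ^ 2 * l i ^ 2) ((2 * max 0 (par.γ₁ * l i + P.H i v)) • fderiv ℝ (P.H i) v) v := by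
    intro i
    have h1 := ((hP.H_smooth i v h).hasStrictFDerivAt one_ne_zero).const_add (par.γ₁ * l i)
    have h2 : HasStrictDerivAt (fun t : ℝ => (max 0 t) ^ 2)
        (2 * max 0 (par.γ₁ * l i + P.H i v)) (par.γ₁ * l i + P.H i v) :=
      hasStrictDerivAt_of_hasDerivAt_of_continuousAt
        (Eventually.of_forall hasDerivAt_sq_max_zero) (by fun_prop)
    exact (h2.comp_hasStrictFDerivAt v h1).sub_const _
  have := hG.add ((HasStrictFDerivAt.fun_sum fun i (_ : i ∈ Finset.univ) => hH i).const_mul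
    (1 / (2 * par.γ₁)))
  refine this.congr_fderiv ?_
  rw [meanGradL, map_add, toDual_gradient, map_smul, map_sum]
  simp only [map_smul, toDual_gradient]
  rw [Finset.smul_sum, Finset.smul_sum]
  congr 1
  refine Finset.sum_congr rfl fun i _ => ?_
  rw [smul_smul, smul_smul]
  congr 1
  have := hv.hγ₁
  field_simp

theorem hasGradientAt_augLagrangian (l : Vec p) {v : XY m n} (h : v ∈ P.dom) :
    HasGradientAt (fun v : XY m n => P.augLagrangian par.γ₁ v.fst v.snd l)
      (P.meanGradL par.γ₁ v l) v :=
  hasGradientAt_iff_hasFDerivAt.2 (hasStrictFDerivAt_augLagrangian hP hv l h).hasFDerivAt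

/-- Strong convexity of `ℓ` in `w`, in first-order form. -/
theorem augLagrangian_first_order {x : Vec m} {w w' : Vec n} (l : Vec p) (hx : x ∈ P.X)
    (hw : w ∈ P.Y) (hw' : w' ∈ P.Y) :
    P.augLagrangian par.γ₁ x w l + inner ℝ (P.meanGradL par.γ₁ (pair x w) l).snd (w' - w)
      + μ / 2 * ‖w' - w‖ ^ 2 ≤ P.augLagrangian par.γ₁ x w' l := by
  have hd : pair x w ∈ P.dom := ⟨hx, hw⟩
  have h1 := StrongConvexOn.add_inner_gradient_le (hP.G_convex x hx) hw hw'
    (hasGradientAt_pair_right (hP.hasGradientAt_G hd))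
  rw [show (Constants.uniform M μ).μG = μ from rfl] at h1
  have h2 : ∀ i, max 0 (par.γ₁ * l i + P.H i (pair x w)) ^ 2 + 2 *
      max 0 (par.γ₁ * l i + P.H i (pair x w)) * inner ℝ (∇ (P.H i) (pair x w)).snd (w' - w)
      ≤ max 0 (par.γ₁ * l i + P.H i (pair x w')) ^ 2 := by
    intro i
    have h3 := ConvexOn.add_inner_gradient_le (hP.H_convex i x hx) hw hw'
      (hasGradientAt_pair_right (hP.hasGradientAt_H i hd))
    have h4 := le_sq_max_zero_add (par.γ₁ * l i + P.H i (pair x w))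
      (P.H i (pair x w') - P.H i (pair x w))
    rw [show par.γ₁ * l i + P.H i (pair x w) + (P.H i (pair x w') - P.H i (pair x w)) =
      par.γ₁ * l i + P.H i (pair x w') by ring] at h4
    have h5 : 2 * max 0 (par.γ₁ * l i + P.H i (pair x w)) *
        inner ℝ (∇ (P.H i) (pair x w)).snd (w' - w) ≤
        2 * max 0 (par.γ₁ * l i + P.H i (pair x w)) *
          (P.H i (pair x w') - P.H i (pair x w)) := by
      refine mul_le_mul_of_nonneg_left ?_ (by positivity)
      linarith
    linarith
  have h3 := mul_le_mul_of_nonneg_left (Finset.sum_le_sum fun i (_ : i ∈ Finset.univ) => h2 i)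
    (by have := hv.hγ₁; positivity : 0 ≤ 1 / (2 * par.γ₁))
  have e : inner ℝ (P.meanGradL par.γ₁ (pair x w) l).snd (w' - w) =
      inner ℝ (∇ P.G (pair x w)).snd (w' - w) + 1 / (2 * par.γ₁) *
        ∑ i, 2 * max 0 (par.γ₁ * l i + P.H i (pair x w)) *
          inner ℝ (∇ (P.H i) (pair x w)).snd (w' - w) := by
    unfold meanGradL
    have hs : ∀ (s : Finset (Fin p)) (f : Fin p → XY m n),
        (∑ i ∈ s, f i).snd = ∑ i ∈ s, (f i).snd :=
      fun s f => map_sum (WithLp.sndL 2 ℝ (Vec m) (Vec n)) f s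
    rw [WithLp.add_snd, WithLp.smul_snd, hs, inner_add_left, inner_smul_left, sum_inner]
    congr 1
    rw [Finset.mul_sum, Finset.mul_sum]
    refine Finset.sum_congr rfl fun i _ => ?_
    rw [WithLp.smul_snd, inner_smul_left]
    have := hv.hγ₁
    simp only [conj_trivial]
    field_simp
  rw [Finset.sum_add_distrib, mul_add] at h3
  unfold augLagrangian
  rw [e, Finset.sum_sub_distrib, Finset.sum_sub_distrib, mul_sub, mul_sub]
  linarith

theorem lagr_first_order {x : Vec m} {w w' : Vec n} (z l : Vec p) (hx : x ∈ P.X)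
    (hw : w ∈ P.Y) (hw' : w' ∈ P.Y) :
    P.lagr par (pair x w) z l + inner ℝ (P.meanGradL par.γ₁ (pair x w) l).snd (w' - w)
      + μ / 2 * ‖w' - w‖ ^ 2 ≤ P.lagr par (pair x w') z l := by
  rw [← augLagrangian_sub_eq_lagr, ← augLagrangian_sub_eq_lagr]
  have := augLagrangian_first_order hP hv l hx hw hw'
  simp only [pair_fst, pair_snd]
  linarith

end

/-- Strong concavity of `ℓ` in `l`, in first-order form. -/
theorem lagr_dual_first_order (hγ₁ : 0 < par.γ₁) (x : Vec m) (w : Vec n) (z l l' : Vec p) :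
    P.lagr par (pair x w) z l' ≤ P.lagr par (pair x w) z l
      + inner ℝ (P.gradDual par.γ₁ par.γ₂ x z w l) (l' - l) - par.γ₂ / 2 * ‖l' - l‖ ^ 2 := by
  have h := Finset.sum_le_sum fun i (_ : i ∈ Finset.univ) =>
    dualTerm_le (γ₂ := par.γ₂) hγ₁ (P.H i (pair x w)) (z i) (l i) (l' i)
  have e1 : inner ℝ (P.gradDual par.γ₁ par.γ₂ x z w l) (l' - l) =
      ∑ i, dualSlope par.γ₁ par.γ₂ (P.H i (pair x w)) (z i) (l i) * (l' i - l i) := by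
    rw [PiLp.inner_apply]
    refine Finset.sum_congr rfl fun i _ => ?_
    simp [gradDual, dualSlope, mul_comm]
  have e2 : par.γ₂ / 2 * ‖l' - l‖ ^ 2 = ∑ i, par.γ₂ / 2 * (l' i - l i) ^ 2 := by
    rw [EuclideanSpace.norm_sq_eq, Finset.mul_sum]
    simp
  rw [Finset.sum_sub_distrib, Finset.sum_add_distrib] at h
  unfold lagr
  rw [e1, e2]
  linarith

/-! ### Saddle points -/

section

variable (hP : P.Assumptions (Constants.uniform M μ)) (hv : par.Valid M μ)

theorem continuous_dualTerm_dualArg (γ₁ γ₂ z : ℝ) :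
    Continuous fun h : ℝ => dualTerm γ₁ γ₂ h z (dualArg γ₁ γ₂ h z) := by
  unfold dualTerm dualArg
  fun_prop

include hv in
theorem gradDual_dualOpt {x : Vec m} {z : Vec p} (w : Vec n) (hz : ∀ i, 0 ≤ z i) :
    P.gradDual par.γ₁ par.γ₂ x z w (P.dualOpt par (pair x w) z) = 0 := by
  ext i
  exact dualSlope_dualArg hv.hγ₁ hv.hγ₂ (hz i)

include hP hv

/-- Minimizing `w ↦ max_l ℓ(x, z, w, l)` over the compact set `Y` yields a saddle point. -/
theorem exists_isSaddle {x : Vec m} {z : Vec p} (hx : x ∈ P.X) (hz : ∀ i, 0 ≤ z i)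
    (hY : P.Y.Nonempty) : ∃ w l, P.IsSaddle par x z w l := by
  have hmaps : Set.MapsTo (fun w => pair x w) P.Y P.dom := fun w hw => ⟨hx, hw⟩
  have hpc : ContinuousOn (fun w => pair x w) P.Y :=
    (continuous_pair.comp (Continuous.prodMk_right x)).continuousOn
  have hcont : ContinuousOn
      (fun w => P.lagr par (pair x w) z (P.dualOpt par (pair x w) z)) P.Y := by
    refine ContinuousOn.add (hP.continuousOn_G.comp hpc hmaps)
      (continuousOn_finsetSum _ fun i _ => ?_)
    exact (continuous_dualTerm_dualArg par.γ₁ par.γ₂ (z i)).comp_continuousOn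
      ((hP.continuousOn_H i).comp hpc hmaps)
  obtain ⟨w, hw, hmin⟩ := hP.Y_compact.exists_isMinOn hY hcont
  have hd : pair x w ∈ P.dom := ⟨hx, hw⟩
  refine ⟨w, P.dualOpt par (pair x w) z, hw, rfl, fun w' hw' => ?_⟩
  have hg := hasGradientAt_pair_right
    (hasGradientAt_augLagrangian hP hv (P.dualOpt par (pair x w) z) hd)
  refine inner_gradient_nonneg_of_isMin_up_to_sq (C := p * (1 / (2 * par.γ₂) * M ^ 2))
    hP.Y_convex hw hg (fun w₁ hw₁ => ?_) hw'
  -- For fixed `l = l(w)`, the point `w` minimizes `ℓ` up to a quadratic error.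
  have h1 : P.lagr par (pair x w) z (P.dualOpt par (pair x w) z) ≤
      P.lagr par (pair x w₁) z (P.dualOpt par (pair x w₁) z) := hmin hw₁
  have h2 : P.lagr par (pair x w₁) z (P.dualOpt par (pair x w₁) z) ≤
      P.lagr par (pair x w₁) z (P.dualOpt par (pair x w) z) +
        p * (1 / (2 * par.γ₂) * M ^ 2) * ‖w₁ - w‖ ^ 2 := by
    have h3 : ∀ i, dualTerm par.γ₁ par.γ₂ (P.H i (pair x w₁)) (z i)
        (P.dualOpt par (pair x w₁) z i) ≤ dualTerm par.γ₁ par.γ₂ (P.H i (pair x w₁)) (z i)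
        (P.dualOpt par (pair x w) z i) + 1 / (2 * par.γ₂) * M ^ 2 * ‖w₁ - w‖ ^ 2 := by
      intro i
      refine (dualTerm_le_dualArg_add_sq hv.hγ₁ hv.hγ₂ (h₀ := P.H i (pair x w)) (hz i)).trans ?_
      have h4 := hP.H_lipschitz i (hmaps hw₁) hd
      rw [norm_pair_sub_pair_right] at h4
      rw [mul_assoc (1 / (2 * par.γ₂)), ← mul_pow]
      have := hv.hγ₂
      refine add_le_add le_rfl (mul_le_mul_of_nonneg_left ?_ (by positivity))
      rw [← sq_abs (P.H i (pair x w₁) - _)]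
      gcongr
    have h5 := Finset.sum_le_sum fun i (_ : i ∈ Finset.univ) => h3 i
    rw [Finset.sum_add_distrib, Finset.sum_const, Finset.card_univ, Fintype.card_fin,
      nsmul_eq_mul] at h5
    unfold lagr
    linarith
  have h6 := h1.trans h2
  rw [← augLagrangian_sub_eq_lagr, ← augLagrangian_sub_eq_lagr] at h6
  change P.augLagrangian par.γ₁ x w _ ≤ P.augLagrangian par.γ₁ x w₁ _ + _ * ‖w₁ - w‖ ^ 2
  simp only [pair_fst, pair_snd] at h6
  linarith

omit hP in
theorem IsSaddle.dual_nonneg {x : Vec m} {z : Vec p} {w : Vec n} {l : Vec p}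
    (hs : P.IsSaddle par x z w l) (hz : ∀ i, 0 ≤ z i) (i : Fin p) : 0 ≤ l i := by
  rw [hs.dual]
  exact dualArg_nonneg hv.hγ₁ hv.hγ₂ (hz i)

theorem IsSaddle.dual_le {x : Vec m} {z : Vec p} {w : Vec n} {l : Vec p}
    (hs : P.IsSaddle par x z w l) (hx : x ∈ P.X) (hz : ∀ i, 0 ≤ z i ∧ z i ≤ par.box p)
    (i : Fin p) : l i ≤ par.dualBound p M := by
  rw [hs.dual]
  refine (dualArg_le hv.hγ₁ hv.hγ₂ (hz i).1 (hP.H_bdd i (pair x w) ⟨hx, hs.mem⟩)).trans ?_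
  refine le_trans ?_ (hv.box_add_le_dualBound p)
  exact add_le_add (hz i).2 le_rfl

/-- The saddle operator `(∇_w ℓ, -∇_l ℓ)` is strongly monotone relative to a saddle point: add the
first-order inequalities of `ℓ` in `w` and in `l`, in both directions. -/
theorem IsSaddle.strong_monotone {x : Vec m} {z : Vec p} {w w' : Vec n} {l : Vec p}
    (hs : P.IsSaddle par x z w l) (hx : x ∈ P.X) (hz : ∀ i, 0 ≤ z i) (hw' : w' ∈ P.Y)
    (l' : Vec p) :
    μ * ‖w' - w‖ ^ 2 + par.γ₂ * ‖l' - l‖ ^ 2 ≤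
      inner ℝ (P.meanGradL par.γ₁ (pair x w') l').snd (w' - w)
        - inner ℝ (P.gradDual par.γ₁ par.γ₂ x z w' l') (l' - l) := by
  have h1 := lagr_first_order hP hv z l' hx hw' hs.mem
  have h2 := lagr_first_order hP hv z l hx hs.mem hw'
  have h3 := lagr_dual_first_order (P := P) (par := par) hv.hγ₁ x w' z l' l
  have h4 := lagr_dual_first_order (P := P) (par := par) hv.hγ₁ x w z l l'
  have h5 := hs.primal w' hw'
  have h6 : P.gradDual par.γ₁ par.γ₂ x z w l = 0 := by
    rw [hs.dual]
    exact gradDual_dualOpt hv w hz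
  rw [h6, inner_zero_left] at h4
  rw [← neg_sub w' w, inner_neg_right, norm_neg] at h1
  rw [← neg_sub l' l, inner_neg_right, norm_neg] at h3
  linarith

omit hv in
/-- `∇_{(x, w)} L` is Lipschitz, one of the two multipliers being bounded by `R`. -/
theorem norm_meanGradL_sub_le {R : ℝ} (hM : 0 ≤ M) (hγ₁ : 0 < par.γ₁) {v v' : XY m n}
    {l l' : Vec p} (h : v ∈ P.dom) (h' : v' ∈ P.dom) (hl0 : ∀ i, 0 ≤ l i) (hl : ∀ i, l i ≤ R) :
    ‖P.meanGradL par.γ₁ v l - P.meanGradL par.γ₁ v' l'‖ ≤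
      (M + 1 / par.γ₁ * (p * ((par.γ₁ * R + M) * M + M * M))) * ‖v - v'‖ +
        p * M * ‖l - l'‖ := by
  have hi : ∀ i, ‖(max 0 (par.γ₁ * l i + P.H i v)) • ∇ (P.H i) v -
      (max 0 (par.γ₁ * l' i + P.H i v')) • ∇ (P.H i) v'‖ ≤
      ((par.γ₁ * R + M) * M + M * M) * ‖v - v'‖ + par.γ₁ * M * ‖l - l'‖ := by
    intro i
    have hR : 0 ≤ R := (hl0 i).trans (hl i)
    have h1 : |max 0 (par.γ₁ * l i + P.H i v)| ≤ par.γ₁ * R + M := by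
      rw [abs_of_nonneg (le_max_left _ _)]
      refine max_le (by positivity) (add_le_add (by gcongr; exact hl i) ?_)
      exact (le_abs_self _).trans (hP.H_bdd i v h)
    have h2 : |max 0 (par.γ₁ * l i + P.H i v) - max 0 (par.γ₁ * l' i + P.H i v')| ≤
        par.γ₁ * ‖l - l'‖ + M * ‖v - v'‖ := by
      refine (abs_max_zero_sub_le _ _).trans ?_
      rw [show par.γ₁ * l i + P.H i v - (par.γ₁ * l' i + P.H i v') =
        par.γ₁ * (l i - l' i) + (P.H i v - P.H i v') by ring]
      refine (abs_add_le _ _).trans (add_le_add ?_ (hP.H_lipschitz i h h'))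
      rw [abs_mul, abs_of_pos hγ₁]
      gcongr
      exact abs_apply_le_norm (l - l') i
    have e : (max 0 (par.γ₁ * l i + P.H i v)) • ∇ (P.H i) v -
        (max 0 (par.γ₁ * l' i + P.H i v')) • ∇ (P.H i) v' =
        (max 0 (par.γ₁ * l i + P.H i v)) • (∇ (P.H i) v - ∇ (P.H i) v') +
        (max 0 (par.γ₁ * l i + P.H i v) - max 0 (par.γ₁ * l' i + P.H i v')) • ∇ (P.H i) v' := by
      module
    rw [e]
    refine (norm_add_le _ _).trans ?_
    rw [norm_smul, norm_smul, Real.norm_eq_abs, Real.norm_eq_abs]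
    calc _ ≤ (par.γ₁ * R + M) * (M * ‖v - v'‖) + (par.γ₁ * ‖l - l'‖ + M * ‖v - v'‖) * M := by
          gcongr
          · exact hP.H_lip i v h v' h'
          · exact hP.H_grad_bdd i v' h'
      _ = _ := by ring
  have e : P.meanGradL par.γ₁ v l - P.meanGradL par.γ₁ v' l' = (∇ P.G v - ∇ P.G v') +
      (1 / par.γ₁) • ∑ i, ((max 0 (par.γ₁ * l i + P.H i v)) • ∇ (P.H i) v -
      (max 0 (par.γ₁ * l' i + P.H i v')) • ∇ (P.H i) v') := by
    unfold meanGradL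
    rw [Finset.sum_sub_distrib]
    module
  rw [e]
  refine (norm_add_le _ _).trans ?_
  rw [norm_smul, Real.norm_eq_abs, abs_of_pos (by positivity)]
  calc _ ≤ M * ‖v - v'‖ + 1 / par.γ₁ * (p * (((par.γ₁ * R + M) * M + M * M) * ‖v - v'‖
        + par.γ₁ * M * ‖l - l'‖)) := by
        gcongr
        · exact hP.G_lip v h v' h'
        · refine (norm_sum_le_of_le _ fun i _ => hi i).trans_eq ?_
          rw [Finset.sum_const, Finset.card_univ, Fintype.card_fin, nsmul_eq_mul]
    _ = _ := by
        field_simp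
        ring

omit hv in
theorem norm_meanGradL_le {R : ℝ} (hM : 0 ≤ M) (hγ₁ : 0 < par.γ₁) {v : XY m n}
    {l : Vec p} (h : v ∈ P.dom) (hl0 : ∀ i, 0 ≤ l i) (hl : ∀ i, l i ≤ R) :
    ‖P.meanGradL par.γ₁ v l‖ ≤ M + 1 / par.γ₁ * (p * ((par.γ₁ * R + M) * M)) := by
  unfold meanGradL
  refine (norm_add_le _ _).trans ?_
  rw [norm_smul, Real.norm_eq_abs, abs_of_pos (by positivity)]
  gcongr
  · exact hP.G_grad_bdd v h
  · refine (norm_sum_le_of_le (Finset.univ) (f := fun i => (max 0 (par.γ₁ * l i + P.H i v)) •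
      ∇ (P.H i) v) (n := fun _ => (par.γ₁ * R + M) * M) fun i _ => ?_).trans_eq (by simp)
    have hR : 0 ≤ R := (hl0 i).trans (hl i)
    rw [norm_smul, Real.norm_eq_abs, abs_of_nonneg (le_max_left _ _)]
    gcongr
    · refine max_le (by positivity) (add_le_add (by gcongr; exact hl i) ?_)
      exact (le_abs_self _).trans (hP.H_bdd i v h)
    · exact hP.H_grad_bdd i v h

omit hv in
theorem norm_gradDual_sub_le (x x' : Vec m) (z z' : Vec p) {w : Vec n} (l : Vec p)
    (hx : x ∈ P.X) (hx' : x' ∈ P.X) (hw : w ∈ P.Y) :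
    ‖P.gradDual par.γ₁ par.γ₂ x z w l - P.gradDual par.γ₁ par.γ₂ x' z' w l‖ ≤
      p * M * ‖x - x'‖ + p * |par.γ₂| * ‖z - z'‖ := by
  refine (norm_le_sum_abs _).trans ?_
  have : ∀ i ∈ Finset.univ,
      |(P.gradDual par.γ₁ par.γ₂ x z w l - P.gradDual par.γ₁ par.γ₂ x' z' w l) i| ≤
      M * ‖x - x'‖ + |par.γ₂| * ‖z - z'‖ := by
    intro i _
    have e : (P.gradDual par.γ₁ par.γ₂ x z w l - P.gradDual par.γ₁ par.γ₂ x' z' w l) i =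
        (max 0 (par.γ₁ * l i + P.H i (pair x w)) - max 0 (par.γ₁ * l i + P.H i (pair x' w))) +
        par.γ₂ * (z - z') i := by
      simp only [gradDual, PiLp.sub_apply]
      ring
    rw [e]
    refine (abs_add_le _ _).trans (add_le_add ?_ ?_)
    · refine (abs_max_zero_sub_le _ _).trans ?_
      rw [add_sub_add_left_eq_sub, ← norm_pair_sub_pair_left x x' w]
      exact hP.H_lipschitz i ⟨hx, hw⟩ ⟨hx', hw⟩
    · rw [abs_mul]
      gcongr
      exact abs_apply_le_norm (z - z') i
  refine (Finset.sum_le_sum this).trans_eq ?_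
  simp only [Finset.sum_const, Finset.card_univ, Fintype.card_fin, nsmul_eq_mul]
  ring

end

/-- The Lipschitz modulus of `∇_{(x, w)} L` on bounded multipliers. -/
def gradLip (par : Params) (p : ℕ) (M : ℝ) : ℝ :=
  M + 1 / par.γ₁ * (p * ((par.γ₁ * par.dualBound p M + M) * M + M * M)) + p * M

/-- The Lipschitz modulus of the saddle point as a function of `(x, z)`. -/
def saddleLip (par : Params) (p : ℕ) (M μ : ℝ) : ℝ :=
  2 * (gradLip par p M + p * M + p * par.γ₂) / min μ par.γ₂

section

variable (hP : P.Assumptions (Constants.uniform M μ)) (hv : par.Valid M μ)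

include hv in
theorem gradLip_nonneg : 0 ≤ gradLip par p M := by
  have h1 := hv.M_pos
  have h2 := hv.hγ₁
  have h3 := hv.dualBound_nonneg p
  unfold gradLip
  positivity

include hv in
theorem saddleLip_nonneg : 0 ≤ saddleLip par p M μ := by
  have h0 := gradLip_nonneg (p := p) hv
  have h1 := hv.M_pos
  have h2 := hv.hγ₂
  have h3 := hv.hμ
  unfold saddleLip
  positivity

include hP hv

theorem norm_meanGradL_sub_le' {v v' : XY m n} {l l' : Vec p} (h : v ∈ P.dom) (h' : v' ∈ P.dom)
    (hl0 : ∀ i, 0 ≤ l i) (hl : ∀ i, l i ≤ par.dualBound p M) :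
    ‖P.meanGradL par.γ₁ v l - P.meanGradL par.γ₁ v' l'‖ ≤
      gradLip par p M * (‖v - v'‖ + ‖l - l'‖) := by
  refine (norm_meanGradL_sub_le hP hv.M_pos.le hv.hγ₁ h h' hl0 hl).trans ?_
  have h1 := hv.M_pos
  have h2 := hv.hγ₁
  have h3 := hv.dualBound_nonneg p
  rw [mul_add (gradLip par p M)]
  refine add_le_add (mul_le_mul_of_nonneg_right ?_ (norm_nonneg _))
    (mul_le_mul_of_nonneg_right ?_ (norm_nonneg _))
  · exact le_add_of_nonneg_right (by positivity)
  · exact le_add_of_nonneg_left (by positivity)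

/-- The saddle point depends on `(x, z)` in a Lipschitz way: strong monotonicity for `(x, z)` is
tested at the saddle point for `(x', z')`, which satisfies its own first-order conditions, and the
two saddle operators differ by a multiple of `‖x - x'‖ + ‖z - z'‖`. -/
theorem IsSaddle.norm_sub_le {x x' : Vec m} {z z' : Vec p} {w w' : Vec n} {l l' : Vec p}
    (hs : P.IsSaddle par x z w l) (hs' : P.IsSaddle par x' z' w' l') (hx : x ∈ P.X)
    (hx' : x' ∈ P.X) (hz : ∀ i, 0 ≤ z i ∧ z i ≤ par.box p)
    (hz' : ∀ i, 0 ≤ z' i ∧ z' i ≤ par.box p) :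
    ‖w - w'‖ + ‖l - l'‖ ≤ saddleLip par p M μ * (‖x - x'‖ + ‖z - z'‖) := by
  have h1 := hs.strong_monotone hP hv hx (fun i => (hz i).1) hs'.mem l'
  have h2 := hs'.primal w hs.mem
  have h3 : P.gradDual par.γ₁ par.γ₂ x' z' w' l' = 0 := by
    rw [hs'.dual]
    exact gradDual_dualOpt hv w' fun i => (hz' i).1
  have h4 := norm_gradDual_sub_le (par := par) hP x x' z z' l' hx hx' hs'.mem
  rw [h3, sub_zero, abs_of_pos hv.hγ₂] at h4
  have h5 := norm_meanGradL_sub_le' hP hv (v := pair x w') (v' := pair x' w') (l' := l')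
    ⟨hx, hs'.mem⟩ ⟨hx', hs'.mem⟩ (fun i => hs'.dual_nonneg hv (fun i => (hz' i).1) i)
    (fun i => hs'.dual_le hP hv hx' hz' i)
  rw [sub_self, norm_zero, add_zero, norm_pair_sub_pair_left] at h5
  have h6 : inner ℝ (P.meanGradL par.γ₁ (pair x w') l').snd (w' - w) ≤
      gradLip par p M * ‖x - x'‖ * ‖w - w'‖ := by
    have h7 : inner ℝ (P.meanGradL par.γ₁ (pair x w') l').snd (w' - w) ≤
        inner ℝ (P.meanGradL par.γ₁ (pair x w') l' - P.meanGradL par.γ₁ (pair x' w') l').snd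
          (w' - w) := by
      rw [WithLp.sub_snd, inner_sub_left]
      rw [← neg_sub w' w, inner_neg_right] at h2
      linarith
    refine h7.trans ((real_inner_le_norm _ _).trans ?_)
    rw [norm_sub_rev w' w]
    gcongr
    exact (WithLp.norm_snd_le _ _).trans h5
  have h8 : - inner ℝ (P.gradDual par.γ₁ par.γ₂ x z w' l') (l' - l) ≤
      (p * M * ‖x - x'‖ + p * par.γ₂ * ‖z - z'‖) * ‖l - l'‖ := by
    rw [← inner_neg_right, neg_sub]
    exact (real_inner_le_norm _ _).trans (by gcongr)
  have hm : 0 < min μ par.γ₂ := lt_min hv.hμ hv.hγ₂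
  have hM := hv.M_pos
  have hγ₂ := hv.hγ₂
  have hg := gradLip_nonneg (p := p) hv
  set C := gradLip par p M + p * M + p * par.γ₂ with hC
  set D := ‖x - x'‖ + ‖z - z'‖ with hD
  set S := ‖w - w'‖ + ‖l - l'‖ with hS
  have h9 : min μ par.γ₂ * S ^ 2 ≤ 2 * C * D * S := by
    have a1 : min μ par.γ₂ * ‖w' - w‖ ^ 2 ≤ μ * ‖w' - w‖ ^ 2 := by gcongr; exact min_le_left _ _
    have a2 : min μ par.γ₂ * ‖l' - l‖ ^ 2 ≤ par.γ₂ * ‖l' - l‖ ^ 2 := by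
      gcongr; exact min_le_right _ _
    rw [norm_sub_rev w' w] at a1 h1
    rw [norm_sub_rev l' l] at a2 h1
    have a3 : S ^ 2 ≤ 2 * (‖w - w'‖ ^ 2 + ‖l - l'‖ ^ 2) := add_sq_le
    have a4 : gradLip par p M * ‖x - x'‖ * ‖w - w'‖ ≤ gradLip par p M * D * S := by
      gcongr
      · exact le_add_of_nonneg_right (norm_nonneg _)
      · exact le_add_of_nonneg_right (norm_nonneg _)
    have a5 : (p * M * ‖x - x'‖ + p * par.γ₂ * ‖z - z'‖) * ‖l - l'‖ ≤
        (p * M * D + p * par.γ₂ * D) * S := by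
      gcongr
      · exact le_add_of_nonneg_right (norm_nonneg _)
      · exact le_add_of_nonneg_left (norm_nonneg _)
      · exact le_add_of_nonneg_left (norm_nonneg _)
    have a6 := mul_le_mul_of_nonneg_left a3 hm.le
    rw [hC]
    linarith
  have hS0 : 0 ≤ S := by positivity
  rw [saddleLip, div_mul_eq_mul_div, le_div_iff₀ hm]
  rcases hS0.eq_or_lt with h0 | h0
  · rw [← h0]
    have : 0 ≤ C := by positivity
    have : 0 ≤ D := by positivity
    rw [zero_mul]
    positivity
  · refine le_of_mul_le_mul_right ?_ h0
    linarith

end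

/-! ### Differentiability of the envelope -/

/-- The gradient in `(x, y, z)` of `ℓ(x, z, w, l)` for fixed `(w, l)`. -/
def gradLagr (P : Problem m n p Ωξ Ωζ) (par : Params) (x : Vec m) (z : Vec p) (w : Vec n)
    (l : Vec p) : XYZ m n p :=
  WithLp.toLp 2 (pair (P.meanGradL par.γ₁ (pair x w) l).fst 0, par.γ₂ • (l - z))

/-- The gradient at `u` of `(x, y, z) ↦ f (x, w)`, if `g` is the gradient of `f` at `(x, w)`. -/
def liftGrad (p : ℕ) (g : XY m n) : XYZ m n p := WithLp.toLp 2 (pair g.fst 0, 0)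

theorem inner_liftGrad (g : XY m n) (d : XYZ m n p) :
    inner ℝ (liftGrad p g) d = inner ℝ g.fst d.fst.fst := by
  change inner ℝ (pair g.fst (0 : Vec n)) d.fst + inner ℝ (0 : Vec p) d.snd = _
  change inner ℝ g.fst d.fst.fst + inner ℝ (0 : Vec n) d.fst.snd + inner ℝ (0 : Vec p) d.snd = _
  simp

theorem inner_gradLagr (x : Vec m) (z : Vec p) (w : Vec n) (l : Vec p) (d : XYZ m n p) :
    inner ℝ (P.gradLagr par x z w l) d =
      inner ℝ (P.meanGradL par.γ₁ (pair x w) l).fst d.fst.fst + par.γ₂ * inner ℝ (l - z) d.snd := by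
  change inner ℝ (P.meanGradL par.γ₁ (pair x w) l).fst d.fst.fst + inner ℝ (0 : Vec n) d.fst.snd
    + inner ℝ (par.γ₂ • (l - z)) d.snd = _
  rw [inner_zero_left, add_zero, inner_smul_left]
  rfl

theorem hasGradientAt_liftGrad {f : XY m n → ℝ} {g : XY m n} {w : Vec n} {u : XYZ m n p}
    (h : HasGradientAt f g (pair u.fst.fst w)) :
    HasGradientAt (fun u' : XYZ m n p => f (pair u'.fst.fst w)) (liftGrad p g) u := by
  rw [hasGradientAt_iff_isLittleO] at h ⊢
  have hc : Continuous fun u' : XYZ m n p => pair u'.fst.fst w :=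
    continuous_pair.comp (by fun_prop : Continuous fun u' : XYZ m n p => (u'.fst.fst, w))
  have h2 := h.comp_tendsto (hc.tendsto' u _ rfl)
  refine (h2.congr_left fun u' => ?_).trans_isBigO ?_
  · simp only [Function.comp]
    rw [inner_liftGrad]
    congr 1
    change inner ℝ g.fst _ + inner ℝ g.snd (w - w) = _
    simp
  · refine Asymptotics.IsBigO.of_bound 1 (Eventually.of_forall fun u' => ?_)
    simp only [Function.comp, one_mul]
    rw [norm_pair_sub_pair_left]
    exact (WithLp.norm_fst_le _ (u' - u).fst).trans (WithLp.norm_fst_le _ (u' - u))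

section

variable (hP : P.Assumptions (Constants.uniform M μ)) (hv : par.Valid M μ)
include hP

/-- The lower-level functions are continuous on `{x'} × Y` for `x'` near a point of `X`, inside
`X` or not. -/
theorem eventually_continuousOn {x : Vec m} (hx : x ∈ P.X) :
    ∀ᶠ x' in 𝓝 x, ContinuousOn (fun w => P.G (pair x' w)) P.Y ∧
      ∀ i, ContinuousOn (fun w => P.H i (pair x' w)) P.Y := by
  have key : ∀ f : XY m n → ℝ, (∀ v ∈ P.dom, ContDiffAt ℝ 1 f v) →
      ∀ᶠ x' in 𝓝 x, ContinuousOn (fun w => f (pair x' w)) P.Y := by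
    intro f hf
    have h1 : ∀ᶠ x' in 𝓝 x, ∀ w ∈ P.Y, ContinuousAt f (pair x' w) := by
      refine hP.Y_compact.eventually_forall_of_forall_eventually fun w hw => ?_
      have h2 : ∀ᶠ v in 𝓝 (pair x w), ContinuousAt f v :=
        ((hf (pair x w) ⟨hx, hw⟩).eventually (by simp)).mono fun v hv => hv.continuousAt
      exact (continuous_pair.tendsto (x, w)).eventually h2
    filter_upwards [h1] with x' hx' w hw
    have : Continuous fun w : Vec n => pair x' w :=
      continuous_pair.comp (Continuous.prodMk_right x')
    exact (ContinuousAt.comp (f := fun w : Vec n => pair x' w) (hx' w hw)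
      this.continuousAt).continuousWithinAt
  exact (key P.G hP.G_smooth).and (eventually_all.2 fun i => key (P.H i) (hP.H_smooth i))

theorem eventually_bddBelow {x : Vec m} (hx : x ∈ P.X) :
    ∀ᶠ x' in 𝓝 x, ∀ l, BddBelow (Set.range fun y : P.Y => P.augLagrangian par.γ₁ x' y l) := by
  filter_upwards [eventually_continuousOn hP hx] with x' hx' l
  have hc : ContinuousOn (fun y => P.augLagrangian par.γ₁ x' y l) P.Y := by
    refine hx'.1.add (continuousOn_const.mul (continuousOn_finsetSum _ fun i _ => ?_))
    exact ((continuousOn_const.sup (continuousOn_const.add (hx'.2 i))).pow 2).sub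
      continuousOn_const
  have := (hP.Y_compact.image_of_continuousOn hc).bddBelow
  rwa [Set.image_eq_range] at this

include hv

/-- A linear lower model of the augmented Lagrangian near its minimizer `w` over `Y`, from strict
differentiability. -/
theorem eventually_le_augLagrangian_near {x : Vec m} {w : Vec n} {l : Vec p}
    (hd : pair x w ∈ P.dom)
    (hmin : ∀ w' ∈ P.Y, P.augLagrangian par.γ₁ x w l ≤ P.augLagrangian par.γ₁ x w' l)
    {c : ℝ} (hc : 0 < c) :
    ∀ᶠ a : Vec m × Vec n in 𝓝 (x, w), a.2 ∈ P.Y → P.augLagrangian par.γ₁ x w l +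
      inner ℝ (P.meanGradL par.γ₁ (pair x w) l).fst (a.1 - x) - c * ‖a.1 - x‖ ≤
        P.augLagrangian par.γ₁ a.1 a.2 l := by
  have h1 := (hasStrictFDerivAt_augLagrangian hP hv l hd).isLittleO.def hc
  have hc2 : Continuous fun a : Vec m × Vec n => pair x a.2 :=
    continuous_pair.comp (by fun_prop : Continuous fun a : Vec m × Vec n => (x, a.2))
  have ht : Tendsto (fun a : Vec m × Vec n => (pair a.1 a.2, pair x a.2)) (𝓝 (x, w))
      (𝓝 (pair x w, pair x w)) := (continuous_pair.prodMk hc2).tendsto (x, w)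
  filter_upwards [ht.eventually h1] with a ha haY
  have h2 := hmin a.2 haY
  rw [norm_pair_sub_pair_left, InnerProductSpace.toDual_apply_apply, Real.norm_eq_abs] at ha
  have h3 : inner ℝ (P.meanGradL par.γ₁ (pair x w) l) (pair a.1 a.2 - pair x a.2) =
      inner ℝ (P.meanGradL par.γ₁ (pair x w) l).fst (a.1 - x) := by
    rw [WithLp.prod_inner_apply]
    simp
  rw [h3] at ha
  have h4 := (abs_le.1 ha).1
  simp only [pair_fst, pair_snd] at h4
  linarith

/-- The lower model away from the minimizer, from the gap between the value and the minimum. -/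
theorem eventually_le_augLagrangian_far {x : Vec m} {w w₀ : Vec n} {l : Vec p}
    (hd : pair x w₀ ∈ P.dom) (hlt : P.augLagrangian par.γ₁ x w l < P.augLagrangian par.γ₁ x w₀ l)
    (c : ℝ) :
    ∀ᶠ a : Vec m × Vec n in 𝓝 (x, w₀), P.augLagrangian par.γ₁ x w l +
      inner ℝ (P.meanGradL par.γ₁ (pair x w) l).fst (a.1 - x) - c * ‖a.1 - x‖ ≤
        P.augLagrangian par.γ₁ a.1 a.2 l := by
  have hA := HasGradientAt.continuousAt (hasGradientAt_augLagrangian hP hv l hd)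
  have h1 : Tendsto (fun a : Vec m × Vec n => P.augLagrangian par.γ₁ a.1 a.2 l) (𝓝 (x, w₀))
      (𝓝 (P.augLagrangian par.γ₁ x w₀ l)) :=
    Tendsto.comp hA (continuous_pair.tendsto (x, w₀))
  have h2 : Tendsto (fun a : Vec m × Vec n => P.augLagrangian par.γ₁ x w l +
      inner ℝ (P.meanGradL par.γ₁ (pair x w) l).fst (a.1 - x) - c * ‖a.1 - x‖) (𝓝 (x, w₀))
      (𝓝 (P.augLagrangian par.γ₁ x w l)) := by
    generalize P.augLagrangian par.γ₁ x w l = A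
    generalize (P.meanGradL par.γ₁ (pair x w) l).fst = g
    exact Continuous.tendsto' (by fun_prop) _ _ (by simp)
  filter_upwards [h2.eventually_lt h1 hlt] with a ha using ha.le

/-- A linear lower model of the augmented Lagrangian with the multiplier of the saddle point,
uniform in `w' ∈ Y`. -/
theorem IsSaddle.eventually_le_augLagrangian {x : Vec m} {z : Vec p} {w : Vec n} {l : Vec p}
    (hs : P.IsSaddle par x z w l) (hx : x ∈ P.X) {c : ℝ} (hc : 0 < c) :
    ∀ᶠ x' in 𝓝 x, ∀ w' ∈ P.Y, P.augLagrangian par.γ₁ x w l +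
      inner ℝ (P.meanGradL par.γ₁ (pair x w) l).fst (x' - x) - c * ‖x' - x‖ ≤
        P.augLagrangian par.γ₁ x' w' l := by
  have hmin : ∀ w' ∈ P.Y, P.augLagrangian par.γ₁ x w l + μ / 2 * ‖w' - w‖ ^ 2 ≤
      P.augLagrangian par.γ₁ x w' l := by
    intro w' hw'
    have := augLagrangian_first_order hP hv l hx hs.mem hw'
    have := hs.primal w' hw'
    linarith
  have hμ := hv.hμ
  have key : ∀ᶠ x' in 𝓝 x, ∀ w' ∈ P.Y, w' ∈ P.Y → P.augLagrangian par.γ₁ x w l +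
      inner ℝ (P.meanGradL par.γ₁ (pair x w) l).fst (x' - x) - c * ‖x' - x‖ ≤
        P.augLagrangian par.γ₁ x' w' l := by
    refine hP.Y_compact.eventually_forall_of_forall_eventually fun w₀ hw₀ => ?_
    rcases eq_or_ne w₀ w with rfl | hne
    · refine eventually_le_augLagrangian_near hP hv ⟨hx, hw₀⟩ (fun w' hw' => ?_) hc
      exact (le_add_of_nonneg_right (by positivity)).trans (hmin w' hw')
    · have h4 : 0 < ‖w₀ - w‖ := norm_pos_iff.2 (sub_ne_zero.2 hne)
      have h5 : 0 < μ / 2 * ‖w₀ - w‖ ^ 2 := by positivity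
      filter_upwards [eventually_le_augLagrangian_far hP hv ⟨hx, hw₀⟩
        ((lt_add_of_pos_right _ h5).trans_le (hmin w₀ hw₀)) c] with a ha _ using ha
  filter_upwards [key] with x' hx' w' hw' using hx' w' hw' hw'

omit hP in
/-- Every dual value is at most the quadratic upper model around the saddle point. -/
theorem IsSaddle.lagr_le_model {x x' : Vec m} {z z' : Vec p} {w : Vec n} {l : Vec p}
    (hs : P.IsSaddle par x z w l) (hz : ∀ i, 0 ≤ z i) (l' : Vec p) :
    P.lagr par (pair x' w) z' l' ≤ P.G (pair x' w) +
      ∑ i, (dualTerm par.γ₁ par.γ₂ (P.H i (pair x w)) (z i) (l i)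
      + 1 / par.γ₁ * max 0 (par.γ₁ * l i + P.H i (pair x w)) *
          (P.H i (pair x' w) - P.H i (pair x w))
      + par.γ₂ * (l i - z i) * (z' i - z i)
      + ((1 / par.γ₂ + 1 / (2 * par.γ₁)) * (P.H i (pair x' w) - P.H i (pair x w)) ^ 2
        + par.γ₂ * (z' i - z i) ^ 2)) := by
  refine add_le_add le_rfl (Finset.sum_le_sum fun i _ => ?_)
  rw [hs.dual]
  exact dualTerm_le_model hv.hγ₁ hv.hγ₂ (hz i)

omit hv in
/-- The upper model is differentiable, with the gradient of `ℓ` at the saddle point. -/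
theorem IsSaddle.hasGradientAt_model {u : XYZ m n p} {w : Vec n} {l : Vec p}
    (hs : P.IsSaddle par u.fst.fst u.snd w l) (hx : u.fst.fst ∈ P.X) :
    HasGradientAt (fun u' : XYZ m n p => P.G (pair u'.fst.fst w) +
      ∑ i, (dualTerm par.γ₁ par.γ₂ (P.H i (pair u.fst.fst w)) (u.snd i) (l i)
      + 1 / par.γ₁ * max 0 (par.γ₁ * l i + P.H i (pair u.fst.fst w)) *
          (P.H i (pair u'.fst.fst w) - P.H i (pair u.fst.fst w))
      + par.γ₂ * (l i - u.snd i) * (u'.snd i - u.snd i)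
      + ((1 / par.γ₂ + 1 / (2 * par.γ₁)) * (P.H i (pair u'.fst.fst w)
        - P.H i (pair u.fst.fst w)) ^ 2 + par.γ₂ * (u'.snd i - u.snd i) ^ 2)))
      (P.gradLagr par u.fst.fst u.snd w l) u := by
  have hd : pair u.fst.fst w ∈ P.dom := ⟨hx, hs.mem⟩
  have hG := (hasGradientAt_liftGrad (p := p) (hP.hasGradientAt_G hd)).hasFDerivAt
  have hH := fun i => ((hasGradientAt_liftGrad (p := p) (hP.hasGradientAt_H i hd)).hasFDerivAt
    ).sub_const (P.H i (pair u.fst.fst w))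
  have hZ : ∀ i, HasFDerivAt (fun u' : XYZ m n p => u'.snd i - u.snd i)
      ((EuclideanSpace.proj i).comp (WithLp.sndL 2 ℝ (XY m n) (Vec p))) u := fun i =>
    (((EuclideanSpace.proj (𝕜 := ℝ) i).comp
      (WithLp.sndL 2 ℝ (XY m n) (Vec p))).hasFDerivAt).sub_const _
  have hsum := HasFDerivAt.fun_sum fun i (_ : i ∈ Finset.univ) =>
    (((((hH i).const_mul (1 / par.γ₁ * max 0 (par.γ₁ * l i + P.H i (pair u.fst.fst w)))).const_add
      (dualTerm par.γ₁ par.γ₂ (P.H i (pair u.fst.fst w)) (u.snd i) (l i))).add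
      ((hZ i).const_mul (par.γ₂ * (l i - u.snd i)))).add
      ((((hH i).pow 2).const_mul (1 / par.γ₂ + 1 / (2 * par.γ₁))).add
        (((hZ i).pow 2).const_mul par.γ₂)))
  rw [hasGradientAt_iff_hasFDerivAt]
  refine (hG.add hsum).congr_fderiv ?_
  ext d
  simp only [InnerProductSpace.toDual_apply_apply, inner_gradLagr, _root_.add_apply,
    _root_.sum_apply, _root_.smul_apply, inner_liftGrad, sub_self,
    ContinuousLinearMap.comp_apply, smul_eq_mul]
  have hs' : ∀ (s : Finset (Fin p)) (f : Fin p → XY m n), (∑ i ∈ s, f i).fst = ∑ i ∈ s, (f i).fst :=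
    fun s f => map_sum (WithLp.fstL 2 ℝ (Vec m) (Vec n)) f s
  rw [meanGradL, WithLp.add_fst, WithLp.smul_fst, hs', inner_add_left, inner_smul_left, sum_inner,
    PiLp.inner_apply (l - u.snd), Finset.mul_sum, Finset.mul_sum, add_assoc,
    ← Finset.sum_add_distrib]
  congr 1
  refine Finset.sum_congr rfl fun i _ => ?_
  rw [WithLp.smul_fst, inner_smul_left]
  simp
  ring

/-- The gradient of the envelope (Danskin): that of `ℓ` in `(x, z)` at the saddle point. The point
`x` may lie on the boundary of `X`; all `x'` near `x` are covered. -/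
theorem IsSaddle.hasGradientAt_envelope {u : XYZ m n p} {w : Vec n} {l : Vec p}
    (hs : P.IsSaddle par u.fst.fst u.snd w l) (hx : u.fst.fst ∈ P.X) (hz : ∀ i, 0 ≤ u.snd i) :
    HasGradientAt (fun u' : XYZ m n p => P.envelope par.γ₁ par.γ₂ u'.fst.fst u'.snd)
      (P.gradLagr par u.fst.fst u.snd w l) u := by
  have hmodel := hs.hasGradientAt_model hP hx
  set U := fun u' : XYZ m n p => P.G (pair u'.fst.fst w) +
      ∑ i, (dualTerm par.γ₁ par.γ₂ (P.H i (pair u.fst.fst w)) (u.snd i) (l i)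
      + 1 / par.γ₁ * max 0 (par.γ₁ * l i + P.H i (pair u.fst.fst w)) *
          (P.H i (pair u'.fst.fst w) - P.H i (pair u.fst.fst w))
      + par.γ₂ * (l i - u.snd i) * (u'.snd i - u.snd i)
      + ((1 / par.γ₂ + 1 / (2 * par.γ₁)) * (P.H i (pair u'.fst.fst w)
        - P.H i (pair u.fst.fst w)) ^ 2 + par.γ₂ * (u'.snd i - u.snd i) ^ 2)) with hU
  have hUu : U u = P.lagr par (pair u.fst.fst w) u.snd l := by
    simp [hU, lagr]
  have hl : l ∈ orthant p := fun i => hs.dual_nonneg hv hz i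
  have hne : Nonempty (orthant p) := ⟨⟨l, hl⟩⟩
  have hYne : Nonempty P.Y := ⟨⟨w, hs.mem⟩⟩
  have htx : Tendsto (fun u' : XYZ m n p => u'.fst.fst) (𝓝 u) (𝓝 u.fst.fst) :=
    Continuous.tendsto (by fun_prop) u
  -- Above: the point `w` of the saddle point competes in every infimum.
  have hterm : ∀ u' : XYZ m n p, (∀ l, BddBelow (Set.range fun y : P.Y =>
      P.augLagrangian par.γ₁ u'.fst.fst y l)) → ∀ l' : orthant p,
      P.dualFn par.γ₁ u'.fst.fst l' - par.γ₂ / 2 * ‖(l' : Vec p) - u'.snd‖ ^ 2 ≤ U u' := by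
    intro u' hb l'
    refine le_trans ?_ (hs.lagr_le_model hv hz (x' := u'.fst.fst) (z' := u'.snd) l')
    rw [← augLagrangian_sub_eq_lagr]
    exact sub_le_sub_right (ciInf_le (hb l') ⟨w, hs.mem⟩) _
  -- For `x'` outside `X`, boundedness below keeps the infimum in `dualFn` from being a junk value.
  have hupper := htx.eventually (eventually_bddBelow (par := par) hP hx)
  -- Below: the multiplier `l` of the saddle point competes in the supremum.
  have hlower : ∀ c > 0, ∀ᶠ u' in 𝓝 u, P.augLagrangian par.γ₁ u.fst.fst w l +
      inner ℝ (P.meanGradL par.γ₁ (pair u.fst.fst w) l).fst (u'.fst.fst - u.fst.fst)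
        - c * ‖u'.fst.fst - u.fst.fst‖ - par.γ₂ / 2 * ‖l - u'.snd‖ ^ 2 ≤
      P.envelope par.γ₁ par.γ₂ u'.fst.fst u'.snd := by
    intro c hc
    filter_upwards [hupper, htx.eventually (hs.eventually_le_augLagrangian hP hv hx hc)]
      with u' hb hu'
    refine le_trans (sub_le_sub_right (le_ciInf fun y : P.Y => hu' y y.2) _)
      (le_ciSup (f := fun l : orthant p => P.dualFn par.γ₁ u'.fst.fst l
        - par.γ₂ / 2 * ‖(l : Vec p) - u'.snd‖ ^ 2) ⟨U u', ?_⟩ ⟨l, hl⟩)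
    rintro _ ⟨l', rfl⟩
    exact hterm u' hb l'
  have hupper' : ∀ᶠ u' in 𝓝 u, P.envelope par.γ₁ par.γ₂ u'.fst.fst u'.snd ≤ U u' := by
    filter_upwards [hupper] with u' hb using ciSup_le (hterm u' hb)
  have hval : P.envelope par.γ₁ par.γ₂ u.fst.fst u.snd = U u := by
    refine le_antisymm hupper'.self_of_nhds ?_
    have := (hlower 1 one_pos).self_of_nhds
    rw [hUu, ← augLagrangian_sub_eq_lagr]
    simpa using this
  rw [hasGradientAt_iff_isLittleO] at hmodel ⊢
  refine Asymptotics.isLittleO_iff.2 fun c hc => ?_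
  have hsmall : ∀ᶠ u' in 𝓝 u, par.γ₂ * ‖u' - u‖ < c := by
    have hcont : Continuous fun u' : XYZ m n p => par.γ₂ * ‖u' - u‖ := by fun_prop
    have h0 : Tendsto (fun u' : XYZ m n p => par.γ₂ * ‖u' - u‖) (𝓝 u) (𝓝 0) :=
      hcont.tendsto' _ _ (by simp)
    exact h0.eventually_lt_const hc
  filter_upwards [hupper', hlower (c / 2) (half_pos hc), hmodel.def hc, hsmall]
    with u' h1 h2 h3 h4
  rw [Real.norm_eq_abs] at h3 ⊢
  rw [hval]
  refine abs_le.2 ⟨?_, ?_⟩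
  · rw [hUu, ← augLagrangian_sub_eq_lagr, inner_gradLagr]
    simp only [pair_fst, pair_snd]
    have e : ‖l - u'.snd‖ ^ 2 = ‖l - u.snd‖ ^ 2 - 2 * inner ℝ (l - u.snd) (u' - u).snd
        + ‖(u' - u).snd‖ ^ 2 := by
      rw [← norm_sub_sq_real]
      congr 2
      rw [WithLp.sub_snd]
      abel
    rw [e] at h2
    have h5 : ‖u'.fst.fst - u.fst.fst‖ ≤ ‖u' - u‖ :=
      (WithLp.norm_fst_le _ (u' - u).fst).trans (WithLp.norm_fst_le _ (u' - u))
    have h6 : ‖(u' - u).snd‖ ≤ ‖u' - u‖ := WithLp.norm_snd_le _ _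
    have h7 : par.γ₂ / 2 * ‖(u' - u).snd‖ ^ 2 ≤ c / 2 * ‖u' - u‖ := by
      have h8 : ‖(u' - u).snd‖ ^ 2 ≤ ‖u' - u‖ ^ 2 := by gcongr
      have h9 := mul_le_mul_of_nonneg_left h8 (half_pos hv.hγ₂).le
      nlinarith [norm_nonneg (u' - u)]
    have h8 : c / 2 * ‖u'.fst.fst - u.fst.fst‖ ≤ c / 2 * ‖u' - u‖ := by gcongr
    change _ ≤ _ - (inner ℝ _ (u'.fst.fst - u.fst.fst) + _)
    linarith
  · have := (abs_le.1 h3).2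
    linarith

end

/-! ### The penalized objective -/

/-- The embedding `v ↦ (v, 0)` of `ℝᵐ × ℝⁿ` into `ℝᵐ × ℝⁿ × ℝᵖ`. -/
def embedXY (m n p : ℕ) : XY m n →ₗ[ℝ] XYZ m n p :=
  (WithLp.linearEquiv 2 ℝ (XY m n × Vec p)).symm.toLinearMap ∘ₗ LinearMap.inl ℝ (XY m n) (Vec p)

/-- The gradient of `Ψ` at `u`, in terms of the saddle point `(w, l)` for `u`. -/
def gradPsi (P : Problem m n p Ωξ Ωζ) (par : Params) (c₁ c₂ : ℝ) (u : XYZ m n p) (w : Vec n)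
    (l : Vec p) : XYZ m n p :=
  embedXY m n p (∇ P.F u.fst + c₁ • ∇ P.G u.fst +
    c₂ • ∑ i, (max 0 (P.H i u.fst)) • ∇ (P.H i) u.fst) -
    c₁ • P.gradLagr par u.fst.fst u.snd w l

theorem hasFDerivAt_comp_fst {f : XY m n → ℝ} {g : XY m n} {u : XYZ m n p}
    (h : HasGradientAt f g u.fst) :
    HasFDerivAt (fun u' : XYZ m n p => f u'.fst)
      (InnerProductSpace.toDual ℝ (XYZ m n p) (embedXY m n p g)) u := by
  have := HasFDerivAt.comp u h.hasFDerivAt (WithLp.fstL 2 ℝ (XY m n) (Vec p)).hasFDerivAt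
  refine this.congr_fderiv ?_
  ext d
  change inner ℝ g d.fst = inner ℝ g d.fst + inner ℝ (0 : Vec p) d.snd
  simp

theorem norm_embedXY (g : XY m n) : ‖embedXY m n p g‖ = ‖g‖ :=
  WithLp.norm_toLp_fst 2 _ _ g

theorem convex_U (hP : P.Assumptions (Constants.uniform M μ)) : Convex ℝ (P.U par) := by
  intro u hu u' hu' a b ha hb hab
  refine ⟨hP.dom_convex hu.1 hu'.1 ha hb hab, fun i => ?_⟩
  have h : (a • u + b • u').snd i = a * u.snd i + b * u'.snd i := rfl
  rw [h]
  have h1 := hu.2 i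
  have h2 := hu'.2 i
  constructor
  · exact add_nonneg (mul_nonneg ha h1.1) (mul_nonneg hb h2.1)
  · calc _ ≤ a * (par.B / √p) + b * (par.B / √p) :=
          add_le_add (mul_le_mul_of_nonneg_left h1.2 ha) (mul_le_mul_of_nonneg_left h2.2 hb)
      _ = _ := by rw [← add_mul, hab, one_mul]

theorem compact_U (hP : P.Assumptions (Constants.uniform M μ)) : IsCompact (P.U par) := by
  have hbox : IsCompact {z : Vec p | ∀ i, 0 ≤ z i ∧ z i ≤ par.B / √p} := by
    have := (isCompact_univ_pi fun _ : Fin p => isCompact_Icc (a := (0 : ℝ))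
      (b := par.B / √p)).image (PiLp.continuous_toLp 2 _)
    convert this using 1
    ext z
    constructor
    · exact fun h => ⟨z.ofLp, fun i _ => h i, rfl⟩
    · rintro ⟨a, ha, rfl⟩ i
      exact ha i trivial
  have := (hP.dom_compact.prod hbox).image (WithLp.prod_continuous_toLp 2 (XY m n) (Vec p))
  convert this using 1
  ext v
  constructor
  · exact fun h => ⟨(v.fst, v.snd), h, rfl⟩
  · rintro ⟨a, ha, rfl⟩
    exact ha

/-- The Lipschitz modulus of the gradient of the envelope. -/
def envelopeLip (par : Params) (p : ℕ) (M μ : ℝ) : ℝ :=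
  (gradLip par p M + par.γ₂) * (1 + 2 * saddleLip par p M μ)

/-- The Lipschitz modulus of `∇Ψ` is this constant times `1 + c₁ + c₂`. -/
def psiLip (par : Params) (p : ℕ) (M μ : ℝ) : ℝ :=
  M + p * (M * M + M * M) + envelopeLip par p M μ

section

variable (hP : P.Assumptions (Constants.uniform M μ)) (hv : par.Valid M μ)

include hv in
theorem envelopeLip_nonneg : 0 ≤ envelopeLip par p M μ := by
  have h1 := gradLip_nonneg (p := p) hv
  have h2 := saddleLip_nonneg (p := p) hv
  have h3 := hv.hγ₂
  unfold envelopeLip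
  positivity

include hv in
theorem psiLip_pos : 0 < psiLip par p M μ := by
  have h1 := envelopeLip_nonneg (p := p) hv
  have h2 := hv.M_pos
  unfold psiLip
  positivity

include hP hv

theorem exists_isSaddle_of_mem {u : XYZ m n p} (hu : u ∈ P.U par) :
    ∃ w l, P.IsSaddle par u.fst.fst u.snd w l :=
  exists_isSaddle hP hv hu.1.1 (fun i => (hu.2 i).1) ⟨_, hu.1.2⟩

theorem IsSaddle.hasGradientAt_Ψ {u : XYZ m n p} {w : Vec n} {l : Vec p}
    (hs : P.IsSaddle par u.fst.fst u.snd w l) (hu : u ∈ P.U par) (c₁ c₂ : ℝ) :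
    HasGradientAt (P.Ψ par c₁ c₂) (P.gradPsi par c₁ c₂ u w l) u := by
  have hE := (hs.hasGradientAt_envelope hP hv hu.1.1 fun i => (hu.2 i).1).hasFDerivAt
  have hF := hasFDerivAt_comp_fst (p := p) (hP.hasGradientAt_F hu.1)
  have hG := hasFDerivAt_comp_fst (p := p) (hP.hasGradientAt_G hu.1)
  have hH := fun i => (hasDerivAt_sq_max_zero (P.H i u.fst)).comp_hasFDerivAt u
    (hasFDerivAt_comp_fst (p := p) (hP.hasGradientAt_H i hu.1))
  have := (hF.add ((hG.sub hE).const_mul c₁)).add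
    ((HasFDerivAt.fun_sum fun i (_ : i ∈ Finset.univ) => hH i).const_mul (c₂ / 2))
  rw [hasGradientAt_iff_hasFDerivAt]
  refine this.congr_fderiv ?_
  simp only [gradPsi, map_sub, map_add, map_smul, map_sum, mul_smul]
  rw [← Finset.smul_sum]
  module

theorem differentiableAt_Ψ {u : XYZ m n p} (hu : u ∈ P.U par) (c₁ c₂ : ℝ) :
    DifferentiableAt ℝ (P.Ψ par c₁ c₂) u := by
  obtain ⟨w, l, hs⟩ := exists_isSaddle_of_mem hP hv hu
  exact (hs.hasGradientAt_Ψ hP hv hu c₁ c₂).differentiableAt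

theorem IsSaddle.gradient_Ψ {u : XYZ m n p} {w : Vec n} {l : Vec p}
    (hs : P.IsSaddle par u.fst.fst u.snd w l) (hu : u ∈ P.U par) (c₁ c₂ : ℝ) :
    ∇ (P.Ψ par c₁ c₂) u = P.gradPsi par c₁ c₂ u w l :=
  (hs.hasGradientAt_Ψ hP hv hu c₁ c₂).gradient

theorem IsSaddle.norm_gradLagr_sub_le {u u' : XYZ m n p} {w w' : Vec n} {l l' : Vec p}
    (hs : P.IsSaddle par u.fst.fst u.snd w l) (hs' : P.IsSaddle par u'.fst.fst u'.snd w' l')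
    (hu : u ∈ P.U par) (hu' : u' ∈ P.U par) :
    ‖P.gradLagr par u.fst.fst u.snd w l - P.gradLagr par u'.fst.fst u'.snd w' l'‖ ≤
      envelopeLip par p M μ * ‖u - u'‖ := by
  have h1 := norm_meanGradL_sub_le' hP hv (v := pair u.fst.fst w) (v' := pair u'.fst.fst w')
    (l' := l') ⟨hu.1.1, hs.mem⟩ ⟨hu'.1.1, hs'.mem⟩
    (hs.dual_nonneg hv fun i => (hu.2 i).1) (hs.dual_le hP hv hu.1.1 hu.2)
  have h2 := hs.norm_sub_le hP hv hs' hu.1.1 hu'.1.1 hu.2 hu'.2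
  have hx : ‖u.fst.fst - u'.fst.fst‖ ≤ ‖u - u'‖ :=
    (WithLp.norm_fst_le _ (u - u').fst).trans (WithLp.norm_fst_le _ (u - u'))
  have hz : ‖u.snd - u'.snd‖ ≤ ‖u - u'‖ := WithLp.norm_snd_le _ (u - u')
  have h3 : ‖pair u.fst.fst w - pair u'.fst.fst w'‖ ≤ ‖u.fst.fst - u'.fst.fst‖ + ‖w - w'‖ :=
    norm_le_fst_add_snd _
  have h4 : ‖P.gradLagr par u.fst.fst u.snd w l - P.gradLagr par u'.fst.fst u'.snd w' l'‖ ≤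
      ‖P.meanGradL par.γ₁ (pair u.fst.fst w) l - P.meanGradL par.γ₁ (pair u'.fst.fst w') l'‖ +
      par.γ₂ * (‖l - l'‖ + ‖u.snd - u'.snd‖) := by
    refine (norm_le_fst_add_snd (P.gradLagr par u.fst.fst u.snd w l -
        P.gradLagr par u'.fst.fst u'.snd w' l')).trans (add_le_add ?_ ?_)
    · refine (norm_le_fst_add_snd (P.gradLagr par u.fst.fst u.snd w l -
        P.gradLagr par u'.fst.fst u'.snd w' l').fst).trans ?_
      have h0 :
          (P.gradLagr par u.fst.fst u.snd w l - P.gradLagr par u'.fst.fst u'.snd w' l').fst.snd =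
            0 := sub_self (0 : Vec n)
      rw [h0, norm_zero, add_zero]
      exact WithLp.norm_fst_le _ (P.meanGradL par.γ₁ (pair u.fst.fst w) l -
        P.meanGradL par.γ₁ (pair u'.fst.fst w') l')
    · change ‖par.γ₂ • (l - u.snd) - par.γ₂ • (l' - u'.snd)‖ ≤ _
      rw [← smul_sub, norm_smul, Real.norm_eq_abs, abs_of_pos hv.hγ₂]
      have := hv.hγ₂
      gcongr
      rw [show l - u.snd - (l' - u'.snd) = (l - l') - (u.snd - u'.snd) by abel]
      exact _root_.norm_sub_le _ _
  have hg := gradLip_nonneg (p := p) hv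
  have hsl := saddleLip_nonneg (p := p) hv
  have hγ := hv.hγ₂
  have h5 : ‖w - w'‖ + ‖l - l'‖ ≤ 2 * saddleLip par p M μ * ‖u - u'‖ := by
    refine h2.trans ?_
    calc _ ≤ saddleLip par p M μ * (‖u - u'‖ + ‖u - u'‖) := by gcongr
      _ = _ := by ring
  calc _ ≤ gradLip par p M * (‖u.fst.fst - u'.fst.fst‖ + ‖w - w'‖ + ‖l - l'‖) +
        par.γ₂ * (‖l - l'‖ + ‖u.snd - u'.snd‖) := by
        refine h4.trans (add_le_add (h1.trans ?_) le_rfl)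
        gcongr
    _ ≤ gradLip par p M * (‖u - u'‖ + 2 * saddleLip par p M μ * ‖u - u'‖) +
        par.γ₂ * (2 * saddleLip par p M μ * ‖u - u'‖ + ‖u - u'‖) := by
        have h6 : ‖l - l'‖ ≤ 2 * saddleLip par p M μ * ‖u - u'‖ :=
          (le_add_of_nonneg_left (norm_nonneg _)).trans h5
        rw [add_assoc (‖u.fst.fst - u'.fst.fst‖)]
        gcongr
    _ = _ := by
        unfold envelopeLip
        ring

theorem norm_gradient_Ψ_sub_le {c₁ c₂ : ℝ} (hc₁ : 0 < c₁) (hc₂ : 0 < c₂) {u u' : XYZ m n p}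
    (hu : u ∈ P.U par) (hu' : u' ∈ P.U par) :
    ‖∇ (P.Ψ par c₁ c₂) u - ∇ (P.Ψ par c₁ c₂) u'‖ ≤
      psiLip par p M μ * (1 + c₁ + c₂) * ‖u - u'‖ := by
  obtain ⟨w, l, hs⟩ := exists_isSaddle_of_mem hP hv hu
  obtain ⟨w', l', hs'⟩ := exists_isSaddle_of_mem hP hv hu'
  rw [hs.gradient_Ψ hP hv hu, hs'.gradient_Ψ hP hv hu']
  have hM := hv.M_pos
  have hd : ‖u.fst - u'.fst‖ ≤ ‖u - u'‖ := WithLp.norm_fst_le _ (u - u')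
  have hF : ‖∇ P.F u.fst - ∇ P.F u'.fst‖ ≤ M * ‖u - u'‖ :=
    (hP.F_lip _ hu.1 _ hu'.1).trans (mul_le_mul_of_nonneg_left hd hM.le)
  have hG : ‖∇ P.G u.fst - ∇ P.G u'.fst‖ ≤ M * ‖u - u'‖ :=
    (hP.G_lip _ hu.1 _ hu'.1).trans (mul_le_mul_of_nonneg_left hd hM.le)
  have hH : ‖∑ i, (max 0 (P.H i u.fst)) • ∇ (P.H i) u.fst -
      ∑ i, (max 0 (P.H i u'.fst)) • ∇ (P.H i) u'.fst‖ ≤ p * (M * M + M * M) * ‖u - u'‖ := by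
    rw [← Finset.sum_sub_distrib]
    refine (norm_sum_le_of_le _ (n := fun _ => (M * M + M * M) * ‖u - u'‖)
      fun i _ => ?_).trans_eq (by simp [mul_assoc])
    have e : (max 0 (P.H i u.fst)) • ∇ (P.H i) u.fst - (max 0 (P.H i u'.fst)) • ∇ (P.H i) u'.fst =
        (max 0 (P.H i u.fst)) • (∇ (P.H i) u.fst - ∇ (P.H i) u'.fst) +
        (max 0 (P.H i u.fst) - max 0 (P.H i u'.fst)) • ∇ (P.H i) u'.fst := by module
    rw [e]
    refine (norm_add_le _ _).trans ?_
    rw [norm_smul, norm_smul, Real.norm_eq_abs, Real.norm_eq_abs,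
      abs_of_nonneg (le_max_left 0 (P.H i u.fst))]
    calc _ ≤ M * (M * ‖u - u'‖) + (M * ‖u - u'‖) * M := by
          gcongr
          · exact max_le hM.le ((le_abs_self _).trans (hP.H_bdd i _ hu.1))
          · exact (hP.H_lip i _ hu.1 _ hu'.1).trans (mul_le_mul_of_nonneg_left hd hM.le)
          · exact (abs_max_zero_sub_le _ _).trans ((hP.H_lipschitz i hu.1 hu'.1).trans
              (mul_le_mul_of_nonneg_left hd hM.le))
          · exact hP.H_grad_bdd i _ hu'.1
      _ = _ := by ring
  have hE := hs.norm_gradLagr_sub_le hP hv hs' hu hu'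
  have e : P.gradPsi par c₁ c₂ u w l - P.gradPsi par c₁ c₂ u' w' l' =
      embedXY m n p ((∇ P.F u.fst - ∇ P.F u'.fst) + c₁ • (∇ P.G u.fst - ∇ P.G u'.fst) +
        c₂ • (∑ i, (max 0 (P.H i u.fst)) • ∇ (P.H i) u.fst -
          ∑ i, (max 0 (P.H i u'.fst)) • ∇ (P.H i) u'.fst)) -
      c₁ • (P.gradLagr par u.fst.fst u.snd w l - P.gradLagr par u'.fst.fst u'.snd w' l') := by
    simp only [gradPsi, map_sub, map_add, map_smul]
    module
  rw [e]
  have hEL := envelopeLip_nonneg (p := p) hv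
  set D := ‖u - u'‖
  calc _ ≤ (M * D + c₁ * (M * D) + c₂ * (p * (M * M + M * M) * D)) +
        c₁ * (envelopeLip par p M μ * D) := by
        refine (norm_sub_le _ _).trans (add_le_add ?_ ?_)
        · rw [norm_embedXY]
          refine (norm_add₃_le).trans ?_
          rw [norm_smul, norm_smul, Real.norm_eq_abs, Real.norm_eq_abs, abs_of_pos hc₁,
            abs_of_pos hc₂]
          gcongr
        · rw [norm_smul, Real.norm_eq_abs, abs_of_pos hc₁]
          gcongr
    _ ≤ _ := by
        have hD : 0 ≤ D := norm_nonneg _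
        have a1 : 0 ≤ M * c₂ * D := by positivity
        have a2 : 0 ≤ p * (M * M + M * M) * (1 + c₁) * D := by positivity
        have a3 : 0 ≤ envelopeLip par p M μ * (1 + c₂) * D := by positivity
        unfold psiLip
        linarith

end

/-! ### Feasibility of the iterates -/

theorem orthant_nonempty (p : ℕ) : (orthant p).Nonempty := ⟨0, fun _ => le_rfl⟩

theorem isClosed_orthant (p : ℕ) : IsClosed (orthant p) := by
  have : orthant p = ⋂ i, {l : Vec p | 0 ≤ l i} := by
    ext l
    simp [orthant]
  rw [this]
  exact isClosed_iInter fun i => isClosed_le continuous_const (by fun_prop)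

theorem convex_orthant (p : ℕ) : Convex ℝ (orthant p) := fun _ hl _ hl' _ _ ha hb _ i =>
  add_nonneg (mul_nonneg ha (hl i)) (mul_nonneg hb (hl' i))

/-- The projection onto the orthant takes positive parts of the coordinates. -/
theorem proj_orthant_apply (v : Vec p) (i : Fin p) : proj (orthant p) v i = max 0 (v i) := by
  set a : Vec p := WithLp.toLp 2 fun i => max 0 (v i) with ha
  have hmem : a ∈ orthant p := fun i => le_max_left _ _
  have h1 := inner_sub_proj_le (orthant_nonempty p) (isClosed_orthant p) (convex_orthant p) v hmem
  have h0 := proj_mem (orthant_nonempty p) (isClosed_orthant p) (convex_orthant p) v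
  set b := proj (orthant p) v with hb
  have h2 : 0 ≤ inner ℝ (v - a) (a - b) := by
    rw [PiLp.inner_apply]
    refine Finset.sum_nonneg fun j _ => ?_
    change 0 ≤ (max 0 (v j) - b j) * (v j - max 0 (v j))
    have := h0 j
    rcases max_cases 0 (v j) with ⟨h, h'⟩ | ⟨h, h'⟩ <;> rw [h] <;> nlinarith
  have h3 : ‖a - b‖ ^ 2 ≤ 0 := by
    have : ‖a - b‖ ^ 2 = inner ℝ (v - b) (a - b) - inner ℝ (v - a) (a - b) := by
      rw [← inner_sub_left, sub_sub_sub_cancel_left, real_inner_self_eq_norm_sq]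
    linarith
  have h4 : a - b = 0 := norm_eq_zero.1 (pow_eq_zero_iff two_ne_zero |>.1
    (le_antisymm h3 (sq_nonneg _)))
  rw [← sub_eq_zero.1 h4]

/-- The box of the multipliers that the inner loop visits. -/
def dualBox (par : Params) (p : ℕ) (M : ℝ) : Set (Vec p) :=
  {l | ∀ i, 0 ≤ l i ∧ l i ≤ par.dualBound p M}

section

variable (hP : P.Assumptions (Constants.uniform M μ)) (hv : par.Valid M μ)
include hP hv

/-- A dual step of size `ρ / (j + 1)` does not leave the box: the drift is at most
`M + γ₂ z - γ₂ l` in each coordinate. -/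
theorem proj_dual_step_mem {x : Vec m} {z : Vec p} {w : Vec n} {l : Vec p} (hx : x ∈ P.X)
    (hz : ∀ i, 0 ≤ z i ∧ z i ≤ par.box p) (hw : w ∈ P.Y) (hl : l ∈ dualBox par p M) (j : ℕ) :
    proj (orthant p) (l + (par.ρ / (j + 1)) • P.gradDual par.γ₁ par.γ₂ x z w l) ∈
      dualBox par p M := by
  intro i
  rw [proj_orthant_apply]
  refine ⟨le_max_left _ _, max_le (hv.dualBound_nonneg p) ?_⟩
  change l i + (par.ρ / (j + 1)) * (max 0 (par.γ₁ * l i + P.H i (pair x w)) - par.γ₁ * l i -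
    par.γ₂ * (l i - z i)) ≤ _
  obtain ⟨hl0, hl1⟩ := hl i
  have hγ₁ := hv.hγ₁
  have hγ₂ := hv.hγ₂
  have hρ := hv.ρ_pos
  have hM := hv.M_pos
  have hH : P.H i (pair x w) ≤ M := (le_abs_self _).trans (hP.H_bdd i _ ⟨hx, hw⟩)
  set t := par.ρ / ((j : ℝ) + 1) with ht
  have ht0 : 0 ≤ t := by positivity
  have htρ : t ≤ par.ρ := div_le_self hρ.le (by simp)
  have h1 : max 0 (par.γ₁ * l i + P.H i (pair x w)) ≤ par.γ₁ * l i + M :=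
    max_le (by positivity) (by linarith)
  set A := M + par.γ₂ * par.box p with hA
  have hbox := hv.box_nonneg p
  have hA0 : 0 ≤ A := by positivity
  have h2 : max 0 (par.γ₁ * l i + P.H i (pair x w)) - par.γ₁ * l i -
      par.γ₂ * (l i - z i) ≤ A - par.γ₂ * l i := by
    have := mul_le_mul_of_nonneg_left (hz i).2 hγ₂.le
    linarith
  have h3 := mul_le_mul_of_nonneg_left h2 ht0
  have h4 : A ≤ par.γ₂ * par.dualBound p M := by
    have := mul_le_mul_of_nonneg_left hv.hρ hγ₂.le
    rw [mul_one_div_cancel hγ₂.ne'] at this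
    unfold Params.dualBound
    nlinarith
  change _ ≤ par.dualBound p M
  rcases le_total (1 - t * par.γ₂) 0 with h5 | h5
  · have h6 : (1 - t * par.γ₂) * l i ≤ 0 := mul_nonpos_of_nonpos_of_nonneg h5 hl0
    have h7 : t * A ≤ par.dualBound p M := mul_le_mul_of_nonneg_right htρ hA0
    nlinarith
  · have h6 := mul_le_mul_of_nonneg_left hl1 h5
    have h7 := mul_le_mul_of_nonneg_left h4 ht0
    nlinarith

theorem salmIter_mem {x : Vec m} {z : Vec p} {w₀ : Vec n} (hx : x ∈ P.X)
    (hz : ∀ i, 0 ≤ z i ∧ z i ≤ par.box p) (hw₀ : w₀ ∈ P.Y) {s : ℕ} (ξ : Fin s → Ωξ) (j : ℕ) :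
    (P.salmIter par x z w₀ ξ j).1 ∈ P.Y ∧ (P.salmIter par x z w₀ ξ j).2 ∈ dualBox par p M := by
  induction j with
  | zero => exact ⟨hw₀, fun i => ⟨le_rfl, hv.dualBound_nonneg p⟩⟩
  | succ j ih =>
    unfold salmIter
    split_ifs with h
    · exact ⟨proj_mem ⟨w₀, hw₀⟩ hP.Y_compact.isClosed hP.Y_convex _,
        proj_dual_step_mem hP hv hx hz ih.1 ih.2 j⟩
    · exact ih

omit hv in
theorem iterate_mem {c₁ c₂ α : ℝ} {s r q : ℕ} {w₀ : ℕ → Vec n} {u₀ : XYZ m n p}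
    (hu₀ : u₀ ∈ P.U par) (b : ℕ → Batch Ωξ Ωζ s r q) (k : ℕ) :
    P.iterate par c₁ c₂ α w₀ u₀ b k ∈ P.U par := by
  cases k with
  | zero => exact hu₀
  | succ k => exact proj_mem ⟨u₀, hu₀⟩ (compact_U hP).isClosed (convex_U hP) _

end

/-! ### Measurability of the iterates -/

section Measurability

variable {α : Type*} {mα : MeasurableSpace α}
variable (hP : P.Assumptions (Constants.uniform M μ))

theorem measurable_comp_of_continuousOn {E F : Type*} [TopologicalSpace E] [MeasurableSpace E]
    [BorelSpace E] [TopologicalSpace F] [MeasurableSpace F] [BorelSpace F] {f : E → F} {S : Set E}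
    (hf : ContinuousOn f S) {v : α → E} (hv : Measurable v) (hd : ∀ a, v a ∈ S) :
    Measurable fun a => f (v a) :=
  (continuousOn_iff_continuous_domRestrict.1 hf).measurable.comp (hv.subtype_mk (h := hd))

theorem measurable_real_smul {E : Type*} [NormedAddCommGroup E] [NormedSpace ℝ E]
    [MeasurableSpace E] [BorelSpace E] {f : α → E} (c : ℝ) (hf : Measurable f) :
    Measurable fun a => c • f a :=
  (continuous_const_smul c).measurable.comp hf

theorem Measurable.vecPair {x : α → Vec m} {y : α → Vec n} (hx : Measurable x)
    (hy : Measurable y) : Measurable fun a => pair (x a) (y a) :=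
  continuous_pair.measurable.comp (hx.prodMk hy)

theorem measurable_apply {l : α → Vec p} (hl : Measurable l) (i : Fin p) :
    Measurable fun a => l a i :=
  (PiLp.continuous_apply 2 _ i).measurable.comp hl

theorem measurable_fst {v : α → XY m n} (h : Measurable v) : Measurable fun a => (v a).fst :=
  (WithLp.fstL 2 ℝ (Vec m) (Vec n)).continuous.measurable.comp h

theorem measurable_snd {v : α → XY m n} (h : Measurable v) : Measurable fun a => (v a).snd :=
  (WithLp.sndL 2 ℝ (Vec m) (Vec n)).continuous.measurable.comp h

theorem measurable_fst' {v : α → XYZ m n p} (h : Measurable v) : Measurable fun a => (v a).fst :=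
  (WithLp.fstL 2 ℝ (XY m n) (Vec p)).continuous.measurable.comp h

theorem measurable_snd' {v : α → XYZ m n p} (h : Measurable v) : Measurable fun a => (v a).snd :=
  (WithLp.sndL 2 ℝ (XY m n) (Vec p)).continuous.measurable.comp h

include hP

theorem measurable_gradg {v : α → XY m n} {ξ : α → Ωξ} (hv : Measurable v)
    (hd : ∀ a, v a ∈ P.dom) (hξ : Measurable ξ) : Measurable fun a => P.gradg (v a) (ξ a) :=
  hP.g_meas.comp ((hv.subtype_mk (h := hd)).prodMk hξ)

theorem measurable_gradf {v : α → XY m n} {ζ : α → Ωζ} (hv : Measurable v)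
    (hd : ∀ a, v a ∈ P.dom) (hζ : Measurable ζ) : Measurable fun a => P.gradf (v a) (ζ a) :=
  hP.f_meas.comp ((hv.subtype_mk (h := hd)).prodMk hζ)

theorem measurable_posPart_smul_gradH {v : α → XY m n} {t : α → ℝ} (hv : Measurable v)
    (hd : ∀ a, v a ∈ P.dom) (ht : Measurable t) (i : Fin p) :
    Measurable fun a => (max 0 (t a + P.H i (v a))) • ∇ (P.H i) (v a) :=
  (measurable_const.max (ht.add (measurable_comp_of_continuousOn (hP.continuousOn_H i) hv hd))).smul
    (measurable_comp_of_continuousOn (hP.continuousOn_gradH i) hv hd)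

theorem measurable_gradL (γ₁ : ℝ) {x : α → Vec m} {w : α → Vec n} {l : α → Vec p} {ξ : α → Ωξ}
    (hx : Measurable x) (hw : Measurable w) (hl : Measurable l) (hξ : Measurable ξ)
    (hxX : ∀ a, x a ∈ P.X) (hwY : ∀ a, w a ∈ P.Y) :
    Measurable fun a => P.gradL γ₁ (x a) (w a) (l a) (ξ a) := by
  have hd : ∀ a, pair (x a) (w a) ∈ P.dom := fun a => ⟨hxX a, hwY a⟩
  have hp := Measurable.vecPair hx hw
  refine (measurable_gradg hP hp hd hξ).add (measurable_real_smul (1 / γ₁) ?_)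
  exact Finset.measurable_fun_sum _ fun i _ =>
    measurable_posPart_smul_gradH hP hp hd ((measurable_apply hl i).const_mul γ₁) i

theorem measurable_gradDual (γ₁ γ₂ : ℝ) {x : α → Vec m} {z : α → Vec p} {w : α → Vec n}
    {l : α → Vec p} (hx : Measurable x) (hz : Measurable z) (hw : Measurable w) (hl : Measurable l)
    (hxX : ∀ a, x a ∈ P.X) (hwY : ∀ a, w a ∈ P.Y) :
    Measurable fun a => P.gradDual γ₁ γ₂ (x a) (z a) (w a) (l a) := by
  have hd : ∀ a, pair (x a) (w a) ∈ P.dom := fun a => ⟨hxX a, hwY a⟩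
  have hp := Measurable.vecPair hx hw
  refine (PiLp.continuous_toLp 2 _).measurable.comp (measurable_pi_lambda _ fun i => ?_)
  have h1 := measurable_apply hl i
  have h2 := measurable_apply hz i
  have h3 := measurable_comp_of_continuousOn (hP.continuousOn_H i) hp hd
  exact ((measurable_const.max ((h1.const_mul γ₁).add h3)).sub (h1.const_mul γ₁)).sub
    ((h1.sub h2).const_mul γ₂)

/-- The `j`-th inner iterate is a measurable function of the first `j` samples. -/
theorem measurable_salmIter {x : α → Vec m} {z : α → Vec p} (hx : Measurable x) (hz : Measurable z)
    (hxX : ∀ a, x a ∈ P.X) {w₀ : Vec n} (hw₀ : w₀ ∈ P.Y) {s : ℕ} {ξ : α → Fin s → Ωξ} (j : ℕ)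
    (hξ : ∀ i : Fin s, (i : ℕ) < j → Measurable fun a => ξ a i) :
    Measurable fun a => P.salmIter par (x a) (z a) w₀ (ξ a) j := by
  have hY : ∀ (a : α) (j : ℕ), (P.salmIter par (x a) (z a) w₀ (ξ a) j).1 ∈ P.Y := by
    intro a j
    induction j with
    | zero => exact hw₀
    | succ j ih =>
      unfold salmIter
      split_ifs with h
      · exact proj_mem ⟨w₀, hw₀⟩ hP.Y_compact.isClosed hP.Y_convex _
      · exact ih
  induction j with
  | zero => exact measurable_const
  | succ j ih =>
    have ih' := ih fun i hi => hξ i (hi.trans (Nat.lt_succ_self j))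
    unfold salmIter
    by_cases h : j < s
    · simp only [h, dif_pos]
      refine Measurable.prodMk ?_ ?_
      · refine (continuous_proj ⟨w₀, hw₀⟩ hP.Y_compact.isClosed hP.Y_convex).measurable.comp ?_
        refine ih'.fst.sub (measurable_real_smul _ (measurable_snd ?_))
        exact measurable_gradL hP _ hx ih'.fst ih'.snd (hξ ⟨j, h⟩ (Nat.lt_succ_self j)) hxX
          fun a => hY a j
      · refine (continuous_proj (orthant_nonempty p) (isClosed_orthant p)
          (convex_orthant p)).measurable.comp ?_
        refine ih'.snd.add (measurable_real_smul _ ?_)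
        exact measurable_gradDual hP _ _ hx hz ih'.fst ih'.snd hxX fun a => hY a j
    · simpa only [h, dif_neg, not_false_eq_true] using ih'

theorem measurable_direction (c₁ c₂ : ℝ) {u : α → XYZ m n p} {w : α → Vec n} {l : α → Vec p}
    {r q : ℕ} {ζ : α → Fin r → Ωζ} {ξ : α → Fin q → Ωξ} (hu : Measurable u) (hw : Measurable w)
    (hl : Measurable l) (hζ : Measurable ζ) (hξ : Measurable ξ) (huU : ∀ a, u a ∈ P.U par)
    (hwY : ∀ a, w a ∈ P.Y) :
    Measurable fun a => P.direction par c₁ c₂ (u a) (w a) (l a) (ζ a) (ξ a) := by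
  have hv := measurable_fst' hu
  have hd : ∀ a, (u a).fst ∈ P.dom := fun a => (huU a).1
  have hx := measurable_fst hv
  refine (WithLp.prod_continuous_toLp 2 (XY m n) (Vec p)).measurable.comp (Measurable.prodMk ?_ ?_)
  · refine Measurable.add (Measurable.add ?_ ?_) ?_
    · exact measurable_real_smul _ (Finset.measurable_fun_sum _ fun j _ =>
        measurable_gradf hP hv hd ((measurable_pi_apply j).comp hζ))
    · refine measurable_real_smul c₁ (Measurable.sub ?_ ?_)
      · exact measurable_real_smul _ (Finset.measurable_fun_sum _ fun j _ =>
          measurable_gradg hP hv hd ((measurable_pi_apply j).comp hξ))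
      · refine Measurable.vecPair ?_ measurable_const
        exact measurable_real_smul _ (Finset.measurable_fun_sum _ fun j _ => measurable_fst
          (measurable_gradL hP par.γ₁ hx hw hl ((measurable_pi_apply j).comp hξ)
            (fun a => (hd a).1) hwY))
    · refine measurable_real_smul c₂ (Finset.measurable_fun_sum _ fun i _ => ?_)
      simpa using measurable_posPart_smul_gradH hP hv hd (t := fun _ => 0) measurable_const i
  · exact measurable_real_smul c₁ (measurable_real_smul par.γ₂ (hl.sub (measurable_snd' hu))).neg

/-- The `k`-th outer iterate is a measurable function of the first `k` batches. -/
theorem measurable_iterate (c₁ c₂ α' : ℝ) {s r q : ℕ} {w₀ : ℕ → Vec n} (hw₀ : ∀ k, w₀ k ∈ P.Y)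
    {u₀ : XYZ m n p} (hu₀ : u₀ ∈ P.U par) (hv : par.Valid M μ) {b : ℕ → α → Batch Ωξ Ωζ s r q}
    (k : ℕ) (hb : ∀ i < k, Measurable (b i)) :
    Measurable fun a => P.iterate par c₁ c₂ α' w₀ u₀ (fun i => b i a) k := by
  induction k with
  | zero => exact measurable_const
  | succ k ih =>
    have ih' := ih fun i hi => hb i (hi.trans (Nat.lt_succ_self k))
    have hbk := hb k (Nat.lt_succ_self k)
    have hU : ∀ a, P.iterate par c₁ c₂ α' w₀ u₀ (fun i => b i a) k ∈ P.U par := fun a =>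
      iterate_mem hP hu₀ _ k
    have hs := measurable_salmIter (par := par) hP (measurable_fst (measurable_fst' ih'))
      (measurable_snd' ih') (fun a => (hU a).1.1) (hw₀ k) s
      (fun i _ => (measurable_pi_apply i).comp hbk.fst)
    unfold iterate
    refine (continuous_proj ⟨u₀, hu₀⟩ (compact_U hP).isClosed (convex_U hP)).measurable.comp ?_
    refine ih'.sub (measurable_real_smul α' ?_)
    exact measurable_direction hP c₁ c₂ ih' hs.fst hs.snd hbk.snd.fst hbk.snd.snd hU
      fun a => (salmIter_mem hP hv (hU a).1.1 (hU a).2 (hw₀ k) _ s).1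

end Measurability

end Problem

/-! ### Independence and mini-batches -/

/-- Integration over the law of one of two independent variables (Tonelli). -/
theorem lintegral_indep {Ω A B : Type*} [MeasurableSpace Ω] [MeasurableSpace A]
    [MeasurableSpace B] {Pr : Measure Ω} [IsProbabilityMeasure Pr] {X : Ω → A} {Z : Ω → B}
    (hX : Measurable X) (hZ : Measurable Z) (hind : IndepFun X Z Pr) {φ : A × B → ENNReal}
    (hφ : Measurable φ) :
    ∫⁻ ω, φ (X ω, Z ω) ∂Pr = ∫⁻ ω, ∫⁻ b, φ (X ω, b) ∂(Pr.map Z) ∂Pr := by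
  have : IsProbabilityMeasure (Pr.map Z) := Measure.isProbabilityMeasure_map hZ.aemeasurable
  rw [← lintegral_map hφ (hX.prodMk hZ),
    hind.map_prod_eq_prod_map_map hX.aemeasurable hZ.aemeasurable,
    lintegral_prod _ hφ.aemeasurable, lintegral_map hφ.lintegral_prod_right' hX]

/-- A function of the variables with index in `S` is independent of a variable with index outside
`S`. -/
theorem indepFun_of_measurable_iSup {Ω ι A : Type*} {β : ι → Type*} [mΩ : MeasurableSpace Ω]
    [mβ : ∀ i, MeasurableSpace (β i)] [MeasurableSpace A] {Pr : Measure Ω} {f : ∀ i, Ω → β i}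
    (hf : ∀ i, Measurable (f i)) (hind : iIndepFun f Pr) {S : Set ι} {k : ι} (hk : k ∉ S)
    {X : Ω → A} (hX : Measurable[⨆ i ∈ S, (mβ i).comap (f i)] X) : IndepFun X (f k) Pr := by
  have h := indep_iSup_of_disjoint (S := S) (T := {k}) (fun i => (hf i).comap_le) hind
    (Set.disjoint_singleton_right.2 hk)
  rw [iSup_singleton] at h
  exact indep_of_indep_of_le_left h hX.comap_le

theorem measurable_of_mem_iSup {Ω ι : Type*} {β : ι → Type*}
    [mβ : ∀ i, MeasurableSpace (β i)] (f : ∀ i, Ω → β i) {S : Set ι} {k : ι} (hk : k ∈ S) :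
    Measurable[⨆ i ∈ S, (mβ i).comap (f i)] (f k) :=
  (comap_measurable (f k)).mono (le_iSup₂_of_le k hk le_rfl) le_rfl

/-- The mean square error of a mini-batch average of `r` independent copies is `1 / r` times the
variance: in an orthonormal basis this is the additivity of the variance for each coordinate. -/
theorem lintegral_sq_norm_average_sub_le {Ω E : Type*} [MeasurableSpace Ω] {μ : Measure Ω}
    [IsProbabilityMeasure μ] [NormedAddCommGroup E] [InnerProductSpace ℝ E]
    [FiniteDimensional ℝ E] {X : Ω → E}
    (hL : MemLp X 2 μ) {c : E} (hc : ∫ ω, X ω ∂μ = c) {σ : ℝ}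
    (hσ : ∫ ω, ‖X ω - c‖ ^ 2 ∂μ ≤ σ ^ 2) {r : ℕ} (hr : 0 < r) :
    ∫⁻ ω, ENNReal.ofReal (‖(1 / (r : ℝ)) • ∑ j, X (ω j) - c‖ ^ 2) ∂(Measure.pi fun _ : Fin r => μ) ≤
      ENNReal.ofReal (σ ^ 2 / r) := by
  have : CompleteSpace E := FiniteDimensional.complete ℝ E
  have hr' : (0 : ℝ) < r := Nat.cast_pos.2 hr
  let e := stdOrthonormalBasis ℝ E
  -- The coordinates of the centered variable, in an orthonormal basis.
  let W : Fin (Module.finrank ℝ E) → Ω → ℝ := fun i ω => inner ℝ (e i) (X ω - c)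
  have hY : MemLp (fun ω => X ω - c) 2 μ := hL.sub (memLp_const c)
  have hW : ∀ i, MemLp (W i) 2 μ := fun i => hY.const_inner (e i)
  have hW0 : ∀ i, ∫ ω, W i ω ∂μ = 0 := by
    intro i
    have h1 : Integrable X μ := hL.integrable one_le_two
    refine (integral_inner (𝕜 := ℝ) (hY.integrable one_le_two) (e i)).trans ?_
    rw [integral_sub h1 (integrable_const c), hc]
    simp
  have hS : ∀ i, MemLp (∑ j : Fin r, fun ω : Fin r → Ω => W i (ω j)) 2
      (Measure.pi fun _ : Fin r => μ) := fun i =>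
    memLp_finsetSum' _ fun j _ => (hW i).comp_measurePreserving (measurePreserving_eval _ j)
  have hS0 : ∀ i, ∫ ω, (∑ j : Fin r, fun ω : Fin r → Ω => W i (ω j)) ω
      ∂(Measure.pi fun _ : Fin r => μ) = 0 := by
    intro i
    simp only [Finset.sum_apply]
    rw [integral_finsetSum]
    · refine Finset.sum_eq_zero fun j _ => ?_
      have hmp := measurePreserving_eval (fun _ : Fin r => μ) j
      have hm : AEStronglyMeasurable (W i) (Measure.map (Function.eval j)
          (Measure.pi fun _ : Fin r => μ)) := by
        rw [hmp.map_eq]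
        exact (hW i).aestronglyMeasurable
      have := integral_map hmp.measurable.aemeasurable hm
      rw [hmp.map_eq, hW0 i] at this
      exact this.symm
    · intro j _
      exact ((hW i).comp_measurePreserving (measurePreserving_eval _ j)).integrable one_le_two
  have hvar : ∀ i, ∫ ω, (∑ j : Fin r, W i (ω j)) ^ 2 ∂(Measure.pi fun _ : Fin r => μ) =
      r * ∫ ω, W i ω ^ 2 ∂μ := by
    intro i
    have h1 := variance_sum_pi (μ := fun _ : Fin r => μ) (X := fun _ => W i) fun _ => hW i
    rw [variance_of_integral_eq_zero (hS i).aestronglyMeasurable.aemeasurable (hS0 i)] at h1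
    simp only [variance_of_integral_eq_zero (hW i).aestronglyMeasurable.aemeasurable (hW0 i),
      Finset.sum_apply, Finset.sum_const, Finset.card_univ, Fintype.card_fin, nsmul_eq_mul] at h1
    exact h1
  have hnorm : ∀ v : E, ‖v‖ ^ 2 = ∑ i, inner ℝ (e i) v ^ 2 := by
    intro v
    rw [← e.sum_sq_norm_inner_right v]
    simp
  have hpt : ∀ ω : Fin r → Ω, ‖(1 / (r : ℝ)) • ∑ j, X (ω j) - c‖ ^ 2 =
      1 / (r : ℝ) ^ 2 * ∑ i, (∑ j : Fin r, W i (ω j)) ^ 2 := by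
    intro ω
    have h1 : (1 / (r : ℝ)) • ∑ j, X (ω j) - c = (1 / (r : ℝ)) • ∑ j, (X (ω j) - c) := by
      rw [Finset.sum_sub_distrib, smul_sub]
      congr 1
      simp only [Finset.sum_const, Finset.card_univ, Fintype.card_fin]
      rw [← Nat.cast_smul_eq_nsmul ℝ, smul_smul, one_div_mul_cancel hr'.ne', one_smul]
    rw [h1, norm_smul, mul_pow, hnorm]
    simp only [inner_sum, W, one_div, norm_inv, inv_pow, Real.norm_natCast]
  have hint : ∀ i ∈ Finset.univ, Integrable (fun ω : Fin r → Ω => (∑ j : Fin r, W i (ω j)) ^ 2)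
      (Measure.pi fun _ : Fin r => μ) := by
    intro i _
    have := (hS i).integrable_sq
    simpa only [Finset.sum_apply] using this
  simp only [hpt]
  rw [← ofReal_integral_eq_lintegral_ofReal ((integrable_finsetSum _ hint).const_mul _)
    (Eventually.of_forall fun ω => by positivity)]
  refine ENNReal.ofReal_le_ofReal ?_
  rw [integral_const_mul, integral_finsetSum _ hint]
  simp only [hvar]
  rw [← Finset.mul_sum, ← integral_finsetSum _ fun i _ => (hW i).integrable_sq]
  have h2 : ∫ ω, ∑ i, W i ω ^ 2 ∂μ = ∫ ω, ‖X ω - c‖ ^ 2 ∂μ := by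
    simp only [hnorm, W]
  rw [h2]
  calc _ ≤ 1 / (r : ℝ) ^ 2 * (r * σ ^ 2) := by gcongr
    _ = _ := by field_simp

namespace Problem

variable {m n p : ℕ} {Ωξ : Type u₁} {Ωζ : Type u₂} [MeasurableSpace Ωξ] [MeasurableSpace Ωζ]
variable {P : Problem m n p Ωξ Ωζ} {par : Params} {M μ : ℝ}

/-! ### Convergence of the inner loop -/

/-- One step of the inner loop, from the state `a = (w, l)` with the sample `ξ`. -/
def salmStep (P : Problem m n p Ωξ Ωζ) (par : Params) (x : Vec m) (z : Vec p) (j : ℕ)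
    (a : Vec n × Vec p) (ξ : Ωξ) : Vec n × Vec p :=
  (proj P.Y (a.1 - (par.η / (j + 1)) • (P.gradL par.γ₁ x a.1 a.2 ξ).snd),
    proj (orthant p) (a.2 + (par.ρ / (j + 1)) • P.gradDual par.γ₁ par.γ₂ x z a.1 a.2))

theorem salmIter_succ (x : Vec m) (z : Vec p) (w₀ : Vec n) {s : ℕ} (ξ : Fin s → Ωξ) {j : ℕ}
    (h : j < s) : P.salmIter par x z w₀ ξ (j + 1) =
      P.salmStep par x z j (P.salmIter par x z w₀ ξ j) (ξ ⟨j, h⟩) := by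
  rw [salmIter, dif_pos h]
  rfl

/-- The squared distance to the saddle point `(w, l)`, weighted by the step size constants: with
these weights the two step sizes act like one. -/
def potential (par : Params) (w : Vec n) (l : Vec p) (a : Vec n × Vec p) : ℝ :=
  ‖a.1 - w‖ ^ 2 / par.η + ‖a.2 - l‖ ^ 2 / par.ρ

/-- A bound of `∇_{(x, w)} L` on bounded multipliers. -/
def gradBound (par : Params) (p : ℕ) (M : ℝ) : ℝ :=
  M + 1 / par.γ₁ * (p * ((par.γ₁ * par.dualBound p M + M) * M))

/-- A bound of `∇_l ℓ` on bounded multipliers. -/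
def dualGradBound (par : Params) (p : ℕ) (M : ℝ) : ℝ :=
  p * (M + par.γ₁ * par.dualBound p M + par.γ₂ * (par.dualBound p M + par.box p))

/-- The inner loop of length `s` has mean squared error at most this constant over `s`. -/
def innerConst (par : Params) (p : ℕ) (M : ℝ) : ℝ :=
  par.η * (2 * gradBound par p M ^ 2 + 2 * M ^ 2) + par.ρ * dualGradBound par p M ^ 2

section

variable (hP : P.Assumptions (Constants.uniform M μ)) (hv : par.Valid M μ)

include hv in
theorem potential_nonneg (w : Vec n) (l : Vec p) (a : Vec n × Vec p) :
    0 ≤ potential par w l a := by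
  have := hv.η_pos
  have := hv.ρ_pos
  unfold potential
  positivity

include hv in
theorem innerConst_nonneg : 0 ≤ innerConst par p M := by
  have := hv.η_pos
  have := hv.ρ_pos
  unfold innerConst
  positivity

include hP hv

theorem norm_gradDual_le {x : Vec m} {z : Vec p} {w : Vec n} {l : Vec p} (hx : x ∈ P.X)
    (hz : ∀ i, 0 ≤ z i ∧ z i ≤ par.box p) (hw : w ∈ P.Y) (hl : l ∈ dualBox par p M) :
    ‖P.gradDual par.γ₁ par.γ₂ x z w l‖ ≤ dualGradBound par p M := by
  have hγ₁ := hv.hγ₁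
  have hγ₂ := hv.hγ₂
  have hM := hv.M_pos
  refine (norm_le_sum_abs _).trans ((Finset.sum_le_sum (g := fun _ => M +
    par.γ₁ * par.dualBound p M + par.γ₂ * (par.dualBound p M + par.box p))
      fun i _ => ?_).trans_eq (by
        rw [Finset.sum_const, Finset.card_univ, Fintype.card_fin, nsmul_eq_mul, dualGradBound]))
  obtain ⟨h0, h1⟩ := hl i
  obtain ⟨k0, k1⟩ := hz i
  have hH := abs_le.1 (hP.H_bdd i (pair x w) ⟨hx, hw⟩)
  have hH1 : -M ≤ P.H i (pair x w) := hH.1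
  have hH2 : P.H i (pair x w) ≤ M := hH.2
  have e1 := mul_le_mul_of_nonneg_left h1 hγ₁.le
  have e2 := mul_le_mul_of_nonneg_left h1 hγ₂.le
  have e3 := mul_le_mul_of_nonneg_left k1 hγ₂.le
  have e4 := mul_nonneg hγ₁.le h0
  have e5 := mul_nonneg hγ₂.le h0
  have e6 := mul_nonneg hγ₂.le k0
  have h2 : max 0 (par.γ₁ * l i + P.H i (pair x w)) ≤ par.γ₁ * l i + M :=
    max_le (by positivity) (by linarith)
  have h3 : 0 ≤ max 0 (par.γ₁ * l i + P.H i (pair x w)) := le_max_left _ _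
  change |max 0 (par.γ₁ * l i + P.H i (pair x w)) - par.γ₁ * l i - par.γ₂ * (l i - z i)| ≤ _
  rw [abs_le]
  constructor <;> nlinarith

omit hP in
/-- The effect of one inner step on the potential, before taking expectations. -/
theorem IsSaddle.potential_salmStep_le (hP : P.Assumptions (Constants.uniform M μ)) {x : Vec m}
    {z : Vec p} {w : Vec n} {l : Vec p} (hs : P.IsSaddle par x z w l) (hz : ∀ i, 0 ≤ z i) (j : ℕ)
    (a : Vec n × Vec p) (ξ : Ωξ) :
    potential par w l (P.salmStep par x z j a ξ) ≤ potential par w l a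
      - 2 / (j + 1) * (inner ℝ (P.meanGradL par.γ₁ (pair x a.1) a.2).snd (a.1 - w)
        + inner ℝ (P.gradg (pair x a.1) ξ - ∇ P.G (pair x a.1)) (pair 0 (a.1 - w))
        - inner ℝ (P.gradDual par.γ₁ par.γ₂ x z a.1 a.2) (a.2 - l))
      + 1 / (j + 1) ^ 2 * (par.η * (2 * ‖P.meanGradL par.γ₁ (pair x a.1) a.2‖ ^ 2
        + 2 * ‖P.gradg (pair x a.1) ξ - ∇ P.G (pair x a.1)‖ ^ 2)
        + par.ρ * ‖P.gradDual par.γ₁ par.γ₂ x z a.1 a.2‖ ^ 2) := by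
  have hη := hv.η_pos
  have hρ := hv.ρ_pos
  have hl : l ∈ orthant p := fun i => hs.dual_nonneg hv hz i
  set Q := P.meanGradL par.γ₁ (pair x a.1) a.2 with hQ
  set D := P.gradg (pair x a.1) ξ - ∇ P.G (pair x a.1) with hD
  set d := P.gradDual par.γ₁ par.γ₂ x z a.1 a.2 with hd
  set t : ℝ := (j : ℝ) + 1 with ht
  have ht0 : 0 < t := by positivity
  have hg : (P.gradL par.γ₁ x a.1 a.2 ξ).snd = (Q + D).snd := by rw [gradL_eq]
  have h1 : ‖(P.salmStep par x z j a ξ).1 - w‖ ^ 2 ≤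
      ‖a.1 - w‖ ^ 2 - 2 * (par.η / t) * inner ℝ (Q + D).snd (a.1 - w)
        + (par.η / t) ^ 2 * ‖(Q + D).snd‖ ^ 2 := by
    have h2 : ‖(P.salmStep par x z j a ξ).1 - w‖ ≤
        ‖a.1 - (par.η / t) • (P.gradL par.γ₁ x a.1 a.2 ξ).snd - w‖ :=
      norm_proj_sub_le ⟨w, hs.mem⟩ hP.Y_compact.isClosed hP.Y_convex _ hs.mem
    have h3 : ‖(P.salmStep par x z j a ξ).1 - w‖ ^ 2 ≤
        ‖(a.1 - w) - (par.η / t) • (Q + D).snd‖ ^ 2 := by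
      rw [hg, sub_right_comm] at h2
      exact pow_le_pow_left₀ (norm_nonneg _) h2 2
    refine h3.trans_eq ?_
    rw [norm_sub_sq_real, norm_smul, mul_pow, Real.norm_eq_abs, sq_abs, inner_smul_right,
      real_inner_comm]
    ring
  have h2 : ‖(P.salmStep par x z j a ξ).2 - l‖ ^ 2 ≤
      ‖a.2 - l‖ ^ 2 + 2 * (par.ρ / t) * inner ℝ d (a.2 - l) + (par.ρ / t) ^ 2 * ‖d‖ ^ 2 := by
    have h2 := norm_proj_sub_le (orthant_nonempty p) (isClosed_orthant p) (convex_orthant p)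
      (a.2 + (par.ρ / t) • d) hl
    have h3 : ‖(P.salmStep par x z j a ξ).2 - l‖ ^ 2 ≤ ‖(a.2 - l) + (par.ρ / t) • d‖ ^ 2 := by
      rw [add_sub_right_comm] at h2
      exact pow_le_pow_left₀ (norm_nonneg _) h2 2
    refine h3.trans_eq ?_
    rw [norm_add_sq_real, norm_smul, mul_pow, Real.norm_eq_abs, sq_abs, inner_smul_right,
      real_inner_comm]
    ring
  have h3 : ‖(Q + D).snd‖ ^ 2 ≤ 2 * ‖Q‖ ^ 2 + 2 * ‖D‖ ^ 2 := by
    have h4 : ‖(Q + D).snd‖ ≤ ‖Q‖ + ‖D‖ := (WithLp.norm_snd_le _ _).trans (norm_add_le _ _)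
    have h5 : (‖Q‖ + ‖D‖) ^ 2 ≤ 2 * (‖Q‖ ^ 2 + ‖D‖ ^ 2) := add_sq_le
    have h6 := pow_le_pow_left₀ (norm_nonneg _) h4 2
    linarith
  have h4 : inner ℝ (Q + D).snd (a.1 - w) =
      inner ℝ Q.snd (a.1 - w) + inner ℝ D (pair 0 (a.1 - w)) := by
    rw [WithLp.add_snd, inner_add_left, WithLp.prod_inner_apply]
    simp
  have k1 := div_le_div_of_nonneg_right h1 hη.le
  have k2 := div_le_div_of_nonneg_right h2 hρ.le
  have k3 := mul_le_mul_of_nonneg_left h3 (by positivity : 0 ≤ par.η / t ^ 2)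
  rw [h4] at k1
  unfold potential
  refine (add_le_add k1 k2).trans ?_
  have e1 : (‖a.1 - w‖ ^ 2 - 2 * (par.η / t) * (inner ℝ Q.snd (a.1 - w) +
      inner ℝ D (pair 0 (a.1 - w))) + (par.η / t) ^ 2 * ‖(Q + D).snd‖ ^ 2) / par.η =
      ‖a.1 - w‖ ^ 2 / par.η - 2 / t * (inner ℝ Q.snd (a.1 - w) +
      inner ℝ D (pair 0 (a.1 - w))) + par.η / t ^ 2 * ‖(Q + D).snd‖ ^ 2 := by
    field_simp
  have e2 : (‖a.2 - l‖ ^ 2 + 2 * (par.ρ / t) * inner ℝ d (a.2 - l) +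
      (par.ρ / t) ^ 2 * ‖d‖ ^ 2) / par.ρ = ‖a.2 - l‖ ^ 2 / par.ρ + 2 / t * inner ℝ d (a.2 - l) +
      1 / t ^ 2 * (par.ρ * ‖d‖ ^ 2) := by
    field_simp
  have e3 : par.η / t ^ 2 * (2 * ‖Q‖ ^ 2 + 2 * ‖D‖ ^ 2) =
      1 / t ^ 2 * (par.η * (2 * ‖Q‖ ^ 2 + 2 * ‖D‖ ^ 2)) := by ring
  rw [e1, e2]
  rw [e3] at k3
  linarith

/-- The expected effect of one inner step: strong monotonicity contracts the potential by
`1 - 2 / (j + 1)`, since `η ≥ 1 / μ` and `ρ ≥ 1 / γ₂`. -/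
theorem IsSaddle.lintegral_potential_salmStep_le {x : Vec m} {z : Vec p} {w : Vec n} {l : Vec p}
    (hs : P.IsSaddle par x z w l) (hx : x ∈ P.X) (hz : ∀ i, 0 ≤ z i ∧ z i ≤ par.box p) (j : ℕ)
    {a : Vec n × Vec p} (ha1 : a.1 ∈ P.Y) (ha2 : a.2 ∈ dualBox par p M) :
    ∫⁻ ξ, ENNReal.ofReal (potential par w l (P.salmStep par x z j a ξ)) ∂P.Dξ ≤
      ENNReal.ofReal (max (0 : ℝ) (1 - 2 / ((j : ℝ) + 1)) * potential par w l a
        + innerConst par p M / (j + 1) ^ 2) := by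
  have hprob := hP.prob_ξ
  have hη := hv.η_pos
  have hρ := hv.ρ_pos
  have hd : pair x a.1 ∈ P.dom := ⟨hx, ha1⟩
  set D : Ωξ → XY m n := fun ξ => P.gradg (pair x a.1) ξ - ∇ P.G (pair x a.1) with hD
  have hDL : MemLp D 2 P.Dξ := (hP.g_memLp _ hd).sub (memLp_const _)
  have hD1 : Integrable D P.Dξ := hDL.integrable one_le_two
  have hDsq : Integrable (fun ξ => ‖D ξ‖ ^ 2) P.Dξ := hDL.integrable_norm_pow two_ne_zero
  have hD0 : ∫ ξ, D ξ ∂P.Dξ = 0 := by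
    rw [hD, integral_sub ((hP.g_memLp _ hd).integrable one_le_two) (integrable_const _),
      hP.g_unbiased _ hd]
    simp
  have hDi : Integrable (fun ξ => inner ℝ (D ξ) (pair (0 : Vec m) (a.1 - w))) P.Dξ :=
    hD1.inner_const _
  have hDi0 : ∫ ξ, inner ℝ (D ξ) (pair (0 : Vec m) (a.1 - w)) ∂P.Dξ = 0 := by
    have := integral_inner (𝕜 := ℝ) hD1 (pair (0 : Vec m) (a.1 - w))
    rw [hD0, inner_zero_right] at this
    rw [← this]
    simp only [real_inner_comm]
  have hpt := fun ξ => hs.potential_salmStep_le hv hP (fun i => (hz i).1) j a ξ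
  set Q := P.meanGradL par.γ₁ (pair x a.1) a.2 with hQ
  set d := P.gradDual par.γ₁ par.γ₂ x z a.1 a.2 with hd'
  set t : ℝ := (j : ℝ) + 1 with ht
  have ht0 : 0 < t := by positivity
  let A : ℝ := potential par w l a - 2 / t * (inner ℝ Q.snd (a.1 - w) - inner ℝ d (a.2 - l))
      + 1 / t ^ 2 * (par.η * (2 * ‖Q‖ ^ 2) + par.ρ * ‖d‖ ^ 2)
  have hpt' : ∀ ξ, potential par w l (P.salmStep par x z j a ξ) ≤
      A + (-(2 / t) * inner ℝ (D ξ) (pair (0 : Vec m) (a.1 - w))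
        + 2 * par.η / t ^ 2 * ‖D ξ‖ ^ 2) := by
    intro ξ
    refine (hpt ξ).trans_eq ?_
    simp only [A, hD]
    ring
  have hint2 : Integrable (fun ξ => -(2 / t) * inner ℝ (D ξ) (pair (0 : Vec m) (a.1 - w))
      + 2 * par.η / t ^ 2 * ‖D ξ‖ ^ 2) P.Dξ := (hDi.const_mul _).add (hDsq.const_mul _)
  have hint : Integrable (fun ξ => A + (-(2 / t) * inner ℝ (D ξ) (pair (0 : Vec m) (a.1 - w))
      + 2 * par.η / t ^ 2 * ‖D ξ‖ ^ 2)) P.Dξ := (integrable_const A).add hint2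
  refine (lintegral_mono fun ξ => ENNReal.ofReal_le_ofReal (hpt' ξ)).trans ?_
  rw [← ofReal_integral_eq_lintegral_ofReal hint
    (Eventually.of_forall fun ξ => (potential_nonneg hv w l _).trans (hpt' ξ))]
  refine ENNReal.ofReal_le_ofReal ?_
  rw [integral_add (integrable_const A) hint2, integral_add (hDi.const_mul _) (hDsq.const_mul _),
    integral_const_mul, integral_const_mul, hDi0]
  simp only [integral_const, probReal_univ, smul_eq_mul, one_mul, mul_zero, zero_add]
  have hvar : ∫ ξ, ‖D ξ‖ ^ 2 ∂P.Dξ ≤ M ^ 2 := hP.g_var _ hd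
  have hQb : ‖Q‖ ≤ gradBound par p M := norm_meanGradL_le hP hv.M_pos.le hv.hγ₁ hd
    (fun i => (ha2 i).1) (fun i => (ha2 i).2)
  have hdb : ‖d‖ ≤ dualGradBound par p M := norm_gradDual_le hP hv hx hz ha1 ha2
  have hmono := hs.strong_monotone hP hv hx (fun i => (hz i).1) ha1 a.2
  have hpot : potential par w l a ≤ μ * ‖a.1 - w‖ ^ 2 + par.γ₂ * ‖a.2 - l‖ ^ 2 := by
    have h1 : 1 / par.η ≤ μ := by
      rw [one_div_le hη hv.hμ]
      exact hv.hη
    have h2 : 1 / par.ρ ≤ par.γ₂ := by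
      rw [one_div_le hρ hv.hγ₂]
      exact hv.hρ
    have h3 := mul_le_mul_of_nonneg_right h1 (sq_nonneg ‖a.1 - w‖)
    have h4 := mul_le_mul_of_nonneg_right h2 (sq_nonneg ‖a.2 - l‖)
    unfold potential
    rw [div_eq_inv_mul, div_eq_inv_mul, ← one_div, ← one_div]
    linarith
  have h5 := mul_le_mul_of_nonneg_left (hpot.trans hmono) (by positivity : 0 ≤ 2 / t)
  have h6 : 1 / t ^ 2 * (par.η * (2 * ‖Q‖ ^ 2) + par.ρ * ‖d‖ ^ 2) +
      2 * par.η / t ^ 2 * ∫ ξ, ‖D ξ‖ ^ 2 ∂P.Dξ ≤ innerConst par p M / t ^ 2 := by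
    calc _ = 1 / t ^ 2 * (par.η * (2 * ‖Q‖ ^ 2 + 2 * ∫ ξ, ‖D ξ‖ ^ 2 ∂P.Dξ) + par.ρ * ‖d‖ ^ 2) := by
          ring
      _ ≤ 1 / t ^ 2 * innerConst par p M := by
          unfold innerConst
          gcongr
      _ = _ := by ring
  have h7 : (1 - 2 / t) * potential par w l a ≤ max 0 (1 - 2 / t) * potential par w l a :=
    mul_le_mul_of_nonneg_right (le_max_right _ _) (potential_nonneg hv w l a)
  simp only [A]
  linarith

/-- After `j ≥ 1` steps the expected potential is at most `innerConst / j`. -/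
theorem IsSaddle.lintegral_potential_salmIter_le {x : Vec m} {z : Vec p} {w : Vec n} {l : Vec p}
    (hs : P.IsSaddle par x z w l) (hx : x ∈ P.X) (hz : ∀ i, 0 ≤ z i ∧ z i ≤ par.box p)
    {w₀ : Vec n} (hw₀ : w₀ ∈ P.Y) {s : ℕ} (j : ℕ) (hj : j + 1 ≤ s) :
    ∫⁻ ξ, ENNReal.ofReal (potential par w l (P.salmIter par x z w₀ ξ (j + 1)))
      ∂(Measure.pi fun _ : Fin s => P.Dξ) ≤ ENNReal.ofReal (innerConst par p M / (j + 1)) := by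
  have hprob := hP.prob_ξ
  have hη := hv.η_pos
  have hρ := hv.ρ_pos
  have hV := innerConst_nonneg (p := p) hv
  set Pr := Measure.pi fun _ : Fin s => P.Dξ with hPr
  -- One step: the state is independent of the next sample.
  have step : ∀ j, j < s →
      ∫⁻ ξ, ENNReal.ofReal (potential par w l (P.salmIter par x z w₀ ξ (j + 1))) ∂Pr ≤
      ∫⁻ ξ, ENNReal.ofReal (max (0 : ℝ) (1 - 2 / ((j : ℝ) + 1)) *
        potential par w l (P.salmIter par x z w₀ ξ j) + innerConst par p M / (j + 1) ^ 2) ∂Pr := by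
    intro j hj
    let A := {a : Vec n × Vec p // a.1 ∈ P.Y ∧ a.2 ∈ dualBox par p M}
    let X : (Fin s → Ωξ) → A := fun ξ =>
      ⟨P.salmIter par x z w₀ ξ j, salmIter_mem hP hv hx hz hw₀ ξ j⟩
    have hXm : ∀ {mα : MeasurableSpace (Fin s → Ωξ)},
        (∀ i : Fin s, (i : ℕ) < j → Measurable[mα] fun ξ => ξ i) → Measurable[mα] X := by
      intro mα hi
      exact (measurable_salmIter (par := par) hP (measurable_const (a := x))
        (measurable_const (a := z)) (fun _ => hx) hw₀ j hi).subtype_mk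
    have hX : Measurable X := hXm fun i _ => measurable_pi_apply i
    have hind : IndepFun X (fun ξ : Fin s → Ωξ => ξ ⟨j, hj⟩) Pr := by
      refine indepFun_of_measurable_iSup (f := fun (i : Fin s) (ξ : Fin s → Ωξ) => ξ i)
        (S := {i | (i : ℕ) < j}) (k := ⟨j, hj⟩) (fun i => measurable_pi_apply i)
        (iIndepFun_pi (X := fun _ => id) fun _ => aemeasurable_id) (by simp) (hXm fun i hi => ?_)
      exact measurable_of_mem_iSup (fun (i : Fin s) (ξ : Fin s → Ωξ) => ξ i) hi
    have hφ : Measurable fun c : A × Ωξ =>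
        ENNReal.ofReal (potential par w l (P.salmStep par x z j c.1.1 c.2)) := by
      have h1 : Measurable fun c : A × Ωξ => c.1.1.1 := _root_.measurable_fst.subtype_val.fst
      have h2 : Measurable fun c : A × Ωξ => c.1.1.2 := _root_.measurable_fst.subtype_val.snd
      have h3 : Measurable fun c : A × Ωξ => (P.salmStep par x z j c.1.1 c.2).1 := by
        refine (continuous_proj ⟨w₀, hw₀⟩ hP.Y_compact.isClosed hP.Y_convex).measurable.comp ?_
        exact h1.sub (measurable_real_smul _ (Problem.measurable_snd (measurable_gradL hP _
          measurable_const h1 h2 _root_.measurable_snd (fun _ => hx) fun c => c.1.2.1)))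
      have h4 : Measurable fun c : A × Ωξ => (P.salmStep par x z j c.1.1 c.2).2 := by
        refine (continuous_proj (orthant_nonempty p) (isClosed_orthant p)
          (convex_orthant p)).measurable.comp ?_
        exact h2.add (measurable_real_smul _ (measurable_gradDual hP _ _ measurable_const
          measurable_const h1 h2 (fun _ => hx) fun c => c.1.2.1))
      unfold potential
      exact ((((h3.sub_const w).norm.pow_const 2).div_const _).add
        (((h4.sub_const l).norm.pow_const 2).div_const _)).ennreal_ofReal
    have hmap : Pr.map (fun ξ : Fin s → Ωξ => ξ ⟨j, hj⟩) = P.Dξ :=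
      (measurePreserving_eval (fun _ : Fin s => P.Dξ) ⟨j, hj⟩).map_eq
    have h1 := lintegral_indep hX (measurable_pi_apply _) hind hφ
    rw [hmap] at h1
    simp only [salmIter_succ x z w₀ _ hj]
    refine h1.trans_le (lintegral_mono fun ξ => ?_)
    exact hs.lintegral_potential_salmStep_le hP hv hx hz j (X ξ).2.1 (X ξ).2.2
  induction j with
  | zero =>
    -- The contraction factor of the first step is zero: the starting point does not matter.
    refine (step 0 hj).trans ?_
    have e : max (0 : ℝ) (1 - 2 / (((0 : ℕ) : ℝ) + 1)) = 0 := by norm_num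
    rw [e]
    simp
  | succ j ih =>
    have ih' := ih (Nat.le_of_succ_le hj)
    refine (step (j + 1) hj).trans ?_
    set τ : ℝ := ((j + 1 : ℕ) : ℝ) + 1 with hτ
    have hτ2 : 2 ≤ τ := by
      rw [hτ]
      push_cast
      linarith [(Nat.cast_nonneg j : (0 : ℝ) ≤ j)]
    have hc : 0 ≤ 1 - 2 / τ := by
      rw [sub_nonneg, div_le_one (by linarith)]
      exact hτ2
    rw [max_eq_right hc]
    have hm : Measurable fun ξ : Fin s → Ωξ =>
        potential par w l (P.salmIter par x z w₀ ξ (j + 1)) := by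
      have h1 := measurable_salmIter (par := par) hP
        (measurable_const : Measurable fun _ : Fin s → Ωξ => x)
        (measurable_const : Measurable fun _ : Fin s → Ωξ => z) (fun _ => hx) hw₀ (j + 1)
        fun i _ => measurable_pi_apply i
      unfold potential
      exact (((h1.fst.sub_const w).norm.pow_const 2).div_const _).add
        (((h1.snd.sub_const l).norm.pow_const 2).div_const _)
    have hpot := fun ξ : Fin s → Ωξ => potential_nonneg hv w l (P.salmIter par x z w₀ ξ (j + 1))
    have e1 : ∀ ξ : Fin s → Ωξ, ENNReal.ofReal ((1 - 2 / τ) *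
        potential par w l (P.salmIter par x z w₀ ξ (j + 1)) + innerConst par p M / τ ^ 2) =
        ENNReal.ofReal (1 - 2 / τ) *
          ENNReal.ofReal (potential par w l (P.salmIter par x z w₀ ξ (j + 1))) +
        ENNReal.ofReal (innerConst par p M / τ ^ 2) := by
      intro ξ
      rw [ENNReal.ofReal_add (mul_nonneg hc (hpot ξ)) (by positivity), ENNReal.ofReal_mul hc]
    simp only [e1]
    rw [lintegral_add_right _ measurable_const, lintegral_const_mul _ hm.ennreal_ofReal,
      lintegral_const, measure_univ, mul_one]
    refine (add_le_add (mul_le_mul_right ih' _) le_rfl).trans ?_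
    rw [← ENNReal.ofReal_mul hc, ← ENNReal.ofReal_add (by positivity) (by positivity)]
    refine ENNReal.ofReal_le_ofReal ?_
    have hj1 : ((j : ℝ) + 1) = τ - 1 := by
      rw [hτ]
      push_cast
      ring
    rw [hj1]
    have hτ1 : 0 < τ - 1 := by linarith
    have hτ0 : 0 < τ := by linarith
    have h8 : (1 - 2 / τ) * (1 / (τ - 1)) + 1 / τ ^ 2 ≤ 1 / τ := by
      rw [← sub_nonneg]
      have : 1 / τ - ((1 - 2 / τ) * (1 / (τ - 1)) + 1 / τ ^ 2) = 1 / (τ ^ 2 * (τ - 1)) := by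
        field_simp
        ring
      rw [this]
      positivity
    have h9 := mul_le_mul_of_nonneg_left h8 hV
    calc _ = innerConst par p M * ((1 - 2 / τ) * (1 / (τ - 1)) + 1 / τ ^ 2) := by ring
      _ ≤ _ := h9
      _ = _ := by ring

end

/-! ### The error of the stochastic direction -/

/-- The mean squared error of the direction is at most this constant times
`1 / r + c₁² / q + c₁² / s`. -/
def errConst (par : Params) (p : ℕ) (M : ℝ) : ℝ :=
  8 * M ^ 2 + 8 * ((gradLip par p M + par.γ₂) ^ 2 * (par.η + par.ρ) * innerConst par p M)

theorem sq_add_four_le (a b c d : ℝ) :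
    (a + b + c + d) ^ 2 ≤ 4 * (a ^ 2 + b ^ 2 + c ^ 2 + d ^ 2) := by
  nlinarith [sq_nonneg (a - b), sq_nonneg (a - c), sq_nonneg (a - d), sq_nonneg (b - c),
    sq_nonneg (b - d), sq_nonneg (c - d)]

section

variable (hP : P.Assumptions (Constants.uniform M μ)) (hv : par.Valid M μ)

include hv in
theorem errConst_pos : 0 < errConst par p M := by
  have h1 := hv.M_pos
  have h2 := innerConst_nonneg (p := p) hv
  have h3 := hv.η_pos
  have h4 := hv.ρ_pos
  unfold errConst
  positivity

/-- The error of the direction: the mini-batch errors of `∇f` and `∇g` at `(x, y)` and of `∇g` at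
`(x, w')`, and the effect of the distance of the inner output `(w', l')` to the saddle point. -/
theorem direction_sub_gradPsi (c₁ c₂ : ℝ) (u : XYZ m n p) (w w' : Vec n) (l l' : Vec p)
    {r q : ℕ} (hq : 0 < q) (ζ : Fin r → Ωζ) (ξ : Fin q → Ωξ) :
    P.direction par c₁ c₂ u w' l' ζ ξ - P.gradPsi par c₁ c₂ u w l =
      embedXY m n p (((1 / (r : ℝ)) • ∑ j, P.gradf u.fst (ζ j) - ∇ P.F u.fst) +
        c₁ • ((1 / (q : ℝ)) • ∑ j, P.gradg u.fst (ξ j) - ∇ P.G u.fst) -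
        c₁ • pair ((1 / (q : ℝ)) • ∑ j, P.gradg (pair u.fst.fst w') (ξ j) -
          ∇ P.G (pair u.fst.fst w')).fst 0) -
      c₁ • WithLp.toLp 2 (pair (P.meanGradL par.γ₁ (pair u.fst.fst w') l' -
        P.meanGradL par.γ₁ (pair u.fst.fst w) l).fst 0, par.γ₂ • (l' - l)) := by
  have hq' : (q : ℝ) ≠ 0 := Nat.cast_ne_zero.2 hq.ne'
  have hs : ∀ (s : Finset (Fin q)) (f : Fin q → XY m n), (∑ i ∈ s, f i).fst = ∑ i ∈ s, (f i).fst :=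
    fun s f => map_sum (WithLp.fstL 2 ℝ (Vec m) (Vec n)) f s
  have havg : (1 / (q : ℝ)) • ∑ j, (P.gradL par.γ₁ u.fst.fst w' l' (ξ j)).fst =
      (P.meanGradL par.γ₁ (pair u.fst.fst w') l').fst +
      ((1 / (q : ℝ)) • ∑ j, P.gradg (pair u.fst.fst w') (ξ j) - ∇ P.G (pair u.fst.fst w')).fst := by
    simp only [gradL_eq]
    rw [← hs, Finset.sum_add_distrib, Finset.sum_sub_distrib, ← WithLp.smul_fst, ← WithLp.add_fst]
    congr 1
    simp only [Finset.sum_const, Finset.card_univ, Fintype.card_fin]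
    rw [← Nat.cast_smul_eq_nsmul ℝ, ← Nat.cast_smul_eq_nsmul ℝ, smul_add, smul_sub, smul_smul,
      smul_smul, one_div_mul_cancel hq', one_smul, one_smul]
  apply (WithLp.equiv 2 _).injective
  refine Prod.ext ?_ ?_
  · apply (WithLp.equiv 2 _).injective
    refine Prod.ext ?_ ?_
    · change ((1 / (r : ℝ)) • ∑ j, P.gradf u.fst (ζ j) +
        c₁ • ((1 / (q : ℝ)) • ∑ j, P.gradg u.fst (ξ j) -
          pair ((1 / (q : ℝ)) • ∑ j, (P.gradL par.γ₁ u.fst.fst w' l' (ξ j)).fst) 0) +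
        c₂ • ∑ i, (max 0 (P.H i u.fst)) • ∇ (P.H i) u.fst).fst -
        ((∇ P.F u.fst + c₁ • ∇ P.G u.fst + c₂ • ∑ i, (max 0 (P.H i u.fst)) • ∇ (P.H i) u.fst).fst -
          c₁ • (P.meanGradL par.γ₁ (pair u.fst.fst w) l).fst) =
        (((1 / (r : ℝ)) • ∑ j, P.gradf u.fst (ζ j) - ∇ P.F u.fst) +
        c₁ • ((1 / (q : ℝ)) • ∑ j, P.gradg u.fst (ξ j) - ∇ P.G u.fst) -
        c₁ • pair ((1 / (q : ℝ)) • ∑ j, P.gradg (pair u.fst.fst w') (ξ j) -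
          ∇ P.G (pair u.fst.fst w')).fst (0 : Vec n)).fst -
        c₁ • (P.meanGradL par.γ₁ (pair u.fst.fst w') l' -
          P.meanGradL par.γ₁ (pair u.fst.fst w) l).fst
      rw [havg]
      simp only [WithLp.add_fst, WithLp.sub_fst, WithLp.smul_fst, pair_fst]
      module
    · change ((1 / (r : ℝ)) • ∑ j, P.gradf u.fst (ζ j) +
        c₁ • ((1 / (q : ℝ)) • ∑ j, P.gradg u.fst (ξ j) -
          pair ((1 / (q : ℝ)) • ∑ j, (P.gradL par.γ₁ u.fst.fst w' l' (ξ j)).fst) 0) +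
        c₂ • ∑ i, (max 0 (P.H i u.fst)) • ∇ (P.H i) u.fst).snd -
        ((∇ P.F u.fst + c₁ • ∇ P.G u.fst + c₂ • ∑ i, (max 0 (P.H i u.fst)) • ∇ (P.H i) u.fst).snd -
          c₁ • (0 : Vec n)) =
        (((1 / (r : ℝ)) • ∑ j, P.gradf u.fst (ζ j) - ∇ P.F u.fst) +
        c₁ • ((1 / (q : ℝ)) • ∑ j, P.gradg u.fst (ξ j) - ∇ P.G u.fst) -
        c₁ • pair ((1 / (q : ℝ)) • ∑ j, P.gradg (pair u.fst.fst w') (ξ j) -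
          ∇ P.G (pair u.fst.fst w')).fst (0 : Vec n)).snd - c₁ • (0 : Vec n)
      simp only [WithLp.add_snd, WithLp.sub_snd, WithLp.smul_snd, pair_snd]
      module
  · change c₁ • (-(par.γ₂ • (l' - u.snd))) - ((0 : Vec p) - c₁ • (par.γ₂ • (l - u.snd))) =
      (0 : Vec p) - c₁ • (par.γ₂ • (l' - l))
    module

include hP hv

theorem sq_norm_direction_sub_gradPsi_le {c₁ : ℝ} (hc₁ : 0 < c₁) (c₂ : ℝ) {u : XYZ m n p}
    (hx : u.fst.fst ∈ P.X) {w w' : Vec n} {l l' : Vec p} (hw : w ∈ P.Y) (hw' : w' ∈ P.Y)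
    (hl' : l' ∈ dualBox par p M)
    {r q : ℕ} (hq : 0 < q) (ζ : Fin r → Ωζ) (ξ : Fin q → Ωξ) :
    ‖P.direction par c₁ c₂ u w' l' ζ ξ - P.gradPsi par c₁ c₂ u w l‖ ^ 2 ≤
      4 * ‖(1 / (r : ℝ)) • ∑ j, P.gradf u.fst (ζ j) - ∇ P.F u.fst‖ ^ 2 +
      (4 * c₁ ^ 2 * ‖(1 / (q : ℝ)) • ∑ j, P.gradg u.fst (ξ j) - ∇ P.G u.fst‖ ^ 2 +
      (4 * c₁ ^ 2 * ‖(1 / (q : ℝ)) • ∑ j, P.gradg (pair u.fst.fst w') (ξ j) -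
          ∇ P.G (pair u.fst.fst w')‖ ^ 2 +
      8 * c₁ ^ 2 * ((gradLip par p M + par.γ₂) ^ 2 * (par.η + par.ρ)) *
        potential par w l (w', l'))) := by
  have hγ₂ := hv.hγ₂
  have hη := hv.η_pos
  have hρ := hv.ρ_pos
  have hg := gradLip_nonneg (p := p) hv
  rw [direction_sub_gradPsi c₁ c₂ u w w' l l' hq ζ ξ]
  set A := (1 / (r : ℝ)) • ∑ j, P.gradf u.fst (ζ j) - ∇ P.F u.fst
  set B := (1 / (q : ℝ)) • ∑ j, P.gradg u.fst (ξ j) - ∇ P.G u.fst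
  set C := (1 / (q : ℝ)) • ∑ j, P.gradg (pair u.fst.fst w') (ξ j) - ∇ P.G (pair u.fst.fst w')
  set T := ‖w' - w‖ + ‖l' - l‖ with hT
  have hpz : ∀ x : Vec m, ‖pair x (0 : Vec n)‖ = ‖x‖ := fun x => WithLp.norm_toLp_fst 2 _ _ x
  have hQ := norm_meanGradL_sub_le' hP hv (v := pair u.fst.fst w') (v' := pair u.fst.fst w)
    (l' := l) ⟨hx, hw'⟩ ⟨hx, hw⟩ (fun i => (hl' i).1) (fun i => (hl' i).2)
  rw [norm_pair_sub_pair_right] at hQ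
  have h1 : ‖embedXY m n p (A + c₁ • B - c₁ • pair C.fst 0)‖ ≤ ‖A‖ + c₁ * ‖B‖ + c₁ * ‖C‖ := by
    rw [norm_embedXY]
    refine (norm_sub_le _ _).trans (add_le_add ((norm_add_le _ _).trans ?_) ?_)
    · rw [norm_smul, Real.norm_eq_abs, abs_of_pos hc₁]
    · rw [norm_smul, Real.norm_eq_abs, abs_of_pos hc₁, hpz]
      gcongr
      exact WithLp.norm_fst_le _ C
  have h2 : ‖c₁ • (WithLp.toLp 2 (pair (P.meanGradL par.γ₁ (pair u.fst.fst w') l' -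
        P.meanGradL par.γ₁ (pair u.fst.fst w) l).fst 0, par.γ₂ • (l' - l)) : XYZ m n p)‖ ≤
      c₁ * ((gradLip par p M + par.γ₂) * T) := by
    rw [norm_smul, Real.norm_eq_abs, abs_of_pos hc₁]
    gcongr
    refine (norm_le_fst_add_snd _).trans ?_
    rw [add_mul]
    refine add_le_add ?_ ?_
    · simp only [WithLp.toLp_fst]
      rw [hpz]
      exact (WithLp.norm_fst_le _ (P.meanGradL par.γ₁ (pair u.fst.fst w') l' -
        P.meanGradL par.γ₁ (pair u.fst.fst w) l)).trans hQ
    · simp only [WithLp.toLp_snd]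
      rw [norm_smul, Real.norm_eq_abs, abs_of_pos hγ₂]
      gcongr
      exact le_add_of_nonneg_left (norm_nonneg _)
  have h3 := (norm_sub_le _ _).trans (add_le_add h1 h2)
  refine (pow_le_pow_left₀ (norm_nonneg _) h3 2).trans ((sq_add_four_le _ _ _ _).trans ?_)
  have hT2 : T ^ 2 ≤ 2 * ((par.η + par.ρ) * potential par w l (w', l')) := by
    have e1 : ‖w' - w‖ ^ 2 = par.η * (‖w' - w‖ ^ 2 / par.η) := by field_simp
    have e2 : ‖l' - l‖ ^ 2 = par.ρ * (‖l' - l‖ ^ 2 / par.ρ) := by field_simp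
    have e3 : T ^ 2 ≤ 2 * (‖w' - w‖ ^ 2 + ‖l' - l‖ ^ 2) := add_sq_le
    refine e3.trans ?_
    unfold potential
    have k1 : 0 ≤ ‖w' - w‖ ^ 2 / par.η := by positivity
    have k2 : 0 ≤ ‖l' - l‖ ^ 2 / par.ρ := by positivity
    nlinarith [mul_nonneg hρ.le k1, mul_nonneg hη.le k2]
  have h4 := mul_le_mul_of_nonneg_left hT2
    (by positivity : 0 ≤ 4 * (c₁ ^ 2 * (gradLip par p M + par.γ₂) ^ 2))
  nlinarith

/-- The mean squared error of the direction, at a fixed point `u`. The samples of the outer gradient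
are independent of the inner output `(w, l)`, so that the mini-batch error at the random point
`(x, w)` has the variance bound of a fixed point. -/
theorem lintegral_sq_norm_direction_sub_le {c₁ : ℝ} (hc₁ : 0 < c₁) (c₂ : ℝ) {u : XYZ m n p}
    (hu : u ∈ P.U par) {w₀ : Vec n} (hw₀ : w₀ ∈ P.Y) {s r q : ℕ} (hs : 0 < s) (hr : 0 < r)
    (hq : 0 < q) :
    ∫⁻ b, ENNReal.ofReal (‖P.direction par c₁ c₂ u (P.salm par u.fst.fst u.snd w₀ b.1).1
      (P.salm par u.fst.fst u.snd w₀ b.1).2 b.2.1 b.2.2 - ∇ (P.Ψ par c₁ c₂) u‖ ^ 2)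
      ∂(P.batchLaw s r q) ≤
    ENNReal.ofReal (errConst par p M * (1 / r + c₁ ^ 2 / q + c₁ ^ 2 / s)) := by
  have hprob := hP.prob_ξ
  have hprob' := hP.prob_ζ
  obtain ⟨w, l, hsad⟩ := exists_isSaddle_of_mem hP hv hu
  rw [hsad.gradient_Ψ hP hv hu]
  have hx := hu.1.1
  have hmem := fun ξ : Fin s → Ωξ => salmIter_mem hP hv hx hu.2 hw₀ ξ s
  set K := (gradLip par p M + par.γ₂) ^ 2 * (par.η + par.ρ) with hK
  have hK0 : 0 ≤ K := by
    have h3 := hv.η_pos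
    have h4 := hv.ρ_pos
    positivity
  have hV := innerConst_nonneg (p := p) hv
  -- The four terms of the error and their measurability.
  let fA : (Fin r → Ωζ) → ENNReal := fun ζ =>
    ENNReal.ofReal (4 * ‖(1 / (r : ℝ)) • ∑ j, P.gradf u.fst (ζ j) - ∇ P.F u.fst‖ ^ 2)
  let fB : (Fin q → Ωξ) → ENNReal := fun ξ =>
    ENNReal.ofReal (4 * c₁ ^ 2 * ‖(1 / (q : ℝ)) • ∑ j, P.gradg u.fst (ξ j) - ∇ P.G u.fst‖ ^ 2)
  let fC : (Fin s → Ωξ) × (Fin r → Ωζ) × (Fin q → Ωξ) → ENNReal := fun b =>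
    ENNReal.ofReal (4 * c₁ ^ 2 * ‖(1 / (q : ℝ)) • ∑ j,
      P.gradg (pair u.fst.fst (P.salm par u.fst.fst u.snd w₀ b.1).1) (b.2.2 j) -
          ∇ P.G (pair u.fst.fst (P.salm par u.fst.fst u.snd w₀ b.1).1)‖ ^ 2)
  let fD : (Fin s → Ωξ) → ENNReal := fun ξ =>
    ENNReal.ofReal (8 * c₁ ^ 2 * K * potential par w l (P.salm par u.fst.fst u.snd w₀ ξ))
  have hfA : Measurable fA := by
    have h1 : Measurable fun ζ : Fin r → Ωζ => ∑ j, P.gradf u.fst (ζ j) :=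
      Finset.measurable_fun_sum _ fun j _ =>
        measurable_gradf hP measurable_const (fun _ => hu.1) (measurable_pi_apply j)
    exact ((((measurable_real_smul _ h1).sub_const _).norm.pow_const 2).const_mul _).ennreal_ofReal
  have hfB : Measurable fB := by
    have h1 : Measurable fun ξ : Fin q → Ωξ => ∑ j, P.gradg u.fst (ξ j) :=
      Finset.measurable_fun_sum _ fun j _ =>
        measurable_gradg hP measurable_const (fun _ => hu.1) (measurable_pi_apply j)
    exact ((((measurable_real_smul _ h1).sub_const _).norm.pow_const 2).const_mul _).ennreal_ofReal
  have hsalm : Measurable fun ξ : Fin s → Ωξ => P.salm par u.fst.fst u.snd w₀ ξ :=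
    measurable_salmIter (par := par) hP
      (measurable_const : Measurable fun _ : Fin s → Ωξ => u.fst.fst)
      (measurable_const : Measurable fun _ : Fin s → Ωξ => u.snd) (fun _ => hx) hw₀ s
      fun i _ => measurable_pi_apply i
  have hfC : Measurable fC := by
    have hv' : Measurable fun b : (Fin s → Ωξ) × (Fin r → Ωζ) × (Fin q → Ωξ) =>
        pair u.fst.fst (P.salm par u.fst.fst u.snd w₀ b.1).1 :=
      Measurable.vecPair measurable_const (hsalm.comp _root_.measurable_fst).fst
    have hd : ∀ b : (Fin s → Ωξ) × (Fin r → Ωζ) × (Fin q → Ωξ),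
        pair u.fst.fst (P.salm par u.fst.fst u.snd w₀ b.1).1 ∈ P.dom :=
      fun b => ⟨hx, (hmem b.1).1⟩
    have h1 : Measurable fun b : (Fin s → Ωξ) × (Fin r → Ωζ) × (Fin q → Ωξ) => ∑ j,
        P.gradg (pair u.fst.fst (P.salm par u.fst.fst u.snd w₀ b.1).1) (b.2.2 j) :=
      Finset.measurable_fun_sum _ fun j _ => measurable_gradg hP hv' hd
        ((measurable_pi_apply j).comp (_root_.measurable_snd.comp _root_.measurable_snd))
    have h2 := measurable_comp_of_continuousOn hP.continuousOn_gradG hv' hd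
    exact ((((measurable_real_smul _ h1).sub h2).norm.pow_const 2).const_mul _).ennreal_ofReal
  have hfD : Measurable fD := by
    unfold fD potential
    exact (((((hsalm.fst.sub_const w).norm.pow_const 2).div_const _).add
      (((hsalm.snd.sub_const l).norm.pow_const 2).div_const _)).const_mul _).ennreal_ofReal
  -- The integrals of the four terms.
  have hA : ∫⁻ ζ, fA ζ ∂(Measure.pi fun _ : Fin r => P.Dζ) ≤ ENNReal.ofReal (4 * (M ^ 2 / r)) := by
    have h1 := lintegral_sq_norm_average_sub_le (hP.f_memLp _ hu.1) (hP.f_unbiased _ hu.1)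
      (hP.f_var _ hu.1) hr
    simp only [fA, ENNReal.ofReal_mul (zero_le_four (α := ℝ))]
    rw [lintegral_const_mul' _ _ ENNReal.ofReal_ne_top]
    exact mul_le_mul_right h1 _
  have hG : ∀ v ∈ P.dom, ∫⁻ ξ, ENNReal.ofReal (4 * c₁ ^ 2 * ‖(1 / (q : ℝ)) • ∑ j, P.gradg v (ξ j)
      - ∇ P.G v‖ ^ 2) ∂(Measure.pi fun _ : Fin q => P.Dξ) ≤
      ENNReal.ofReal (4 * c₁ ^ 2 * (M ^ 2 / q)) := by
    intro v hvd
    have h1 := lintegral_sq_norm_average_sub_le (hP.g_memLp _ hvd) (hP.g_unbiased _ hvd)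
      (hP.g_var _ hvd) hq
    simp only [ENNReal.ofReal_mul (by positivity : (0 : ℝ) ≤ 4 * c₁ ^ 2)]
    rw [lintegral_const_mul' _ _ ENNReal.ofReal_ne_top]
    exact mul_le_mul_right h1 _
  have hC : ∫⁻ b, fC b ∂(P.batchLaw s r q) ≤ ENNReal.ofReal (4 * c₁ ^ 2 * (M ^ 2 / q)) := by
    unfold batchLaw
    rw [lintegral_prod _ hfC.aemeasurable]
    calc _ ≤ ∫⁻ _ : Fin s → Ωξ, ENNReal.ofReal (4 * c₁ ^ 2 * (M ^ 2 / q))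
          ∂(Measure.pi fun _ => P.Dξ) := by
          refine lintegral_mono fun ξ => ?_
          have h1 : Measurable fun ξ' : Fin q → Ωξ => ENNReal.ofReal (4 * c₁ ^ 2 *
              ‖(1 / (q : ℝ)) • ∑ j,
              P.gradg (pair u.fst.fst (P.salm par u.fst.fst u.snd w₀ ξ).1) (ξ' j) -
              ∇ P.G (pair u.fst.fst (P.salm par u.fst.fst u.snd w₀ ξ).1)‖ ^ 2) := by
            have h2 : Measurable fun ξ' : Fin q → Ωξ => ∑ j,
                P.gradg (pair u.fst.fst (P.salm par u.fst.fst u.snd w₀ ξ).1) (ξ' j) :=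
              Finset.measurable_fun_sum _ fun j _ => measurable_gradg hP measurable_const
                (fun _ => ⟨hx, (hmem ξ).1⟩) (measurable_pi_apply j)
            exact ((((measurable_real_smul _ h2).sub_const _).norm.pow_const
              2).const_mul _).ennreal_ofReal
          have h2 := (measurePreserving_snd (μ := Measure.pi fun _ : Fin r => P.Dζ)
            (ν := Measure.pi fun _ : Fin q => P.Dξ)).lintegral_comp h1
          exact h2.trans_le (hG _ ⟨hx, (hmem ξ).1⟩)
      _ = _ := by simp
  have hD : ∫⁻ ξ, fD ξ ∂(Measure.pi fun _ : Fin s => P.Dξ) ≤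
      ENNReal.ofReal (8 * c₁ ^ 2 * K * (innerConst par p M / s)) := by
    obtain ⟨j, rfl⟩ : ∃ j, s = j + 1 := ⟨s - 1, (Nat.succ_pred_eq_of_pos hs).symm⟩
    have h1 := hsad.lintegral_potential_salmIter_le hP hv hx hu.2 hw₀ j le_rfl
    simp only [fD, ENNReal.ofReal_mul (by positivity : (0 : ℝ) ≤ 8 * c₁ ^ 2 * K)]
    rw [lintegral_const_mul' _ _ ENNReal.ofReal_ne_top]
    push_cast
    exact mul_le_mul_right h1 _
  have hpA : ∫⁻ b, fA b.2.1 ∂(P.batchLaw s r q) = ∫⁻ ζ, fA ζ ∂(Measure.pi fun _ : Fin r => P.Dζ) :=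
    (measurePreserving_fst.comp (measurePreserving_snd (μ := Measure.pi fun _ : Fin s => P.Dξ)
      (ν := (Measure.pi fun _ : Fin r => P.Dζ).prod
        (Measure.pi fun _ : Fin q => P.Dξ)))).lintegral_comp hfA
  have hpB : ∫⁻ b, fB b.2.2 ∂(P.batchLaw s r q) = ∫⁻ ξ, fB ξ ∂(Measure.pi fun _ : Fin q => P.Dξ) :=
    (measurePreserving_snd.comp (measurePreserving_snd (μ := Measure.pi fun _ : Fin s => P.Dξ)
      (ν := (Measure.pi fun _ : Fin r => P.Dζ).prod
        (Measure.pi fun _ : Fin q => P.Dξ)))).lintegral_comp hfB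
  have hpD : ∫⁻ b, fD b.1 ∂(P.batchLaw s r q) = ∫⁻ ξ, fD ξ ∂(Measure.pi fun _ : Fin s => P.Dξ) :=
    (measurePreserving_fst (μ := Measure.pi fun _ : Fin s => P.Dξ)
      (ν := (Measure.pi fun _ : Fin r => P.Dζ).prod
        (Measure.pi fun _ : Fin q => P.Dξ))).lintegral_comp hfD
  have hmA : Measurable fun b : Batch Ωξ Ωζ s r q => fA b.2.1 :=
    hfA.comp (_root_.measurable_fst.comp _root_.measurable_snd)
  have hmB : Measurable fun b : Batch Ωξ Ωζ s r q => fB b.2.2 :=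
    hfB.comp (_root_.measurable_snd.comp _root_.measurable_snd)
  calc _ ≤ ∫⁻ b, (fA b.2.1 + (fB b.2.2 + (fC b + fD b.1))) ∂(P.batchLaw s r q) := by
        refine lintegral_mono fun b => ?_
        have h1 := sq_norm_direction_sub_gradPsi_le hP hv (l := l) hc₁ c₂ hx hsad.mem (hmem b.1).1
          (hmem b.1).2 hq b.2.1 b.2.2
        refine (ENNReal.ofReal_le_ofReal h1).trans ?_
        refine ENNReal.ofReal_add_le.trans (add_le_add le_rfl ?_)
        refine ENNReal.ofReal_add_le.trans (add_le_add le_rfl ?_)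
        exact ENNReal.ofReal_add_le
    _ = ∫⁻ ζ, fA ζ ∂(Measure.pi fun _ : Fin r => P.Dζ) +
        (∫⁻ ξ, fB ξ ∂(Measure.pi fun _ : Fin q => P.Dξ) + (∫⁻ b, fC b ∂(P.batchLaw s r q) +
          ∫⁻ ξ, fD ξ ∂(Measure.pi fun _ : Fin s => P.Dξ))) := by
        rw [lintegral_add_left hmA, lintegral_add_left hmB, lintegral_add_left hfC, hpA, hpB, hpD]
    _ ≤ ENNReal.ofReal (4 * (M ^ 2 / r)) + (ENNReal.ofReal (4 * c₁ ^ 2 * (M ^ 2 / q)) +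
        (ENNReal.ofReal (4 * c₁ ^ 2 * (M ^ 2 / q)) +
          ENNReal.ofReal (8 * c₁ ^ 2 * K * (innerConst par p M / s)))) :=
        add_le_add hA (add_le_add (hG _ hu.1) (add_le_add hC hD))
    _ = ENNReal.ofReal (4 * (M ^ 2 / r) + (4 * c₁ ^ 2 * (M ^ 2 / q) + (4 * c₁ ^ 2 * (M ^ 2 / q) +
          8 * c₁ ^ 2 * K * (innerConst par p M / s)))) := by
        rw [ENNReal.ofReal_add, ENNReal.ofReal_add, ENNReal.ofReal_add] <;> positivity
    _ ≤ _ := by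
        refine ENNReal.ofReal_le_ofReal ?_
        have a1 : 0 ≤ 4 * M ^ 2 * (1 / (r : ℝ)) := by positivity
        have a2 : 0 ≤ 8 * M ^ 2 * (c₁ ^ 2 / (s : ℝ)) := by positivity
        have a3 : 0 ≤ 8 * (K * innerConst par p M) * (1 / (r : ℝ) + c₁ ^ 2 / q) := by positivity
        have e : errConst par p M * (1 / r + c₁ ^ 2 / q + c₁ ^ 2 / s) -
            (4 * (M ^ 2 / r) + (4 * c₁ ^ 2 * (M ^ 2 / q) + (4 * c₁ ^ 2 * (M ^ 2 / q) +
              8 * c₁ ^ 2 * K * (innerConst par p M / s)))) =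
            4 * M ^ 2 * (1 / (r : ℝ)) + 8 * M ^ 2 * (c₁ ^ 2 / (s : ℝ)) +
            8 * (K * innerConst par p M) * (1 / (r : ℝ) + c₁ ^ 2 / q) := by
          unfold errConst
          rw [← hK]
          ring
        linarith

end

end Problem

/-! ### One projected gradient step with an inexact gradient -/

section

variable {E : Type*} [NormedAddCommGroup E] [InnerProductSpace ℝ E]

/-- After a projected step from `u` in the direction `d`, the squared distance to stationarity at
the new point is at most a multiple of the decrease of `f`, up to the error of `d`: the optimality
condition of the projection provides an element of the normal cone, and the descent lemma bounds
the length of the step. -/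
theorem sq_infDist_normalCone_proj_le [CompleteSpace E] {S : Set E} (hcl : IsClosed S)
    (hS : Convex ℝ S) {f : E → ℝ} {L : ℝ} (hf : ∀ u ∈ S, DifferentiableAt ℝ f u)
    (hL : ∀ u ∈ S, ∀ u' ∈ S, ‖∇ f u - ∇ f u'‖ ≤ L * ‖u - u'‖) {α : ℝ} (hα : 0 < α)
    (hLα : 2 * L * α < 1) {u : E} (hu : u ∈ S) (d : E) :
    Metric.infDist 0 ((fun v => ∇ f (proj S (u - α • d)) + v) ''
        normalCone S (proj S (u - α • d))) ^ 2 ≤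
      18 / α * (f u - f (proj S (u - α • d))) + 11 * ‖d - ∇ f u‖ ^ 2 := by
  have hu' : proj S (u - α • d) ∈ S := proj_mem ⟨u, hu⟩ hcl hS _
  have hvi := fun w (hw : w ∈ S) => inner_sub_proj_le ⟨u, hu⟩ hcl hS (u - α • d) hw
  set u' := proj S (u - α • d) with hu'_def
  set e := d - ∇ f u with he
  set δ := u' - u with hδ
  have hα' := hα.ne'
  -- The optimality condition of the projection, as an element of the normal cone.
  have hcone : (1 / α) • (u - α • d - u') ∈ normalCone S u' := by
    intro w hw
    rw [real_inner_smul_left]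
    exact mul_nonpos_of_nonneg_of_nonpos (by positivity) (hvi w hw)
  have hvec : ∇ f u' + (1 / α) • (u - α • d - u') = (∇ f u' - ∇ f u) - (1 / α) • δ - e := by
    have h1 : u - α • d - u' = -δ - α • d := by
      rw [hδ]
      abel
    rw [h1, smul_sub, smul_smul, one_div_mul_cancel hα', one_smul, smul_neg, he]
    abel
  have hLip : L ≤ 1 / (2 * α) := by
    rw [le_div_iff₀ (by positivity)]
    linarith
  have hnorm : Metric.infDist 0 ((fun v => ∇ f u' + v) '' normalCone S u') ≤
      3 / (2 * α) * ‖δ‖ + ‖e‖ := by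
    refine (Metric.infDist_le_dist_of_mem (Set.mem_image_of_mem _ hcone)).trans ?_
    rw [dist_zero_left, hvec]
    have h1 : ‖∇ f u' - ∇ f u‖ ≤ 1 / (2 * α) * ‖δ‖ :=
      (hL u' hu' u hu).trans (mul_le_mul_of_nonneg_right hLip (norm_nonneg _))
    have h2 : ‖(1 / α) • δ‖ = 1 / α * ‖δ‖ := by
      rw [norm_smul, Real.norm_of_nonneg (by positivity)]
    have h3 : 3 / (2 * α) * ‖δ‖ = 1 / (2 * α) * ‖δ‖ + 1 / α * ‖δ‖ := by
      field_simp
      ring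
    have h4 := norm_sub_le (∇ f u' - ∇ f u - (1 / α) • δ) e
    have h5 := norm_sub_le (∇ f u' - ∇ f u) ((1 / α) • δ)
    linarith
  have hsq : Metric.infDist 0 ((fun v => ∇ f u' + v) '' normalCone S u') ^ 2 ≤
      9 / (2 * α ^ 2) * ‖δ‖ ^ 2 + 2 * ‖e‖ ^ 2 := by
    refine (pow_le_pow_left₀ Metric.infDist_nonneg hnorm 2).trans (add_sq_le.trans_eq ?_)
    field_simp
    ring
  have hstep : ‖δ‖ ^ 2 / α ≤ -inner ℝ d δ := by
    have h1 := hvi u hu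
    have h2 : u - α • d - u' = -δ - α • d := by
      rw [hδ]
      abel
    have h3 : u - u' = -δ := by
      rw [hδ]
      abel
    rw [h2, h3, inner_neg_right, inner_sub_left, inner_neg_left, real_inner_self_eq_norm_sq,
      real_inner_smul_left] at h1
    rw [div_le_iff₀ hα]
    linarith
  have hdesc := le_add_inner_gradient_add_sq hS hf hL hu hu'
  have hin : inner ℝ (∇ f u) δ = inner ℝ d δ - inner ℝ e δ := by
    rw [he, inner_sub_left]
    ring
  have hcs : -inner ℝ e δ ≤ ‖e‖ * ‖δ‖ := by
    rw [← inner_neg_left, ← norm_neg e]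
    exact real_inner_le_norm _ _
  have hyoung : ‖e‖ * ‖δ‖ ≤ α / 2 * ‖e‖ ^ 2 + 1 / (2 * α) * ‖δ‖ ^ 2 := by
    have h1 : 0 ≤ 1 / (2 * α) * (α * ‖e‖ - ‖δ‖) ^ 2 := by positivity
    have h2 : 1 / (2 * α) * (α * ‖e‖ - ‖δ‖) ^ 2 =
        α / 2 * ‖e‖ ^ 2 + 1 / (2 * α) * ‖δ‖ ^ 2 - ‖e‖ * ‖δ‖ := by
      field_simp
      ring
    linarith
  have hL2 : L / 2 * ‖δ‖ ^ 2 ≤ 1 / (4 * α) * ‖δ‖ ^ 2 := by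
    refine mul_le_mul_of_nonneg_right ?_ (sq_nonneg _)
    have : 1 / (4 * α) = 1 / (2 * α) / 2 := by
      field_simp
      ring
    linarith
  have hdecr : 1 / (4 * α) * ‖δ‖ ^ 2 ≤ f u - f u' + α / 2 * ‖e‖ ^ 2 := by
    have h1 : ‖δ‖ ^ 2 / α = 1 / (4 * α) * ‖δ‖ ^ 2 + 1 / (4 * α) * ‖δ‖ ^ 2 +
        1 / (2 * α) * ‖δ‖ ^ 2 := by
      field_simp
      ring
    rw [hin] at hdesc
    linarith
  have h6 := mul_le_mul_of_nonneg_left hdecr (by positivity : 0 ≤ 18 / α)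
  have h7 : 18 / α * (1 / (4 * α) * ‖δ‖ ^ 2) = 9 / (2 * α ^ 2) * ‖δ‖ ^ 2 := by
    field_simp
    ring
  have h8 : 18 / α * (f u - f u' + α / 2 * ‖e‖ ^ 2) = 18 / α * (f u - f u') + 9 * ‖e‖ ^ 2 := by
    field_simp
    ring
  linarith

theorem zero_mem_normalCone (S : Set E) (u : E) : (0 : E) ∈ normalCone S u := fun w _ => by
  rw [inner_zero_left]

/-- The distance to stationarity is lower semicontinuous: its sublevel sets are projections, along
a compact ball, of closed sets. -/
theorem lowerSemicontinuous_infDist_normalCone [FiniteDimensional ℝ E] {S : Set E} {g : E → E}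
    (hg : ContinuousOn g S) :
    LowerSemicontinuous fun u : S =>
      Metric.infDist 0 ((fun v => g u + v) '' normalCone S (u : E)) := by
  have : ProperSpace E := FiniteDimensional.proper ℝ E
  rw [lowerSemicontinuous_iff_isClosed_preimage]
  intro t
  have : CompactSpace (Metric.closedBall (0 : E) t) :=
    isCompact_iff_compactSpace.1 (isCompact_closedBall 0 t)
  let T : Set (S × Metric.closedBall (0 : E) t) :=
    {a | ∀ w ∈ S, inner ℝ ((a.2 : E) - g a.1) (w - a.1) ≤ 0}
  have hg' : Continuous fun a : S × Metric.closedBall (0 : E) t => g a.1 :=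
    (continuousOn_iff_continuous_domRestrict.1 hg).comp continuous_fst
  have hT : IsClosed T := by
    have : T = ⋂ w ∈ S, {a | inner ℝ ((a.2 : E) - g a.1) (w - a.1) ≤ 0} := by
      ext a
      simp [T]
    rw [this]
    refine isClosed_biInter fun w _ => isClosed_le ?_ continuous_const
    exact ((continuous_subtype_val.comp continuous_snd).sub hg').inner
      (continuous_const.sub (continuous_subtype_val.comp continuous_fst))
  convert isClosedMap_fst_of_compactSpace T hT using 1
  ext u
  have hcl : IsClosed ((fun v => g u + v) '' normalCone S (u : E)) := by
    refine (Homeomorph.addLeft (g u)).isClosedMap _ ?_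
    have : normalCone S (u : E) = ⋂ w ∈ S, {v | inner ℝ v (w - u) ≤ 0} := by
      ext v
      simp [normalCone]
    rw [this]
    exact isClosed_biInter fun w _ => isClosed_le (continuous_id.inner continuous_const)
      continuous_const
  constructor
  · intro h
    obtain ⟨y, ⟨v, hv, rfl⟩, hy⟩ := hcl.exists_infDist_eq_dist
      (Set.Nonempty.image _ ⟨0, zero_mem_normalCone S (u : E)⟩) 0
    refine ⟨(u, ⟨g u + v, ?_⟩), ?_, rfl⟩
    · rw [Metric.mem_closedBall, dist_comm, ← hy]
      exact h
    · intro w hw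
      change inner ℝ (g u + v - g u) (w - u) ≤ 0
      rw [add_sub_cancel_left]
      exact hv w hw
  · rintro ⟨⟨u', y⟩, hy, rfl⟩
    have h1 : (y : E) ∈ (fun v => g u' + v) '' normalCone S (u' : E) :=
      ⟨y - g u', hy, add_sub_cancel _ _⟩
    refine (Metric.infDist_le_dist_of_mem h1).trans ?_
    rw [dist_comm]
    exact y.2

theorem measurable_infDist_normalCone [FiniteDimensional ℝ E] [MeasurableSpace E] [BorelSpace E]
    {S : Set E} {g : E → E} (hg : ContinuousOn g S) {α : Type*} [MeasurableSpace α] {u : α → E}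
    (hu : Measurable u) (hS : ∀ a, u a ∈ S) :
    Measurable fun a => Metric.infDist 0 ((fun v => g (u a) + v) '' normalCone S (u a)) := by
  have h1 := (lowerSemicontinuous_infDist_normalCone hg).measurable
  have h2 : Measurable fun a => (⟨u a, hS a⟩ : S) := hu.subtype_mk
  have h3 := h1.comp h2
  exact h3

end

namespace Problem

variable {m n p : ℕ} {Ωξ : Type u₁} {Ωζ : Type u₂} [MeasurableSpace Ωξ] [MeasurableSpace Ωζ]
variable {P : Problem m n p Ωξ Ωζ} {par : Params} {M μ : ℝ}

/-! ### The outer loop -/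

/-- The direction at `u` computed from one batch, with the inner loop started at `w₀`. -/
def batchDirection (P : Problem m n p Ωξ Ωζ) (par : Params) (c₁ c₂ : ℝ) (w₀ : Vec n) {s r q : ℕ}
    (u : XYZ m n p) (b : Batch Ωξ Ωζ s r q) : XYZ m n p :=
  P.direction par c₁ c₂ u (P.salm par u.fst.fst u.snd w₀ b.1).1
    (P.salm par u.fst.fst u.snd w₀ b.1).2 b.2.1 b.2.2

section

variable (hP : P.Assumptions (Constants.uniform M μ)) (hv : par.Valid M μ)
include hP hv

theorem continuousOn_gradient_Ψ {c₁ c₂ : ℝ} (hc₁ : 0 < c₁) (hc₂ : 0 < c₂) :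
    ContinuousOn (∇ (P.Ψ par c₁ c₂)) (P.U par) := by
  refine LipschitzOnWith.continuousOn (K := Real.toNNReal (psiLip par p M μ * (1 + c₁ + c₂))) ?_
  refine LipschitzOnWith.of_dist_le_mul fun u hu u' hu' => ?_
  have := psiLip_pos (p := p) hv
  rw [dist_eq_norm, dist_eq_norm, Real.coe_toNNReal _ (by positivity)]
  exact norm_gradient_Ψ_sub_le hP hv hc₁ hc₂ hu hu'

theorem measurable_stat {c₁ c₂ : ℝ} (hc₁ : 0 < c₁) (hc₂ : 0 < c₂) {α : Type*}
    [MeasurableSpace α] {u : α → XYZ m n p} (hu : Measurable u) (hU : ∀ a, u a ∈ P.U par) :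
    Measurable fun a => P.stat par c₁ c₂ (u a) :=
  measurable_infDist_normalCone (continuousOn_gradient_Ψ hP hv hc₁ hc₂) hu hU

theorem measurable_batchDirection (c₁ c₂ : ℝ) {w₀ : Vec n} (hw₀ : w₀ ∈ P.Y) {s r q : ℕ} :
    Measurable fun a : P.U par × Batch Ωξ Ωζ s r q =>
      P.batchDirection par c₁ c₂ w₀ (a.1 : XYZ m n p) a.2 := by
  have hu : Measurable fun a : P.U par × Batch Ωξ Ωζ s r q => (a.1 : XYZ m n p) :=
    _root_.measurable_fst.subtype_val
  have hb : Measurable fun a : P.U par × Batch Ωξ Ωζ s r q => a.2 := _root_.measurable_snd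
  have hs := measurable_salmIter (par := par) hP (measurable_fst (measurable_fst' hu))
    (measurable_snd' hu) (fun a => a.1.2.1.1) hw₀ s
    (fun i _ => (measurable_pi_apply i).comp hb.fst)
  exact measurable_direction hP c₁ c₂ hu hs.fst hs.snd hb.snd.fst hb.snd.snd (fun a => a.1.2)
    fun a => (salmIter_mem hP hv a.1.2.1.1 a.1.2.2 hw₀ _ s).1

variable {c₁ c₂ α : ℝ} {s r q : ℕ} {w₀ : ℕ → Vec n} {u₀ : XYZ m n p} {Ω : Type u₃}
  [MeasurableSpace Ω] {Pr : Measure Ω} {b : ℕ → Ω → Batch Ωξ Ωζ s r q} {S : Finset ℕ} {R : Ω → ℕ}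

/-- The batch of iteration `k` is independent of `u^k`, so that the mean square error of the
direction is bounded as at a fixed point. -/
theorem lintegral_sq_norm_batchDirection_iterate_le (hc₁ : 0 < c₁) (hc₂ : 0 < c₂) (hs : 0 < s)
    (hr : 0 < r) (hq : 0 < q) (hw₀ : ∀ k, w₀ k ∈ P.Y) (hu₀ : u₀ ∈ P.U par)
    (hb : P.IsSampling Pr b S R) (k : ℕ) :
    ∫⁻ ω, ENNReal.ofReal (‖P.batchDirection par c₁ c₂ (w₀ k)
        (P.iterate par c₁ c₂ α w₀ u₀ (fun i => b i ω) k) (b k ω) -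
        ∇ (P.Ψ par c₁ c₂) (P.iterate par c₁ c₂ α w₀ u₀ (fun i => b i ω) k)‖ ^ 2) ∂Pr ≤
      ENNReal.ofReal (errConst par p M * (1 / r + c₁ ^ 2 / q + c₁ ^ 2 / s)) := by
  have hprob := hb.prob
  let X : Ω → P.U par := fun ω =>
    ⟨P.iterate par c₁ c₂ α w₀ u₀ (fun i => b i ω) k, iterate_mem hP hu₀ _ k⟩
  have hXm : ∀ {mα : MeasurableSpace Ω}, (∀ i < k, Measurable[mα] (b i)) → Measurable[mα] X := by
    intro mα hi
    exact (measurable_iterate hP c₁ c₂ α hw₀ hu₀ hv k hi).subtype_mk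
  have hX : Measurable X := hXm fun i _ => hb.b_meas i
  have hind : IndepFun X (b k) Pr := by
    refine indepFun_of_measurable_iSup (f := b) (S := {i | i < k}) (k := k) hb.b_meas hb.b_indep
      (by simp) (hXm fun i hi => ?_)
    exact measurable_of_mem_iSup b hi
  have hφ : Measurable fun a : P.U par × Batch Ωξ Ωζ s r q =>
      ENNReal.ofReal (‖P.batchDirection par c₁ c₂ (w₀ k) (a.1 : XYZ m n p) a.2 -
        ∇ (P.Ψ par c₁ c₂) (a.1 : XYZ m n p)‖ ^ 2) := by
    have h1 := measurable_batchDirection hP hv c₁ c₂ (hw₀ k) (s := s) (r := r) (q := q)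
    have h2 := measurable_comp_of_continuousOn (continuousOn_gradient_Ψ hP hv hc₁ hc₂)
      (show Measurable fun a : P.U par × Batch Ωξ Ωζ s r q => (a.1 : XYZ m n p) from
        _root_.measurable_fst.subtype_val) fun a => a.1.2
    exact ((h1.sub h2).norm.pow_const 2).ennreal_ofReal
  refine (lintegral_indep hX (hb.b_meas k) hind hφ).le.trans ?_
  rw [hb.b_law k]
  refine (lintegral_mono fun ω =>
    lintegral_sq_norm_direction_sub_le hP hv hc₁ c₂ (X ω).2 (hw₀ k) hs hr hq).trans_eq ?_
  simp

/-- Telescoping the decrease of `Ψ` along the iterates. -/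
theorem sum_sq_stat_iterate_le {L Δ : ℝ} (hL : ∀ u ∈ P.U par, ∀ u' ∈ P.U par,
      ‖∇ (P.Ψ par c₁ c₂) u - ∇ (P.Ψ par c₁ c₂) u'‖ ≤ L * ‖u - u'‖) (hα : 0 < α)
    (hLα : 2 * L * α < 1) (hu₀ : u₀ ∈ P.U par)
    (hΔ : ∀ u ∈ P.U par, P.Ψ par c₁ c₂ u₀ - P.Ψ par c₁ c₂ u ≤ Δ)
    (b : ℕ → Batch Ωξ Ωζ s r q) (K : ℕ) :
    ∑ k ∈ Finset.range K, P.stat par c₁ c₂ (P.iterate par c₁ c₂ α w₀ u₀ b (k + 1)) ^ 2 ≤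
      18 * Δ / α + ∑ k ∈ Finset.range K, 11 * ‖P.batchDirection par c₁ c₂ (w₀ k)
        (P.iterate par c₁ c₂ α w₀ u₀ b k) (b k) -
        ∇ (P.Ψ par c₁ c₂) (P.iterate par c₁ c₂ α w₀ u₀ b k)‖ ^ 2 := by
  set v := P.iterate par c₁ c₂ α w₀ u₀ b with hvdef
  have hmem : ∀ k, v k ∈ P.U par := iterate_mem hP hu₀ b
  have h1 : ∀ k ∈ Finset.range K, P.stat par c₁ c₂ (v (k + 1)) ^ 2 ≤
      18 / α * (P.Ψ par c₁ c₂ (v k) - P.Ψ par c₁ c₂ (v (k + 1))) +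
        11 * ‖P.batchDirection par c₁ c₂ (w₀ k) (v k) (b k) - ∇ (P.Ψ par c₁ c₂) (v k)‖ ^ 2 :=
    fun k _ => sq_infDist_normalCone_proj_le (compact_U hP).isClosed (convex_U hP)
      (fun u hu => differentiableAt_Ψ hP hv hu c₁ c₂) hL hα hLα (hmem k) _
  refine (Finset.sum_le_sum h1).trans ?_
  rw [Finset.sum_add_distrib, ← Finset.mul_sum,
    Finset.sum_range_sub' (fun k => P.Ψ par c₁ c₂ (v k))]
  have h2 := mul_le_mul_of_nonneg_left (hΔ (v K) (hmem K)) (by positivity : 0 ≤ 18 / α)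
  have h3 : 18 * Δ / α = 18 / α * Δ := by ring
  rw [h3]
  exact add_le_add_left h2 _

theorem measurable_sq_stat_iterate (hc₁ : 0 < c₁) (hc₂ : 0 < c₂) (hw₀ : ∀ k, w₀ k ∈ P.Y)
    (hu₀ : u₀ ∈ P.U par) (hb : ∀ k, Measurable (b k)) (k : ℕ) :
    Measurable fun ω => ENNReal.ofReal
      (P.stat par c₁ c₂ (P.iterate par c₁ c₂ α w₀ u₀ (fun i => b i ω) k) ^ 2) :=
  ((measurable_stat hP hv hc₁ hc₂ (measurable_iterate hP c₁ c₂ α hw₀ hu₀ hv k fun i _ => hb i)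
    fun _ => iterate_mem hP hu₀ _ k).pow_const 2).ennreal_ofReal

/-- The sum of the expected squared stationarity measures of `u^1, …, u^K`. -/
theorem sum_lintegral_sq_stat_le (hc₁ : 0 < c₁) (hc₂ : 0 < c₂) {L Δ : ℝ}
    (hL : ∀ u ∈ P.U par, ∀ u' ∈ P.U par,
      ‖∇ (P.Ψ par c₁ c₂) u - ∇ (P.Ψ par c₁ c₂) u'‖ ≤ L * ‖u - u'‖) (hα : 0 < α)
    (hLα : 2 * L * α < 1) (hs : 0 < s) (hr : 0 < r) (hq : 0 < q) (hw₀ : ∀ k, w₀ k ∈ P.Y)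
    (hu₀ : u₀ ∈ P.U par) (hΔ : ∀ u ∈ P.U par, P.Ψ par c₁ c₂ u₀ - P.Ψ par c₁ c₂ u ≤ Δ)
    (hb : P.IsSampling Pr b S R) (K : ℕ) :
    ∑ k ∈ Finset.range K, ∫⁻ ω, ENNReal.ofReal
      (P.stat par c₁ c₂ (P.iterate par c₁ c₂ α w₀ u₀ (fun i => b i ω) (k + 1)) ^ 2) ∂Pr ≤
    ENNReal.ofReal (18 * Δ / α +
      11 * (K * (errConst par p M * (1 / r + c₁ ^ 2 / q + c₁ ^ 2 / s)))) := by
  have hprob := hb.prob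
  have hΔ0 : 0 ≤ Δ := by simpa using hΔ u₀ hu₀
  have hE := errConst_pos (p := p) hv
  set τ := errConst par p M * (1 / r + c₁ ^ 2 / q + c₁ ^ 2 / s) with hτ
  have hτ0 : 0 ≤ τ := by positivity
  rw [← lintegral_finsetSum _ fun k _ =>
    measurable_sq_stat_iterate hP hv hc₁ hc₂ hw₀ hu₀ hb.b_meas (k + 1)]
  set e : ℕ → Ω → ℝ := fun k ω => ‖P.batchDirection par c₁ c₂ (w₀ k)
    (P.iterate par c₁ c₂ α w₀ u₀ (fun i => b i ω) k) (b k ω) -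
    ∇ (P.Ψ par c₁ c₂) (P.iterate par c₁ c₂ α w₀ u₀ (fun i => b i ω) k)‖ ^ 2 with he
  have he_meas : ∀ k, Measurable fun ω => ENNReal.ofReal (e k ω) := by
    intro k
    have hm := measurable_iterate hP c₁ c₂ α hw₀ hu₀ hv k fun i _ => hb.b_meas i
    have hU : ∀ ω, P.iterate par c₁ c₂ α w₀ u₀ (fun i => b i ω) k ∈ P.U par := fun ω =>
      iterate_mem hP hu₀ _ k
    have h1 := (measurable_batchDirection hP hv c₁ c₂ (hw₀ k) (s := s) (r := r) (q := q)).comp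
      ((hm.subtype_mk (h := hU)).prodMk (hb.b_meas k))
    have h2 := measurable_comp_of_continuousOn (continuousOn_gradient_Ψ hP hv hc₁ hc₂) hm hU
    exact ((h1.sub h2).norm.pow_const 2).ennreal_ofReal
  have hpt : ∀ ω, ∑ k ∈ Finset.range K, ENNReal.ofReal
      (P.stat par c₁ c₂ (P.iterate par c₁ c₂ α w₀ u₀ (fun i => b i ω) (k + 1)) ^ 2) ≤
      ENNReal.ofReal (18 * Δ / α) +
        ∑ k ∈ Finset.range K, ENNReal.ofReal 11 * ENNReal.ofReal (e k ω) := by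
    intro ω
    rw [← ENNReal.ofReal_sum_of_nonneg fun _ _ => sq_nonneg _]
    refine (ENNReal.ofReal_le_ofReal (sum_sq_stat_iterate_le hP hv hL hα hLα hu₀ hΔ
      (fun i => b i ω) K)).trans_eq ?_
    rw [ENNReal.ofReal_add (by positivity) (Finset.sum_nonneg fun _ _ => by positivity),
      ENNReal.ofReal_sum_of_nonneg fun _ _ => by positivity]
    congr 1
    exact Finset.sum_congr rfl fun k _ => ENNReal.ofReal_mul (by norm_num)
  refine (lintegral_mono hpt).trans ?_
  rw [lintegral_add_left measurable_const, lintegral_const, measure_univ, mul_one,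
    lintegral_finsetSum _ fun k _ => (he_meas k).const_mul _]
  have hsum : ∑ k ∈ Finset.range K, ∫⁻ ω, ENNReal.ofReal 11 * ENNReal.ofReal (e k ω) ∂Pr ≤
      ∑ _k ∈ Finset.range K, ENNReal.ofReal (11 * τ) := by
    refine Finset.sum_le_sum fun k _ => ?_
    rw [lintegral_const_mul _ (he_meas k), ENNReal.ofReal_mul (by norm_num)]
    gcongr
    exact lintegral_sq_norm_batchDirection_iterate_le hP hv hc₁ hc₂ hs hr hq hw₀ hu₀ hb k
  refine (add_le_add_right hsum _).trans_eq ?_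
  rw [← ENNReal.ofReal_sum_of_nonneg fun _ _ => by positivity,
    ← ENNReal.ofReal_add (by positivity) (Finset.sum_nonneg fun _ _ => by positivity)]
  congr 2
  rw [Finset.sum_const, Finset.card_range, nsmul_eq_mul]
  ring

/-- For an output index that is uniform on `S` and independent of the samples, the expectation is
the average over `S`. -/
theorem expStatLE_of_sum_le (hc₁ : 0 < c₁) (hc₂ : 0 < c₂) (hw₀ : ∀ k, w₀ k ∈ P.Y)
    (hu₀ : u₀ ∈ P.U par) (hS : S.Nonempty) (hb : P.IsSampling Pr b S R) {τ : ℝ} (hτ : 0 ≤ τ)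
    (hsum : ∑ k ∈ S, ∫⁻ ω, ENNReal.ofReal
      (P.stat par c₁ c₂ (P.iterate par c₁ c₂ α w₀ u₀ (fun i => b i ω) k) ^ 2) ∂Pr ≤
      ENNReal.ofReal (S.card * τ)) :
    P.ExpStatLE par c₁ c₂ α w₀ u₀ Pr b R τ := by
  have hprob := hb.prob
  have hcard : (0 : ℝ) < S.card := Nat.cast_pos.2 hS.card_pos
  let Z : Ω → ℕ → Batch Ωξ Ωζ s r q := fun ω k => b k ω
  have hZ : Measurable Z := measurable_pi_lambda _ fun k => hb.b_meas k
  let σ : ℕ × (ℕ → Batch Ωξ Ωζ s r q) → ℝ := fun a =>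
    P.stat par c₁ c₂ (P.iterate par c₁ c₂ α w₀ u₀ a.2 a.1) ^ 2
  have hσ : Measurable σ := by
    refine measurable_from_prod_countable_right fun k => ?_
    have h1 : Measurable fun c : ℕ → Batch Ωξ Ωζ s r q => P.iterate par c₁ c₂ α w₀ u₀ c k :=
      measurable_iterate hP c₁ c₂ α hw₀ hu₀ hv k (b := fun i (c : ℕ → Batch Ωξ Ωζ s r q) => c i)
        fun i _ => measurable_pi_apply i
    exact (measurable_stat hP hv hc₁ hc₂ h1 fun c => iterate_mem hP hu₀ _ k).pow_const 2
  have hσ0 : ∀ a, 0 ≤ σ a := fun a => sq_nonneg _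
  have hσR : Measurable fun ω => σ (R ω, Z ω) := hσ.comp (hb.R_meas.prodMk hZ)
  have hset : ∀ k, MeasurableSet {ω | R ω = k} := fun k =>
    hb.R_meas (measurableSet_singleton k)
  have hlaw : ∀ k ∈ S, Pr {ω | R ω = k} = ENNReal.ofReal (1 / S.card) := by
    intro k hk
    rw [← hb.R_law k hk, ofReal_measureReal]
  -- The index lies in `S` almost surely, since the masses of the points of `S` add up to one.
  have hRS : ∀ᵐ ω ∂Pr, R ω ∈ S := by
    have h1 : Pr {ω | R ω ∈ S} = 1 := by
      have h2 : {ω | R ω ∈ S} = ⋃ k ∈ S, {ω | R ω = k} := by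
        ext ω
        simp
      have h3 : Set.PairwiseDisjoint (S : Set ℕ) fun k => {ω | R ω = k} := fun i _ j _ hij =>
        Set.disjoint_left.2 fun ω (hi : R ω = i) (hj : R ω = j) => hij (hi.symm.trans hj)
      rw [h2, measure_biUnion_finset h3 fun k _ => hset k,
        Finset.sum_congr rfl hlaw, Finset.sum_const, nsmul_eq_mul, ← ENNReal.ofReal_natCast,
        ← ENNReal.ofReal_mul hcard.le, mul_one_div_cancel hcard.ne', ENNReal.ofReal_one]
    exact (prob_compl_eq_zero_iff (hb.R_meas (S.measurableSet))).2 h1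
  let g : ℕ → ENNReal := fun k => ∫⁻ ω, ENNReal.ofReal (σ (k, Z ω)) ∂Pr
  have hlin : ∫⁻ ω, ENNReal.ofReal (σ (R ω, Z ω)) ∂Pr ≤ ENNReal.ofReal τ := by
    have h1 : ∫⁻ ω, ENNReal.ofReal (σ (R ω, Z ω)) ∂Pr = ∫⁻ ω, g (R ω) ∂Pr := by
      rw [lintegral_indep hb.R_meas hZ hb.R_indep hσ.ennreal_ofReal]
      refine lintegral_congr fun ω => ?_
      exact lintegral_map (f := fun c => ENNReal.ofReal (σ (R ω, c)))
        (hσ.ennreal_ofReal.comp measurable_prodMk_left) hZ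
    have h2 : ∫⁻ ω, g (R ω) ∂Pr =
        ∫⁻ ω, ∑ k ∈ S, {ω | R ω = k}.indicator (fun _ => g k) ω ∂Pr := by
      refine lintegral_congr_ae ?_
      filter_upwards [hRS] with ω hω
      rw [Finset.sum_eq_single_of_mem (R ω) hω]
      · simp
      · intro k _ hk
        exact Set.indicator_of_notMem (fun h : R ω = k => hk h.symm) _
    have h3 : ∀ k ∈ S, ∫⁻ ω, {ω | R ω = k}.indicator (fun _ => g k) ω ∂Pr =
        g k * ENNReal.ofReal (1 / S.card) := by
      intro k hk
      rw [lintegral_indicator_const (hset k), hlaw k hk]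
    rw [h1, h2, lintegral_finsetSum _ fun k _ => measurable_const.indicator (hset k),
      Finset.sum_congr rfl h3, ← Finset.sum_mul]
    refine (mul_le_mul_left hsum _).trans_eq ?_
    rw [← ENNReal.ofReal_mul (by positivity)]
    congr 1
    field_simp
  refine ⟨?_, ?_⟩
  · refine (lintegral_ofReal_ne_top_iff_integrable hσR.aestronglyMeasurable
      (Eventually.of_forall fun ω => hσ0 _)).1 (ne_top_of_le_ne_top ENNReal.ofReal_ne_top hlin)
  · refine (integral_eq_lintegral_of_nonneg_ae (Eventually.of_forall fun ω => hσ0 (R ω, Z ω))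
      hσR.aestronglyMeasurable).trans_le ?_
    exact ENNReal.toReal_le_of_le_ofReal hτ hlin

/-- The constant of the convergence rate: `18` multiplies the decrease of `Ψ` and `11` the error of
the direction in `sq_infDist_normalCone_proj_le`. -/
def rateConst (par : Params) (p : ℕ) (M : ℝ) : ℝ := 18 + 11 * errConst par p M

omit hP in
theorem rateConst_pos : 0 < rateConst par p M := by
  have := errConst_pos (p := p) hv
  unfold rateConst
  positivity

omit hP in
theorem average_le_rate {Δ : ℝ} (hΔ : 0 ≤ Δ) (hα : 0 < α) {K : ℕ} (hK : 0 < K) :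
    18 * Δ / α + 11 * (K * (errConst par p M * (1 / r + c₁ ^ 2 / q + c₁ ^ 2 / s))) ≤
      K * (rateConst par p M * (Δ / (α * K) + 1 / r + c₁ ^ 2 / q + c₁ ^ 2 / s)) := by
  have hE := errConst_pos (p := p) hv
  have hK' : (0 : ℝ) < K := Nat.cast_pos.2 hK
  have h1 : 0 ≤ 11 * errConst par p M * (Δ / α) := by positivity
  have h2 : 0 ≤ 18 * K * (1 / (r : ℝ) + c₁ ^ 2 / q + c₁ ^ 2 / s) := by positivity
  have h3 : (K : ℝ) * (rateConst par p M * (Δ / (α * K) + 1 / r + c₁ ^ 2 / q + c₁ ^ 2 / s)) =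
      18 * Δ / α + 11 * (K * (errConst par p M * (1 / r + c₁ ^ 2 / q + c₁ ^ 2 / s))) +
      (11 * errConst par p M * (Δ / α) + 18 * K * (1 / (r : ℝ) + c₁ ^ 2 / q + c₁ ^ 2 / s)) := by
    have h4 : Δ / (α * K) = Δ / α / K := by rw [div_div]
    rw [h4]
    unfold rateConst
    generalize 1 / (r : ℝ) = A
    generalize c₁ ^ 2 / (q : ℝ) = B
    generalize c₁ ^ 2 / (s : ℝ) = D
    field_simp
    ring
  linarith

variable {L Δ : ℝ} {K : ℕ} (hc₁ : 0 < c₁) (hc₂ : 0 < c₂)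
    (hL : ∀ u ∈ P.U par, ∀ u' ∈ P.U par,
      ‖∇ (P.Ψ par c₁ c₂) u - ∇ (P.Ψ par c₁ c₂) u'‖ ≤ L * ‖u - u'‖) (hα : 0 < α)
    (hLα : 2 * L * α < 1) (hK : 0 < K) (hr : 0 < r) (hq : 0 < q) (hs : 0 < s)
    (hw₀ : ∀ k, w₀ k ∈ P.Y)
    (hu₀ : u₀ ∈ P.U par) (hΔ : ∀ u ∈ P.U par, P.Ψ par c₁ c₂ u₀ - P.Ψ par c₁ c₂ u ≤ Δ)
include hc₁ hc₂ hL hα hLα hK hr hq hs hw₀ hu₀ hΔ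

theorem expStatLE_Icc (hb : P.IsSampling Pr b (Finset.Icc 1 K) R) :
    P.ExpStatLE par c₁ c₂ α w₀ u₀ Pr b R
      (rateConst par p M * (Δ / (α * K) + 1 / r + c₁ ^ 2 / q + c₁ ^ 2 / s)) := by
  have hΔ0 : 0 ≤ Δ := by simpa using hΔ u₀ hu₀
  have hC := rateConst_pos (p := p) hv
  refine expStatLE_of_sum_le hP hv hc₁ hc₂ hw₀ hu₀ (Finset.nonempty_Icc.2 hK) hb
    (by positivity) ?_
  have h1 := sum_lintegral_sq_stat_le hP hv hc₁ hc₂ hL hα hLα hs hr hq hw₀ hu₀ hΔ hb K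
  rw [Finset.range_eq_Ico, Finset.sum_Ico_add' (fun k => ∫⁻ ω, ENNReal.ofReal
      (P.stat par c₁ c₂ (P.iterate par c₁ c₂ α w₀ u₀ (fun i => b i ω) k) ^ 2) ∂Pr), zero_add,
    Finset.Ico_add_one_right_eq_Icc] at h1
  refine h1.trans (ENNReal.ofReal_le_ofReal ?_)
  rw [Nat.card_Icc, Nat.add_sub_cancel]
  exact average_le_rate hv hΔ0 hα hK

theorem expStatLE_range (hb : P.IsSampling Pr b (Finset.range K) R) :
    P.ExpStatLE par c₁ c₂ α w₀ u₀ Pr b R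
      (rateConst par p M * (Δ / (α * K) + 1 / r + c₁ ^ 2 / q + c₁ ^ 2 / s)
        + P.stat par c₁ c₂ u₀ ^ 2 / K) := by
  have hprob := hb.prob
  have hΔ0 : 0 ≤ Δ := by simpa using hΔ u₀ hu₀
  have hC := rateConst_pos (p := p) hv
  have hK' : (0 : ℝ) < K := Nat.cast_pos.2 hK
  refine expStatLE_of_sum_le hP hv hc₁ hc₂ hw₀ hu₀ (Finset.nonempty_range_iff.2 hK.ne') hb
    (by positivity) ?_
  have h1 := sum_lintegral_sq_stat_le hP hv hc₁ hc₂ hL hα hLα hs hr hq hw₀ hu₀ hΔ hb K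
  -- The sum over `u^0, …, u^{K-1}` is at most the initial term plus the sum over `u^1, …, u^K`.
  refine (Finset.sum_le_sum_of_subset
    (Finset.range_subset_range.2 (Nat.le_succ K))).trans ?_
  rw [Finset.sum_range_succ']
  refine (add_le_add_left h1 _).trans ?_
  simp only [iterate, lintegral_const, measure_univ, mul_one]
  rw [← ENNReal.ofReal_add (by have := errConst_pos (p := p) hv; positivity) (sq_nonneg _)]
  refine ENNReal.ofReal_le_ofReal ?_
  rw [Finset.card_range, mul_add (K : ℝ) _ (_ / (K : ℝ)), mul_div_cancel₀ _ hK'.ne']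
  exact add_le_add_left (average_le_rate hv hΔ0 hα hK) _

end

end Problem

/-! ### The choice of the parameters -/

theorem Constants.one_le_bound (κ : Constants) : 1 ≤ κ.bound := by
  have : 0 ≤ |κ.LF| + |κ.LG| + |κ.LH| + |κ.MG| + |κ.MH0| + |κ.MH1| + |κ.σf| + |κ.σg| := by
    positivity
  unfold Constants.bound
  linarith

theorem natCeil_pos_and_le {t B : ℝ} (ht : 0 < t) (hB : t + 1 ≤ B) :
    0 < ⌈t⌉₊ ∧ t ≤ (⌈t⌉₊ : ℝ) ∧ (⌈t⌉₊ : ℝ) ≤ B :=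
  ⟨Nat.ceil_pos.2 ht, Nat.le_ceil t, (Nat.ceil_lt_add_one ht.le).le.trans hB⟩

/-- The step size `a / c` with `a = 1 / (4 Λ (1 / c₀ + 2))` is admissible. -/
theorem two_mul_lip_mul_step_lt_one {Λ c₀ c₁ c₂ c : ℝ} (hΛ : 0 < Λ) (hc₀ : 0 < c₀) (h₁ : c₁ ≤ c)
    (h₂ : c₂ ≤ c) (h : c₀ ≤ c) :
    2 * (Λ * (1 + c₁ + c₂)) * (1 / (4 * Λ * (1 / c₀ + 2)) / c) < 1 := by
  have hc : 0 < c := hc₀.trans_le h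
  have h3 : 1 + c₁ + c₂ ≤ (1 / c₀ + 2) * c := by
    have : 1 ≤ c / c₀ := (one_le_div hc₀).2 h
    have : (1 / c₀ + 2) * c = c / c₀ + 2 * c := by ring
    linarith
  calc _ ≤ 2 * (Λ * ((1 / c₀ + 2) * c)) * (1 / (4 * Λ * (1 / c₀ + 2)) / c) := by gcongr
    _ = 1 / 2 := by
        have : 1 / c₀ + 2 ≠ 0 := by positivity
        generalize 1 / c₀ + 2 = T at *
        field_simp
        norm_num
    _ < 1 := by norm_num

/-- With the prescribed batch sizes and iteration number, every term of the rate is at most a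
multiple of `ε / A`. -/
theorem rate_add_le {C Δ a A c c₁ ε S : ℝ} {K r q s : ℕ} (hC : 0 < C) (hΔ : 0 ≤ Δ) (ha : 0 < a)
    (hA : A = C * (Δ / a + 3) + Δ + 1) (hc : 0 < c) (hc₁ : 0 < c₁) (hε : 0 < ε)
    (hK : A * c / ε ≤ K) (hr : A / ε ≤ r) (hq : A * c₁ ^ 2 / ε ≤ q) (hs : A * c₁ ^ 2 / ε ≤ s)
    (hS : S ≤ c * Δ) :
    C * (Δ / (a / c * K) + 1 / r + c₁ ^ 2 / q + c₁ ^ 2 / s) + S / K ≤ ε := by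
  have hA0 : 0 < A := by
    rw [hA]
    positivity
  have hK0 : 0 < A * c / ε := by positivity
  have hr0 : 0 < A / ε := by positivity
  have hq0 : 0 < A * c₁ ^ 2 / ε := by positivity
  have hK' := hK0.trans_le hK
  have h1 : Δ / (a / c * K) ≤ Δ / (a / c * (A * c / ε)) := by gcongr
  have h2 : 1 / (r : ℝ) ≤ 1 / (A / ε) := one_div_le_one_div_of_le hr0 hr
  have h3 : c₁ ^ 2 / (q : ℝ) ≤ c₁ ^ 2 / (A * c₁ ^ 2 / ε) := by gcongr
  have h4 : c₁ ^ 2 / (s : ℝ) ≤ c₁ ^ 2 / (A * c₁ ^ 2 / ε) := by gcongr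
  have h5 : S / K ≤ c * Δ / (A * c / ε) :=
    (div_le_div_of_nonneg_right hS hK'.le).trans (by gcongr)
  have e1 : Δ / (a / c * (A * c / ε)) = Δ / a * (ε / A) := by field_simp
  have e2 : 1 / (A / ε) = ε / A := one_div_div _ _
  have e3 : c₁ ^ 2 / (A * c₁ ^ 2 / ε) = ε / A := by field_simp
  have e5 : c * Δ / (A * c / ε) = Δ * (ε / A) := by field_simp
  have h6 : C * (Δ / (a / c * K) + 1 / r + c₁ ^ 2 / q + c₁ ^ 2 / s) ≤
      C * (Δ / a * (ε / A) + ε / A + ε / A + ε / A) := by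
    exact mul_le_mul_of_nonneg_left (by linarith) hC.le
  have h7 : C * (Δ / a * (ε / A) + ε / A + ε / A + ε / A) + Δ * (ε / A) = (A - 1) * (ε / A) := by
    rw [hA]
    ring
  have h8 : (A - 1) * (ε / A) ≤ A * (ε / A) := by gcongr; linarith
  have h9 : A * (ε / A) = ε := mul_div_cancel₀ _ hA0.ne'
  linarith

/-- The rounding up in the sample sizes costs a constant factor, since `c₁ ≥ c₀` and `ε ≤ 1`. -/
theorem sample_bounds {A c₀ c₁ c ε : ℝ} {K r q : ℕ} (hA : 0 < A) (hc₀ : 0 < c₀) (h₁ : c₀ ≤ c₁)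
    (hc : c₁ ≤ c) (hε : 0 < ε) (hε1 : ε ≤ 1) (hK : K = ⌈A * c / ε⌉₊) (hr : r = ⌈A / ε⌉₊)
    (hq : q = ⌈A * c₁ ^ 2 / ε⌉₊) :
    (0 < K ∧ A * c / ε ≤ K ∧ (K : ℝ) ≤ (A + 1 / c₀) * c / ε) ∧
      (0 < r ∧ A / ε ≤ r ∧ (r : ℝ) ≤ (A + 1) / ε) ∧
      (0 < q ∧ A * c₁ ^ 2 / ε ≤ q ∧ (q : ℝ) ≤ (A + 1 / c₀ ^ 2) * c₁ ^ 2 / ε) := by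
  have hc₁ : 0 < c₁ := hc₀.trans_le h₁
  have hcp : 0 < c := hc₁.trans_le hc
  have key : ∀ t : ℝ, 1 ≤ t → 1 ≤ t / ε := fun t ht => by
    rw [one_le_div hε]
    linarith
  refine ⟨?_, ?_, ?_⟩
  · rw [hK]
    refine natCeil_pos_and_le (by positivity) ?_
    have h3 := key (c / c₀) ((one_le_div hc₀).2 (h₁.trans hc))
    have e : (A + 1 / c₀) * c / ε = A * c / ε + c / c₀ / ε := by ring
    linarith
  · rw [hr]
    refine natCeil_pos_and_le (by positivity) ?_
    have h3 := key 1 le_rfl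
    have e : (A + 1) / ε = A / ε + 1 / ε := by ring
    linarith
  · rw [hq]
    refine natCeil_pos_and_le (by positivity) ?_
    have h3 := key (c₁ ^ 2 / c₀ ^ 2) ((one_le_div (by positivity)).2 (by gcongr))
    have e : (A + 1 / c₀ ^ 2) * c₁ ^ 2 / ε = A * c₁ ^ 2 / ε + c₁ ^ 2 / c₀ ^ 2 / ε := by ring
    linarith

end SALVF

end

theorem mainTheorem5 (p : ℕ) (κ : SALVF.Constants) (par : SALVF.Params)
    (hμ : 0 < κ.μG) (hγ₁ : 0 < par.γ₁) (hγ₂ : 0 < par.γ₂)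
    (hη : 1 / κ.μG ≤ par.η) (hρ : 1 / par.γ₂ ≤ par.ρ) (hB : 0 ≤ par.B) :
    ∃ CL > (0 : ℝ), ∃ C > (0 : ℝ),
      -- `Ψ` is differentiable on `U`, and `∇Ψ` is Lipschitz with modulus `CL (1 + c₁ + c₂)`
      (∀ (m n : ℕ) (Ωξ : Type u₁) (Ωζ : Type u₂) [MeasurableSpace Ωξ] [MeasurableSpace Ωζ]
        (P : SALVF.Problem m n p Ωξ Ωζ), P.Assumptions κ →
        ∀ c₁ c₂ : ℝ, 0 < c₁ → 0 < c₂ →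
          (∀ u ∈ P.U par, DifferentiableAt ℝ (P.Ψ par c₁ c₂) u) ∧
          ∀ u ∈ P.U par, ∀ u' ∈ P.U par,
            ‖∇ (P.Ψ par c₁ c₂) u - ∇ (P.Ψ par c₁ c₂) u'‖ ≤ CL * (1 + c₁ + c₂) * ‖u - u'‖) ∧
      -- the rate
      (∀ (m n : ℕ) (Ωξ : Type u₁) (Ωζ : Type u₂) [MeasurableSpace Ωξ] [MeasurableSpace Ωζ]
        (P : SALVF.Problem m n p Ωξ Ωζ), P.Assumptions κ →
        ∀ c₁ c₂ : ℝ, 0 < c₁ → 0 < c₂ →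
        -- any Lipschitz modulus `L` of `∇Ψ` on `U`, any step size `α < 1 / (2 L)`
        ∀ L : ℝ, 0 ≤ L →
        (∀ u ∈ P.U par, ∀ u' ∈ P.U par,
          ‖∇ (P.Ψ par c₁ c₂) u - ∇ (P.Ψ par c₁ c₂) u'‖ ≤ L * ‖u - u'‖) →
        ∀ α : ℝ, 0 < α → 2 * L * α < 1 →
        ∀ K r q s : ℕ, 0 < K → 0 < r → 0 < q → 0 < s →
        ∀ w₀ : ℕ → SALVF.Vec n, (∀ k, w₀ k ∈ P.Y) →
        ∀ u₀ ∈ P.U par, ∀ Δ : ℝ, (∀ u ∈ P.U par, P.Ψ par c₁ c₂ u₀ - P.Ψ par c₁ c₂ u ≤ Δ) →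
        ∀ (Ω : Type u₃) [MeasurableSpace Ω] (Pr : Measure Ω)
          (b : ℕ → Ω → SALVF.Batch Ωξ Ωζ s r q) (R : Ω → ℕ),
          (P.IsSampling Pr b (Finset.Icc 1 K) R →
            P.ExpStatLE par c₁ c₂ α w₀ u₀ Pr b R
              (C * (Δ / (α * K) + 1 / r + c₁ ^ 2 / q + c₁ ^ 2 / s))) ∧
          (P.IsSampling Pr b (Finset.range K) R →
            P.ExpStatLE par c₁ c₂ α w₀ u₀ Pr b R
              (C * (Δ / (α * K) + 1 / r + c₁ ^ 2 / q + c₁ ^ 2 / s)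
                + P.stat par c₁ c₂ u₀ ^ 2 / K))) ∧
      -- the sample complexity
      (∀ c₀ > (0 : ℝ), ∀ Δ ≥ (0 : ℝ), ∃ a > (0 : ℝ), ∃ A > (0 : ℝ), ∃ C' > (0 : ℝ),
        ∀ c₁ c₂ c ε α : ℝ, c₀ ≤ c₁ → 0 < c₂ → c = max c₁ c₂ → 0 < ε → ε ≤ 1 → α = a / c →
        ∀ K r q s : ℕ, K = ⌈A * c / ε⌉₊ → r = ⌈A / ε⌉₊ → q = ⌈A * c₁ ^ 2 / ε⌉₊ →
          s = ⌈A * c₁ ^ 2 / ε⌉₊ →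
          2 * (CL * (1 + c₁ + c₂)) * α < 1 ∧
          (K * r : ℝ) ≤ C' * c / ε ^ 2 ∧
          (K * (s + q) : ℝ) ≤ C' * c * c₁ ^ 2 / ε ^ 2 ∧
          ∀ (m n : ℕ) (Ωξ : Type u₁) (Ωζ : Type u₂) [MeasurableSpace Ωξ] [MeasurableSpace Ωζ]
            (P : SALVF.Problem m n p Ωξ Ωζ), P.Assumptions κ →
          ∀ w₀ : ℕ → SALVF.Vec n, (∀ k, w₀ k ∈ P.Y) →
          ∀ u₀ ∈ P.U par, (∀ u ∈ P.U par, P.Ψ par c₁ c₂ u₀ - P.Ψ par c₁ c₂ u ≤ Δ) →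
          ∀ (Ω : Type u₃) [MeasurableSpace Ω] (Pr : Measure Ω)
            (b : ℕ → Ω → SALVF.Batch Ωξ Ωζ s r q) (R : Ω → ℕ),
            (P.IsSampling Pr b (Finset.Icc 1 K) R →
              P.ExpStatLE par c₁ c₂ α w₀ u₀ Pr b R ε) ∧
            (P.IsSampling Pr b (Finset.range K) R → P.stat par c₁ c₂ u₀ ^ 2 ≤ c * Δ →
              P.ExpStatLE par c₁ c₂ α w₀ u₀ Pr b R ε)) := by
  have hv : par.Valid κ.bound κ.μG := ⟨κ.one_le_bound, hμ, hγ₁, hγ₂, hη, hρ, hB⟩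
  have hΛ := SALVF.Problem.psiLip_pos (p := p) hv
  have hC := SALVF.Problem.rateConst_pos (p := p) hv
  refine ⟨SALVF.Problem.psiLip par p κ.bound κ.μG, hΛ, SALVF.Problem.rateConst par p κ.bound, hC,
    ?_, ?_, ?_⟩
  · intro m n Ωξ Ωζ _ _ P hP c₁ c₂ hc₁ hc₂
    exact ⟨fun u hu => SALVF.Problem.differentiableAt_Ψ hP.uniform hv hu c₁ c₂,
      fun u hu u' hu' => SALVF.Problem.norm_gradient_Ψ_sub_le hP.uniform hv hc₁ hc₂ hu hu'⟩
  · intro m n Ωξ Ωζ _ _ P hP c₁ c₂ hc₁ hc₂ L _ hL α hα hLα K r q s hK hr hq hs w₀ hw₀ u₀ hu₀ Δ hΔ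
      Ω _ Pr b R
    exact ⟨SALVF.Problem.expStatLE_Icc hP.uniform hv hc₁ hc₂ hL hα hLα hK hr hq hs hw₀ hu₀ hΔ,
      SALVF.Problem.expStatLE_range hP.uniform hv hc₁ hc₂ hL hα hLα hK hr hq hs hw₀ hu₀ hΔ⟩
  · intro c₀ hc₀ Δ hΔ
    have ha : 0 < 1 / (4 * SALVF.Problem.psiLip par p κ.bound κ.μG * (1 / c₀ + 2)) := by positivity
    obtain ⟨A, hA⟩ : ∃ A, A = SALVF.Problem.rateConst par p κ.bound *
      (Δ / (1 / (4 * SALVF.Problem.psiLip par p κ.bound κ.μG * (1 / c₀ + 2))) + 3) + Δ + 1 :=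
      ⟨_, rfl⟩
    have hA0 : 0 < A := by
      rw [hA]
      positivity
    refine ⟨_, ha, A, hA0,
      (A + 1 / c₀) * (A + 1) + 2 * ((A + 1 / c₀) * (A + 1 / c₀ ^ 2)), by positivity, ?_⟩
    intro c₁ c₂ c ε α h₁ hc₂ hc hε hε1 hα K r q s hK hr hq hs
    have hc₁ : 0 < c₁ := hc₀.trans_le h₁
    have hc1 : c₁ ≤ c := hc ▸ le_max_left _ _
    have hc2 : c₂ ≤ c := hc ▸ le_max_right _ _
    have hc0 : 0 < c := hc₁.trans_le hc1
    obtain ⟨⟨hK0, hK1, hK2⟩, ⟨hr0, hr1, hr2⟩, hq0, hq1, hq2⟩ :=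
      SALVF.sample_bounds hA0 hc₀ h₁ hc1 hε hε1 hK hr hq
    have hsq : s = q := hs.trans hq.symm
    have hstep := SALVF.two_mul_lip_mul_step_lt_one hΛ hc₀ hc1 hc2 (h₁.trans hc1)
    rw [← hα] at hstep
    have hα0 : 0 < α := hα ▸ div_pos ha hc0
    refine ⟨hstep, ?_, ?_, ?_⟩
    · calc (K * r : ℝ) ≤ ((A + 1 / c₀) * c / ε) * ((A + 1) / ε) := by gcongr
        _ = (A + 1 / c₀) * (A + 1) * c / ε ^ 2 := by ring
        _ ≤ _ := by
            gcongr
            exact le_add_of_nonneg_right (by positivity)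
    · rw [hsq]
      calc (K * (q + q) : ℝ) ≤ ((A + 1 / c₀) * c / ε) * ((A + 1 / c₀ ^ 2) * c₁ ^ 2 / ε +
            (A + 1 / c₀ ^ 2) * c₁ ^ 2 / ε) := by gcongr
        _ = 2 * ((A + 1 / c₀) * (A + 1 / c₀ ^ 2)) * c * c₁ ^ 2 / ε ^ 2 := by ring
        _ ≤ _ := by
            gcongr
            exact le_add_of_nonneg_left (by positivity)
    · intro m n Ωξ Ωζ _ _ P hP w₀ hw₀ u₀ hu₀ hΔu Ω _ Pr b R
      have hL : ∀ u ∈ P.U par, ∀ u' ∈ P.U par,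
          ‖∇ (P.Ψ par c₁ c₂) u - ∇ (P.Ψ par c₁ c₂) u'‖ ≤
            SALVF.Problem.psiLip par p κ.bound κ.μG * (1 + c₁ + c₂) * ‖u - u'‖ :=
        fun u hu u' hu' => SALVF.Problem.norm_gradient_Ψ_sub_le hP.uniform hv hc₁ hc₂ hu hu'
      have hs0 : 0 < s := hsq ▸ hq0
      have hs1 : A * c₁ ^ 2 / ε ≤ s := hsq ▸ hq1
      have hrate := fun S (hS : S ≤ c * Δ) =>
        SALVF.rate_add_le (S := S) hC hΔ ha hA hc0 hc₁ hε hK1 hr1 hq1 hs1 hS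
      rw [← hα] at hrate
      refine ⟨fun hb => ?_, fun hb hS => ?_⟩
      · have h := SALVF.Problem.expStatLE_Icc hP.uniform hv hc₁ hc₂ hL hα0 hstep hK0 hr0 hq0 hs0
          hw₀ hu₀ hΔu hb
        refine ⟨h.1, h.2.trans ?_⟩
        simpa using hrate 0 (by positivity)
      · have h := SALVF.Problem.expStatLE_range hP.uniform hv hc₁ hc₂ hL hα0 hstep hK0 hr0 hq0 hs0
          hw₀ hu₀ hΔu hb
        exact ⟨h.1, h.2.trans (hrate _ hS)⟩
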